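/- **Lemma 1 (Normal Form Lemma).** *Setting.* Let $n,m\ge 0$. Let $\mathcal R\subset\mathbb R$, $\mathcal I\subset\mathbb R^n$, $\Xi\subset\mathbb R$ be open, connected and bounded, with $0\in\Xi$. For $u=(r,\rho,\xi,s,\delta)$ with positive entries let $$\mathcal P_u=\mathcal R_r\times\mathcal I_\rho\times\Xi_\xi\times\mathbb T^n_s\times B_\delta ,$$ with variables $(\mathrm r,\mathrm I,x,\varphi,p,q)$, where $A_\theta$ is the union of the open complex balls of radius $\theta$ centred at the points of $A$, $\mathbb T_s=\mathbb R/2\pi\mathbb Z+i[-s,s]$, and $B_\delta=\{(p,q)\in\mathbb C^{2m}:|p_l|\le\delta,\ |q_l|\le\delta\}$. Let $\mathcal O_u$ be the set of functions holomorphic on $\mathcal P_v$ for some $v>u$ (componentwise). For $g\in\mathcal O_u$ with Taylor–Fourier expansion $g=\sum_{k\in\mathbb Z^n;\,h,j\in\mathbb N^m}g_{khj}(\mathrm r,\mathrm I,x)e^{ik\cdot\varphi}p^hq^j$ put $$\|g\|_u=\sum_{k,h,j}\ \sup_{\mathcal R_r\times\mathcal I_\rho\times\Xi_\xi}|g_{khj}|\;e^{s|k|}\delta^{|h|+|j|},\qquad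 |k|=\sum_i|k_i| .$$ Let $\overline g$ be the part of the expansion with $k=0$ and $h=j$, and $\widetilde g=g-\overline g$; let $\mathcal N_u=\{g\in\mathcal O_u:\widetilde g=0\}$ and $\mathcal Z_u=\{g\in\mathcal O_u:\overline g=0\}$. Poisson brackets are $$\{F,G\}=\partial_{\mathrm r}F\,\partial_xG-\partial_{\mathrm r}G\,\partial_xF+\sum_i(\partial_{\mathrm I_i}F\,\partial_{\varphi_i}G-\partial_{\mathrm I_i}G\,\partial_{\varphi_i}F)+\sum_l(\partial_{p_l}F\,\partial_{q_l}G-\partial_{p_l}G\,\partial_{q_l}F),$$ $\mathcal L_\chi=\{\chi,\cdot\}$ and $e^{\mathcal L_\chi}=\sum_{j\ge0}\mathcal L_\chi^j/j!$. We say that $\chi\in\mathcal Z_v$ generates a time-one Lie-series map $e^{\mathcal L_\chi}:\mathcal O_u\to\mathcal O_v$ if, for every $g\in\mathcal O_u$, the series $\sum_j\mathcal L_\chi^jg/j!$ converges absolutely in $\|\cdot\|_v$ and its sum belongs to $\mathcal O_v$. *Statement.* For all $n,m$ there is a number $c_{n,m}\ge1$ such that the following holds for all $\mathcal R,\mathcal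 I,\Xi$ and $u=(r,\rho,\xi,s,\delta)$ as above. Let $\mathrm H=\mathrm H_0(\mathrm r,\mathrm I,J(p,q))+f(\mathrm r,\mathrm I,x,\varphi,p,q)$ with $J(p,q)=(p_1q_1,\dots,p_mq_m)$ and $\mathrm H_0\circ(\mathrm r,\mathrm I,J),\,f\in\mathcal O_u$ ($f$ need not be periodic in $x$). Put $\omega_{\mathrm r}=\partial_{\mathrm r}\mathrm H_0$, $\omega_{\mathrm I}=\partial_{\mathrm I}\mathrm H_0$, $\omega_J=\partial_J\mathrm H_0$, and assume that $\omega_{\mathrm r}$ has no zero for $\mathrm r\in\mathcal R_r$, $\mathrm I\in\mathcal I_\rho$, $|J_l|\le\delta^2$. Let $\|\cdot\|$ without index denote the supremum over this set of $(\mathrm r,\mathrm I,J)$ (for vectors: the sum of the suprema of the components). Put $\mathcal X=\sup\{|x|:x\in\Xi_\xi\}$ and $\mathfrak d=\min\{\rho s,\,r\xi,\,\delta^2\}$. Let $N\ge1$ be an integer with $$4N\mathcal X\Big\|\frac{\omega_{\mathrm I}}{\omega_{\mathrm r}}\Big\|<s,\qquad 4N\mathcal X\Big\|\frac{\omega_J}{\omega_{\mathrm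 r}}\Big\|<1,\qquad c_{n,m}N\frac{\mathcal X}{\mathfrak d}\Big\|\frac1{\omega_{\mathrm r}}\Big\|\,\|f\|_u<1 .$$ Then there is an operator $\Psi_N:\mathcal O_u\to\mathcal O_{u/3}$, a composition $e^{\mathcal L_{\chi_{N-1}}}\circ\cdots\circ e^{\mathcal L_{\chi_0}}$ of $N$ time-one Lie-series maps $e^{\mathcal L_{\chi_i}}:\mathcal O_{u_i}\to\mathcal O_{u_{i+1}}$ with $\chi_i\in\mathcal Z_{u_{i+1}}$ and $u=u_0\ge u_1\ge\dots\ge u_N=u/3$ (componentwise), such that on $\mathcal P_{u/3}$ $$\Psi_N[\mathrm H]=\mathrm H_0+\mathrm H_1+f_N,\qquad \mathrm H_1\in\mathcal N_{u/3},\quad f_N\in\mathcal O_{u/3},$$ $$\|\mathrm H_1-\overline f\|_{u/3}\le c_{n,m}\frac{\mathcal X}{\mathfrak d}\Big\|\frac1{\omega_{\mathrm r}}\Big\|\,\|\widetilde f\|_u\,\|f\|_u,\qquad \|f_N\|_{u/3}\le 2^{-(N+1)}\|f\|_u .$$ -/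

import Mathlib

open scoped ENNReal

noncomputable section

namespace NormalForm

/-- The real sets `R ⊆ ℝ`, `I ⊆ ℝⁿ`, `Ξ ⊆ ℝ` in which `r`, `I`, `x` vary: open, connected,
bounded, with `0 ∈ Ξ`. -/
structure BaseSets (n : ℕ) where
  setR : Set ℝ
  setI : Set (Fin n → ℝ)
  setX : Set ℝ
  isOpen_R : IsOpen setR
  isConnected_R : IsConnected setR
  isBounded_R : Bornology.IsBounded setR
  isOpen_I : IsOpen setI
  isConnected_I : IsConnected setI
  isBounded_I : Bornology.IsBounded setI
  isOpen_X : IsOpen setX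
  isConnected_X : IsConnected setX
  isBounded_X : Bornology.IsBounded setX
  zero_mem_X : (0 : ℝ) ∈ setX

/-- The analyticity widths `(r, ρ, ξ, s, δ)`. -/
structure Width where
  r : ℝ
  ρ : ℝ
  ξ : ℝ
  s : ℝ
  δ : ℝ

/-- All widths are positive. -/
def Width.Pos (u : Width) : Prop := 0 < u.r ∧ 0 < u.ρ ∧ 0 < u.ξ ∧ 0 < u.s ∧ 0 < u.δ

/-- Componentwise `≤`. -/
def Width.Le (u v : Width) : Prop :=
  u.r ≤ v.r ∧ u.ρ ≤ v.ρ ∧ u.ξ ≤ v.ξ ∧ u.s ≤ v.s ∧ u.δ ≤ v.δ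

/-- Componentwise `<`. -/
def Width.Lt (u v : Width) : Prop :=
  u.r < v.r ∧ u.ρ < v.ρ ∧ u.ξ < v.ξ ∧ u.s < v.s ∧ u.δ < v.δ

/-- The widths `1/3 (r, ρ, ξ, s, δ)`. -/
def Width.third (u : Width) : Width := ⟨u.r / 3, u.ρ / 3, u.ξ / 3, u.s / 3, u.δ / 3⟩

/-- `𝔡 = min {ρ s, r ξ, δ²}`. -/
def Width.frakd (u : Width) : ℝ := min (u.ρ * u.s) (min (u.r * u.ξ) (u.δ ^ 2))

/-- Complexified phase space; a point is `(r, I, x, φ, p, q)`. -/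
abbrev Phase (n m : ℕ) : Type :=
  ℂ × (Fin n → ℂ) × ℂ × (Fin n → ℂ) × (Fin m → ℂ) × (Fin m → ℂ)

/-- The space of the variables `(r, I, J)` of the unperturbed Hamiltonian. -/
abbrev Actions (n m : ℕ) : Type := ℂ × (Fin n → ℂ) × (Fin m → ℂ)

/-- Complex neighbourhood of radius `θ` of a subset of the real line. -/
def nbhd (A : Set ℝ) (θ : ℝ) : Set ℂ := {z | ∃ a ∈ A, ‖z - (a : ℂ)‖ < θ}

/-- Complex (Euclidean) neighbourhood of radius `θ` of a subset of `ℝⁿ`. -/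
def nbhdVec {n : ℕ} (A : Set (Fin n → ℝ)) (θ : ℝ) : Set (Fin n → ℂ) :=
  {z | ∃ a ∈ A, Real.sqrt (∑ i, ‖z i - (a i : ℂ)‖ ^ 2) < θ}

/-- The complex domain `R_r × I_ρ × Ξ_ξ × 𝕋ⁿ_s × B_δ`. The angles are lifted to the strip
`|Im φ_i| ≤ s` of `ℂⁿ`, and `B_δ` is the ball of radius `δ` for the maximum norm. -/
def domain {n : ℕ} (m : ℕ) (B : BaseSets n) (u : Width) : Set (Phase n m) :=
  {z | z.1 ∈ nbhd B.setR u.r ∧ z.2.1 ∈ nbhdVec B.setI u.ρ ∧ z.2.2.1 ∈ nbhd B.setX u.ξ ∧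
    (∀ i, |(z.2.2.2.1 i).im| ≤ u.s) ∧
    (∀ i, ‖z.2.2.2.2.1 i‖ ≤ u.δ) ∧ (∀ i, ‖z.2.2.2.2.2 i‖ ≤ u.δ)}

/-- The complex domain of the variables `(r, I, J)`: the image of `domain m B u` under
`(r, I, x, φ, p, q) ↦ (r, I, (p₁q₁, …, p_mq_m))`. -/
def actionDomain {n : ℕ} (m : ℕ) (B : BaseSets n) (u : Width) : Set (Actions n m) :=
  {y | y.1 ∈ nbhd B.setR u.r ∧ y.2.1 ∈ nbhdVec B.setI u.ρ ∧ ∀ i, ‖y.2.2 i‖ ≤ u.δ ^ 2}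

/-- `g ∈ 𝒪_u`: `g` is holomorphic, and `2π`-periodic in each angle, on a domain with strictly
larger widths. -/
def IsHol {n m : ℕ} (B : BaseSets n) (u : Width) (g : Phase n m → ℂ) : Prop :=
  ∃ v : Width, u.Lt v ∧ DifferentiableOn ℂ g (domain m B v) ∧
    ∀ z ∈ domain m B v, ∀ i,
      g (z.1, z.2.1, z.2.2.1, z.2.2.2.1 + Pi.single i (2 * (Real.pi : ℂ)), z.2.2.2.2) = g z

/-- The coefficient `g_{khj}(r, I, x)` of `e^{i k·φ} p^h q^j` in the Taylor–Fourier expansion of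
`g`, by Cauchy's formula on the torus `φ ∈ [0, 2π]ⁿ`, `p_l = δ e^{i α_l}`, `q_l = δ e^{i β_l}`. -/
def coeff {n m : ℕ} (δ : ℝ) (g : Phase n m → ℂ) (k : Fin n → ℤ) (h j : Fin m → ℕ)
    (r : ℂ) (I : Fin n → ℂ) (x : ℂ) : ℂ :=
  (((2 * Real.pi) ^ (n + 2 * m) : ℝ) : ℂ)⁻¹ *
    ∫ t in Set.Icc (0 : (Fin n → ℝ) × (Fin m → ℝ) × (Fin m → ℝ))
        (fun _ => 2 * Real.pi, fun _ => 2 * Real.pi, fun _ => 2 * Real.pi),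
      g (r, I, x, fun i => (t.1 i : ℂ),
          fun l => (δ : ℂ) * Complex.exp (Complex.I * (t.2.1 l : ℂ)),
          fun l => (δ : ℂ) * Complex.exp (Complex.I * (t.2.2 l : ℂ))) *
        Complex.exp (-Complex.I * (∑ i, (k i : ℂ) * (t.1 i : ℂ) +
          ∑ l, (h l : ℂ) * (t.2.1 l : ℂ) + ∑ l, (j l : ℂ) * (t.2.2 l : ℂ))) /
        (δ : ℂ) ^ (∑ l, h l + ∑ l, j l)

/-- `‖g‖_u = ∑_{k,h,j} (sup_{R_r × I_ρ × Ξ_ξ} |g_{khj}|) e^{s|k|} δ^{|h|+|j|}`, with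
`|k| = ∑ |k_i|`. -/
def norm {n m : ℕ} (B : BaseSets n) (u : Width) (g : Phase n m → ℂ) : ℝ≥0∞ :=
  ∑' a : (Fin n → ℤ) × (Fin m → ℕ) × (Fin m → ℕ),
    (⨆ r ∈ nbhd B.setR u.r, ⨆ I ∈ nbhdVec B.setI u.ρ, ⨆ x ∈ nbhd B.setX u.ξ,
      ‖coeff u.δ g a.1 a.2.1 a.2.2 r I x‖ₑ) *
    ENNReal.ofReal (Real.exp (u.s * ∑ i, |(a.1 i : ℝ)|) *
      u.δ ^ (∑ l, a.2.1 l + ∑ l, a.2.2 l))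

/-- The average `ḡ`: the part of the Taylor–Fourier expansion of `g` with `k = 0` and `h = j`. -/
def average {n m : ℕ} (δ : ℝ) (g : Phase n m → ℂ) : Phase n m → ℂ := fun z =>
  ∑' h : Fin m → ℕ, coeff δ g 0 h h z.1 z.2.1 z.2.2.1 *
    ∏ l, (z.2.2.2.2.1 l ^ h l * z.2.2.2.2.2 l ^ h l)

/-- The off-average `g̃ = g - ḡ`. -/
def offAverage {n m : ℕ} (δ : ℝ) (g : Phase n m → ℂ) : Phase n m → ℂ := fun z =>
  g z - average δ g z

/-- The zero-average class `𝒵_u`. -/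
def IsZeroAverage {n m : ℕ} (B : BaseSets n) (u : Width) (g : Phase n m → ℂ) : Prop :=
  IsHol B u g ∧ ∀ z ∈ domain m B u, average u.δ g z = 0

/-- The normal class `𝒩_u`. -/
def IsNormal {n m : ℕ} (B : BaseSets n) (u : Width) (g : Phase n m → ℂ) : Prop :=
  IsHol B u g ∧ ∀ z ∈ domain m B u, average u.δ g z = g z

/-- The Poisson bracket of the two-form `dr ∧ dx + ∑ dI_i ∧ dφ_i + ∑ dp_l ∧ dq_l`. -/
def poisson {n m : ℕ} (F G : Phase n m → ℂ) : Phase n m → ℂ := fun z =>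
  let dF := fderiv ℂ F z
  let dG := fderiv ℂ G z
  let eR : Phase n m := (1, 0, 0, 0, 0, 0)
  let eX : Phase n m := (0, 0, 1, 0, 0, 0)
  let eI : Fin n → Phase n m := fun i => (0, Pi.single i 1, 0, 0, 0, 0)
  let eA : Fin n → Phase n m := fun i => (0, 0, 0, Pi.single i 1, 0, 0)
  let eP : Fin m → Phase n m := fun l => (0, 0, 0, 0, Pi.single l 1, 0)
  let eQ : Fin m → Phase n m := fun l => (0, 0, 0, 0, 0, Pi.single l 1)
  (dF eR * dG eX - dG eR * dF eX) +
    ∑ i, (dF (eI i) * dG (eA i) - dG (eI i) * dF (eA i)) +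
    ∑ l, (dF (eP l) * dG (eQ l) - dG (eP l) * dF (eQ l))

/-- The Lie series `e^{ℒ_χ} g = ∑_j ℒ_χ^j g / j!`, where `ℒ_χ = {χ, ·}`. -/
def lieExp {n m : ℕ} (χ g : Phase n m → ℂ) : Phase n m → ℂ := fun z =>
  ∑' j : ℕ, ((j.factorial : ℂ))⁻¹ * ((poisson χ)^[j] g) z

/-- `χ ∈ 𝒵_v` generates a time-one map `e^{ℒ_χ} : 𝒪_u → 𝒪_v`: on each `g ∈ 𝒪_u` the Lie series
converges absolutely in the norm of `𝒪_v`, and its sum lies in `𝒪_v`. -/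
def GeneratesLieMap {n m : ℕ} (B : BaseSets n) (u v : Width) (χ : Phase n m → ℂ) : Prop :=
  IsZeroAverage B v χ ∧ ∀ g : Phase n m → ℂ, IsHol B u g →
    (∑' j : ℕ, norm B v ((poisson χ)^[j] g) / (j.factorial : ℝ≥0∞)) < ⊤ ∧
    IsHol B v (lieExp χ g)

/-- The composition `e^{ℒ_{χ_{N-1}}} ∘ ⋯ ∘ e^{ℒ_{χ_0}}`. -/
def lieComp {n m : ℕ} (χ : ℕ → Phase n m → ℂ) : ℕ → (Phase n m → ℂ) → (Phase n m → ℂ)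
  | 0, g => g
  | N + 1, g => lieExp (χ N) (lieComp χ N g)

/-- `Ψ` is a composition of `N` time-one Lie-series maps leading from `𝒪_u` to `𝒪_v` through
decreasing widths. -/
def IsLieComposition {n m : ℕ} (B : BaseSets n) (N : ℕ) (u v : Width)
    (Ψ : (Phase n m → ℂ) → (Phase n m → ℂ)) : Prop :=
  ∃ (w : ℕ → Width) (χ : ℕ → Phase n m → ℂ), w 0 = u ∧ w N = v ∧
    (∀ i < N, (w (i + 1)).Le (w i) ∧ GeneratesLieMap B (w i) (w (i + 1)) (χ i)) ∧
    Ψ = lieComp χ N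

/-- `z ↦ (r, I, J(p, q))` with `J(p, q) = (p₁q₁, …, p_mq_m)`. -/
def toActions {n m : ℕ} (z : Phase n m) : Actions n m :=
  (z.1, z.2.1, fun l => z.2.2.2.2.1 l * z.2.2.2.2.2 l)

/-- `ω_r = ∂_r H₀`. -/
def omegaR {n m : ℕ} (H₀ : Actions n m → ℂ) : Actions n m → ℂ := fun y =>
  fderiv ℂ H₀ y (1, 0, 0)

/-- `ω_I = ∂_I H₀`. -/
def omegaI {n m : ℕ} (H₀ : Actions n m → ℂ) (i : Fin n) : Actions n m → ℂ := fun y =>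
  fderiv ℂ H₀ y (0, Pi.single i 1, 0)

/-- `ω_J = ∂_J H₀`. -/
def omegaJ {n m : ℕ} (H₀ : Actions n m → ℂ) (l : Fin m) : Actions n m → ℂ := fun y =>
  fderiv ℂ H₀ y (0, 0, Pi.single l 1)

/-- The supremum norm of a function of `(r, I, J)`; it is the supremum over `R_r × I_ρ` if the
function does not depend on `J`. -/
def supNorm {n m : ℕ} (B : BaseSets n) (u : Width) (w : Actions n m → ℂ) : ℝ≥0∞ :=
  ⨆ y ∈ actionDomain m B u, ‖w y‖ₑ

/-- `𝒳 = sup {|x| : x ∈ Ξ_ξ}`. -/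
def supX {n : ℕ} (B : BaseSets n) (u : Width) : ℝ≥0∞ := ⨆ x ∈ nbhd B.setX u.ξ, ‖x‖ₑ

end NormalForm

end

noncomputable section

namespace NormalForm

open MeasureTheory Filter Topology Metric

/-! ### Holomorphic functions and integrals with parameters -/

section Holomorphic

variable {E : Type*} [NormedAddCommGroup E] [NormedSpace ℂ E]

/-! The off-average part of the perturbation is removed by Lie transforms whose generators solve
`{χ, H₀} = -f̃`. No small divisors occur. Since `ω_r` does not vanish, bracketing with `H₀` is
`-ω_r` times the derivative along `∂_x + (ω_I/ω_r) ∂_φ + (ω_J/ω_r)(q ∂_q - p ∂_p)`. This field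
conserves `r`, `I` and `J`, so its flow is explicit, and it moves `x` at unit speed. The equation is
therefore solved by integrating along the flow from `x = 0`: `χ = (x/ω_r) ∫₀¹ f̃ ∘ flow_{(t-1)x}
dt`. Periodicity in `x` plays no role, and `χ` is at most `𝒳 ‖1/ω_r‖` times the size of `f̃`. The
flow shifts `Im φ` by at most `𝒳 ‖ω_I/ω_r‖` and stretches `p`, `q` by at most `exp (𝒳 ‖ω_J/ω_r‖)`;
the two frequency hypotheses turn this into a relative loss of width `1/(4N)` per step. The flow
commutes with the torus rotations up to a translation of the angles, so `χ` inherits a vanishing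
average (`ZBd.exists_homological`).

The flow mixes Taylor monomials in `(p, q)` but preserves Fourier modes in `φ`. All estimates are
therefore made with `Bd`: a function is a countable sum of modes `e^{ik·φ} G`, each controlled by a
supremum norm and weighted by `e^{s|k|}`. These bounds are stable under sums, products, averages
and, with a loss of width, derivatives; this gives the Cauchy estimate `Bd.poissonBracket` and, by
iteration, the Lie series bounds. Passing from the Taylor–Fourier norm to `Bd` costs nothing
(`IsHol.bd`, `IsHol.zbd_sub_avg`); the way back costs one constant, paid once at the end
(`Bd.norm_le_ofReal`).

In the transformed Hamiltonian `H₀` enters only through `{χ, H₀}`, so no bound on `H₀` itself is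
needed (`Bd.lieExp_sub`): what remains beyond `H₀` and the average is quadratic in the perturbation.

The smallness condition is linear in `N`, although a loss of order `1/N` on both factors of a
bracket would cost `N²`. Two devices achieve this. The first step uses a loss independent of `N` and
leaves an error `ρ ~ κ ‖f̃‖ ‖f‖`, with `κ = 𝒳 ‖1/ω_r‖/𝔡`. In later steps the perturbation is split
as `f̄` plus a part of size `3ρ`. The large part `f̄` is holomorphic on all of the initial domain,
so differentiating it costs no power of `N`; the other part does cost `N²`, but `N² κ ρ ≲ (N κ
‖f‖)²`. Each later step then divides the off-average part by `4` (`Scheme.next_step`), and the drift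
of the average stays below `3ρ`. -/

theorem hasDerivAt_line {U : Set E} (hU : IsOpen U) {F : E → ℂ}
    (hF : DifferentiableOn ℂ F U) {z e : E} {ζ : ℂ} (hz : z + ζ • e ∈ U) :
    HasDerivAt (fun ζ : ℂ => F (z + ζ • e)) (fderiv ℂ F (z + ζ • e) e) ζ := by
  have h1 : HasFDerivAt F (fderiv ℂ F (z + ζ • e)) (z + ζ • e) :=
    ((hF _ hz).differentiableAt (hU.mem_nhds hz)).hasFDerivAt
  have h2 : HasDerivAt (fun ζ : ℂ => z + ζ • e) e ζ := by
    simpa using ((hasDerivAt_id ζ).smul_const e).const_add z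
  exact h1.comp_hasDerivAt ζ h2

theorem diffContOnCl_line {U : Set E} (hU : IsOpen U) {F : E → ℂ}
    (hF : DifferentiableOn ℂ F U) {z e : E} {ρ : ℝ}
    (h : ∀ ζ : ℂ, ‖ζ‖ ≤ ρ → z + ζ • e ∈ U) :
    DiffContOnCl ℂ (fun ζ : ℂ => F (z + ζ • e)) (ball 0 ρ) := by
  have hd : ∀ ζ ∈ closedBall (0 : ℂ) ρ,
      DifferentiableAt ℂ (fun ζ : ℂ => F (z + ζ • e)) ζ := fun ζ hζ =>
    (hasDerivAt_line hU hF (h ζ (by simpa using hζ))).differentiableAt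
  refine ⟨fun ζ hζ => (hd ζ (ball_subset_closedBall hζ)).differentiableWithinAt, fun ζ hζ => ?_⟩
  exact (hd ζ (closure_ball_subset_closedBall hζ)).continuousAt.continuousWithinAt

/-- Only a complex disc in the direction `e` is used, so each group of variables can later be given
its own radius. -/
theorem norm_fderiv_apply_le {U : Set E} (hU : IsOpen U) {F : E → ℂ}
    (hF : DifferentiableOn ℂ F U) {z e : E} {ρ C : ℝ} (hρ : 0 < ρ)
    (h : ∀ ζ : ℂ, ‖ζ‖ ≤ ρ → z + ζ • e ∈ U)
    (hC : ∀ ζ : ℂ, ‖ζ‖ ≤ ρ → ‖F (z + ζ • e)‖ ≤ C) :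
    ‖fderiv ℂ F z e‖ ≤ C / ρ := by
  have hz : z + (0 : ℂ) • e ∈ U := h 0 (by simpa using hρ.le)
  have h1 := hasDerivAt_line hU hF hz
  have h2 := Complex.norm_deriv_le_of_forall_mem_sphere_norm_le hρ
    (diffContOnCl_line hU hF h) (C := C) (fun ζ hζ => hC ζ (by simp at hζ; exact hζ.le))
  rw [h1.deriv] at h2
  simpa using h2

theorem norm_fderiv_le_of_ball {U : Set E} (hU : IsOpen U) {F : E → ℂ}
    (hF : DifferentiableOn ℂ F U) {z : E} {ε C : ℝ} (hε : 0 < ε) (hC0 : 0 ≤ C)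
    (h : closedBall z ε ⊆ U) (hC : ∀ w ∈ closedBall z ε, ‖F w‖ ≤ C) :
    ‖fderiv ℂ F z‖ ≤ C / ε := by
  refine ContinuousLinearMap.opNorm_le_bound _ (by positivity) fun e => ?_
  rcases eq_or_ne e 0 with rfl | he
  · simp
  have he' : 0 < ‖e‖ := norm_pos_iff.2 he
  have key : ∀ ζ : ℂ, ‖ζ‖ ≤ ε / ‖e‖ → z + ζ • e ∈ closedBall z ε := fun ζ hζ => by
    rw [mem_closedBall, dist_eq_norm, add_sub_cancel_left, norm_smul]
    exact (le_div_iff₀ he').1 hζ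
  have := norm_fderiv_apply_le hU hF (z := z) (e := e) (ρ := ε / ‖e‖) (C := C) (by positivity)
    (fun ζ hζ => h (key ζ hζ)) (fun ζ hζ => hC _ (key ζ hζ))
  calc _ ≤ _ := this
    _ = _ := by field_simp

/-- Along each direction the derivative is a limit of difference quotients with steps `1/k`, which
are measurable in the parameter; in finite dimension finitely many directions determine it. -/
theorem aestronglyMeasurable_fderiv_param [FiniteDimensional ℂ E] {T : Type*} [MeasurableSpace T]
    {μ : Measure T} {U : Set E} (hU : IsOpen U) {f : T → E → ℂ}
    (hf : ∀ᵐ t ∂μ, DifferentiableOn ℂ (f t) U)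
    (hm : ∀ z ∈ U, AEStronglyMeasurable (fun t => f t z) μ) {z : E} (hz : z ∈ U) :
    AEStronglyMeasurable (fun t => fderiv ℂ (f t) z) μ := by
  have key : ∀ e : E, AEStronglyMeasurable (fun t => fderiv ℂ (f t) z e) μ := by
    intro e
    have hcont : Tendsto (fun n : ℕ => z + ((n : ℂ))⁻¹ • e) atTop (𝓝 (z + (0 : ℂ) • e)) := by
      refine tendsto_const_nhds.add (Tendsto.smul_const ?_ e)
      exact tendsto_inv_atTop_nhds_zero_nat (𝕜 := ℂ)
    have hev : ∀ᶠ n : ℕ in atTop, z + ((n : ℂ))⁻¹ • e ∈ U :=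
      hcont.eventually (hU.mem_nhds (by simpa using hz))
    obtain ⟨n₀, hn₀⟩ := eventually_atTop.1 hev
    refine aestronglyMeasurable_of_tendsto_ae (atTop : Filter ℕ)
      -- The shift by `n₀` keeps all the points `z + e/(k + n₀)` inside `U`.
      (f := fun n t => ((n + n₀ : ℕ) : ℂ) • (f t (z + (((n + n₀ : ℕ) : ℂ))⁻¹ • e) - f t z)) ?_ ?_
    · intro n
      exact ((hm _ (hn₀ _ (Nat.le_add_left _ _))).sub (hm z hz)).const_smul (((n + n₀ : ℕ) : ℂ))
    · filter_upwards [hf] with t ht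
      have h1 : HasFDerivAt (f t) (fderiv ℂ (f t) z) z :=
        ((ht z hz).differentiableAt (hU.mem_nhds hz)).hasFDerivAt
      refine h1.lim e ?_
      have : Tendsto (fun n : ℕ => ((n + n₀ : ℕ) : ℝ)) atTop atTop :=
        tendsto_natCast_atTop_atTop.comp (tendsto_add_atTop_nat n₀)
      refine this.congr fun n => ?_
      simp only [Complex.norm_natCast]
  let b := Module.finBasis ℂ E
  have heq : (fun t => fderiv ℂ (f t) z) = fun t => ∑ i, (fderiv ℂ (f t) z (b i)) •
      (LinearMap.toContinuousLinearMap (b.coord i)) := by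
    funext t
    ext v
    conv_lhs => rw [← b.sum_repr v]
    simp only [map_sum, map_smul, smul_eq_mul, FunLike.coe_sum, Finset.sum_apply,
      FunLike.coe_smul, Pi.smul_apply, LinearMap.coe_toContinuousLinearMap',
      Module.Basis.coord_apply, mul_comm]
  rw [heq]
  refine Finset.aestronglyMeasurable_fun_sum _ fun i _ => ?_
  exact (key (b i)).smul_const _

/-- A parametric integral of holomorphic functions, dominated by a continuous function of the
point, is holomorphic. -/
theorem differentiableOn_integral [FiniteDimensional ℂ E] {T : Type*} [MeasurableSpace T]
    {μ : Measure T} [IsFiniteMeasure μ] {U : Set E} (hU : IsOpen U) {f : T → E → ℂ} {C : E → ℝ}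
    (hC : ContinuousOn C U) (hf : ∀ᵐ t ∂μ, DifferentiableOn ℂ (f t) U)
    (hm : ∀ z ∈ U, AEStronglyMeasurable (fun t => f t z) μ)
    (hb : ∀ᵐ t ∂μ, ∀ z ∈ U, ‖f t z‖ ≤ C z) :
    DifferentiableOn ℂ (fun z => ∫ t, f t z ∂μ) U := by
  intro z₀ hz₀
  have h1 : ∀ᶠ z in 𝓝 z₀, C z < C z₀ + 1 :=
    (hC.continuousAt (hU.mem_nhds hz₀)).eventually (gt_mem_nhds (by linarith))
  obtain ⟨ε, hε, hball⟩ := Metric.eventually_nhds_iff_ball.1 (h1.and (hU.mem_nhds hz₀))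
  have hF := hasFDerivAt_integral_of_dominated_of_fderiv_le (μ := μ) (𝕜 := ℂ)
    (F := fun z t => f t z) (F' := fun z t => fderiv ℂ (f t) z) (x₀ := z₀)
    (s := ball z₀ (ε / 2)) (bound := fun _ => |C z₀ + 1| / (ε / 3))
    (ball_mem_nhds _ (by positivity))
    (by
      filter_upwards [hU.mem_nhds hz₀] with z hz using hm z hz)
    (by
      refine Integrable.mono' (integrable_const (C z₀)) (hm z₀ hz₀) ?_
      filter_upwards [hb] with t ht using ht z₀ hz₀)
    (aestronglyMeasurable_fderiv_param hU hf hm hz₀)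
    (by
      filter_upwards [hf, hb] with t ht htb z hz
      have hsub : ∀ w ∈ closedBall z (ε / 3), w ∈ ball z₀ ε := fun w hw => by
        have := mem_ball.1 hz
        have h3 := mem_closedBall.1 hw
        have := dist_triangle w z z₀
        rw [mem_ball]; linarith
      refine norm_fderiv_le_of_ball hU ht (by positivity) (abs_nonneg _)
        (fun w hw => (hball w (hsub w hw)).2) (fun w hw => ?_)
      have := hball w (hsub w hw)
      exact (htb w this.2).trans (this.1.le.trans (le_abs_self _)))
    (integrable_const _)
    (by
      filter_upwards [hf] with t ht z hz
      have hzU : z ∈ U := (hball z (ball_subset_ball (by linarith) hz)).2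
      exact ((ht z hzU).differentiableAt (hU.mem_nhds hzU)).hasFDerivAt)
  exact hF.differentiableAt.differentiableWithinAt

/-- Cauchy's formula on a circle in the direction `e` writes the derivative as a parametric integral
of translates of `F`, to which `differentiableOn_integral` applies. -/
theorem differentiableOn_fderiv_apply [FiniteDimensional ℂ E] {U : Set E} (hU : IsOpen U)
    {F : E → ℂ} (hF : DifferentiableOn ℂ F U) (e : E) :
    DifferentiableOn ℂ (fun z => fderiv ℂ F z e) U := by
  intro z₀ hz₀
  obtain ⟨ε', hε', hball'⟩ := Metric.isOpen_iff.1 hU z₀ hz₀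
  obtain ⟨ε, hε, hball⟩ : ∃ ε > 0, closedBall z₀ (2 * ε) ⊆ U :=
    ⟨ε' / 3, by positivity, (closedBall_subset_ball (by linarith)).trans hball'⟩
  have : ProperSpace E := FiniteDimensional.proper ℂ E
  obtain ⟨C, hC⟩ := (isCompact_closedBall z₀ (2 * ε)).exists_bound_of_continuousOn
    (hF.continuousOn.mono hball)
  -- The `+ 1` keeps the radius meaningful for `e = 0`.
  set ρ := ε / (‖e‖ + 1) with hρ
  have hρ0 : 0 < ρ := by positivity
  have hmem : ∀ z ∈ ball z₀ ε, ∀ ζ : ℂ, ‖ζ‖ ≤ ρ → z + ζ • e ∈ closedBall z₀ (2 * ε) := by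
    intro z hz ζ hζ
    rw [mem_closedBall, dist_eq_norm]
    have h1 : ‖ζ • e‖ ≤ ε := by
      rw [norm_smul]
      calc ‖ζ‖ * ‖e‖ ≤ ρ * (‖e‖ + 1) := by gcongr; linarith
        _ = ε := by rw [hρ]; field_simp
    have h2 : ‖z - z₀‖ < ε := by simpa [dist_eq_norm] using hz
    calc ‖z + ζ • e - z₀‖ = ‖(z - z₀) + ζ • e‖ := by congr 1; abel
      _ ≤ _ := norm_add_le _ _
      _ ≤ _ := by linarith
  have hrep : ∀ z ∈ ball z₀ ε, fderiv ℂ F z e = (2 * Real.pi * Complex.I : ℂ)⁻¹ •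
      ∮ ζ in C(0, ρ), (1 / (ζ - 0) ^ 2) • F (z + ζ • e) := by
    intro z hz
    have hd := diffContOnCl_line hU hF (z := z) (e := e) (ρ := ρ)
      (fun ζ hζ => hball (hmem z hz ζ hζ))
    have h2 := (hasDerivAt_line hU hF (z := z) (e := e) (ζ := 0)
      (hball (hmem z hz 0 (by simpa using hρ0.le)))).deriv
    rw [hd.deriv_eq_smul_circleIntegral hρ0, h2, inv_smul_smul₀ Complex.two_pi_I_ne_zero]
    simp
  have hdiff : DifferentiableOn ℂ (fun z => ∮ ζ in C(0, ρ), (1 / (ζ - 0) ^ 2) • F (z + ζ • e))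
      (ball z₀ ε) := by
    simp only [circleIntegral, intervalIntegral.integral_of_le Real.two_pi_pos.le]
    have hnorm : ∀ t : ℝ, ‖circleMap 0 ρ t‖ = ρ := fun t => by
      simp [abs_of_pos hρ0]
    refine differentiableOn_integral isOpen_ball (C := fun _ => ρ * (1 / ρ ^ 2 * C))
      continuousOn_const (ae_of_all _ fun t => ?_) (fun z hz => ?_) (ae_of_all _ fun t z hz => ?_)
    · have h1 : DifferentiableOn ℂ (fun z => F (z + circleMap 0 ρ t • e)) (ball z₀ ε) :=
        hF.comp (differentiableOn_id.add_const _)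
          (fun z hz => hball (hmem z hz _ (hnorm t).le))
      exact (h1.fun_const_smul _).fun_const_smul _
    · refine Continuous.aestronglyMeasurable ?_
      have h1 : Continuous fun t => F (z + circleMap 0 ρ t • e) := by
        refine hF.continuousOn.comp_continuous (by fun_prop)
          (fun t => hball (hmem z hz _ (hnorm t).le))
      have h2 : Continuous fun t => 1 / (circleMap 0 ρ t - 0) ^ 2 := by
        refine continuous_const.div (by fun_prop) (fun t => pow_ne_zero 2 ?_)
        rw [sub_zero, ← norm_pos_iff, hnorm]; exact hρ0
      have h3 : Continuous fun t => deriv (circleMap 0 ρ) t := by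
        simp only [deriv_circleMap]; fun_prop
      exact h3.smul (h2.smul h1)
    · rw [norm_smul, norm_smul, norm_div, norm_pow, norm_one, sub_zero, hnorm, deriv_circleMap, norm_mul,
        hnorm]
      simp only [Complex.norm_I, mul_one]
      gcongr
      exact hC _ (hmem z hz _ (hnorm t).le)
  have h3 : DifferentiableOn ℂ (fun z => fderiv ℂ F z e) (ball z₀ ε) :=
    (hdiff.fun_const_smul _).congr hrep
  exact ((h3 z₀ (mem_ball_self hε)).differentiableAt
    (ball_mem_nhds _ hε)).differentiableWithinAt

/-- Termwise differentiation of an absolutely convergent series of holomorphic functions. -/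
theorem hasFDerivAt_of_hasSum {ι : Type*} {U : Set E} (hU : IsOpen U) {F : ι → E → ℂ}
    {a : ι → ℝ} (ha : Summable a) (hF : ∀ i, DifferentiableOn ℂ (F i) U)
    (hb : ∀ i, ∀ z ∈ U, ‖F i z‖ ≤ a i) {g : E → ℂ} (hg : ∀ z ∈ U, HasSum (fun i => F i z) (g z))
    {z : E} (hz : z ∈ U) :
    ∃ g' : E →L[ℂ] ℂ, HasFDerivAt g g' z ∧ HasSum (fun i => fderiv ℂ (F i) z) g' := by
  obtain ⟨ε', hε', hball'⟩ := Metric.isOpen_iff.1 hU z hz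
  obtain ⟨ε, hε, hball⟩ : ∃ ε > 0, ball z (2 * ε) ⊆ U :=
    ⟨ε' / 2, by positivity, (ball_subset_ball (by linarith)).trans hball'⟩
  have ha0 : ∀ i, 0 ≤ a i := fun i => (norm_nonneg _).trans (hb i z hz)
  have hbd : ∀ i, ∀ w ∈ ball z ε, ‖fderiv ℂ (F i) w‖ ≤ a i / (ε / 2) := by
    intro i w hw
    have hsub : closedBall w (ε / 2) ⊆ U := fun y hy => hball (by
      have h1 := mem_ball.1 hw
      have h3 := mem_closedBall.1 hy
      have := dist_triangle y w z
      rw [mem_ball]; linarith)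
    exact norm_fderiv_le_of_ball hU (hF i) (by positivity) (ha0 i) hsub
      (fun y hy => hb i y (hsub hy))
  have hbU : ∀ w ∈ ball z ε, w ∈ U := fun w hw => hball (ball_subset_ball (by linarith) hw)
  have hsum : Summable fun i => a i / (ε / 2) := ha.div_const _
  have h := hasFDerivAt_tsum_of_isPreconnected hsum isOpen_ball
    (convex_ball z ε).isPreconnected
    (f := F) (f' := fun i w => fderiv ℂ (F i) w)
    (fun i w hw => ((hF i w (hbU w hw)).differentiableAt (hU.mem_nhds (hbU w hw))).hasFDerivAt)
    hbd (mem_ball_self hε) (hg z hz).summable (mem_ball_self hε)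
  refine ⟨_, ?_, (Summable.of_norm_bounded hsum
    (fun i => hbd i z (mem_ball_self hε))).hasSum⟩
  refine h.congr_of_eventuallyEq ?_
  filter_upwards [ball_mem_nhds z hε] with w hw
  exact (hg w (hbU w hw)).tsum_eq.symm

end Holomorphic

/-- The radial primitive `x ∫₀¹ h(tx) dt` of a function holomorphic on a star-shaped domain. -/
theorem hasDerivAt_radial_primitive {U : Set ℂ} (hU : IsOpen U)
    (hstar : ∀ x ∈ U, ∀ t ∈ Set.Icc (0 : ℝ) 1, (t : ℂ) * x ∈ U) {h : ℂ → ℂ}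
    (hh : DifferentiableOn ℂ h U) {x : ℂ} (hx : x ∈ U) :
    HasDerivAt (fun x : ℂ => x * ∫ t in (0 : ℝ)..1, h (t * x)) (h x) x := by
  have hcont : ∀ y ∈ U, ContinuousOn (fun t : ℝ => h (t * y)) (Set.Icc 0 1) := fun y hy =>
    hh.continuousOn.comp (by fun_prop) (fun t ht => hstar y hy t ht)
  set A : ℂ → ℂ := fun x => ∫ t in (0 : ℝ)..1, h (t * x) with hA
  have hAd : DifferentiableAt ℂ A x := by
    obtain ⟨ε, hε, hball⟩ := Metric.isOpen_iff.1 hU x hx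
    have hK : IsCompact ((fun p : ℝ × ℂ => (p.1 : ℂ) * p.2) ''
        (Set.Icc 0 1 ×ˢ closedBall x (ε / 2))) :=
      (isCompact_Icc.prod (isCompact_closedBall _ _)).image (by fun_prop)
    have hsubU : closedBall x (ε / 2) ⊆ U := (closedBall_subset_ball (by linarith)).trans hball
    have hKU : (fun p : ℝ × ℂ => (p.1 : ℂ) * p.2) ''
        (Set.Icc 0 1 ×ˢ closedBall x (ε / 2)) ⊆ U := by
      rintro _ ⟨p, hp, rfl⟩
      exact hstar _ (hsubU hp.2) _ hp.1
    obtain ⟨C, hC⟩ := hK.exists_bound_of_continuousOn (hh.continuousOn.mono hKU)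
    have hsub : ball x (ε / 2) ⊆ U := ball_subset_closedBall.trans hsubU
    have : DifferentiableOn ℂ A (ball x (ε / 2)) := by
      simp only [hA, intervalIntegral.integral_of_le zero_le_one]
      refine differentiableOn_integral isOpen_ball (C := fun _ => C) continuousOn_const ?_ ?_ ?_
      · refine (ae_restrict_iff' measurableSet_Ioc).2 (ae_of_all _ fun t ht => ?_)
        exact hh.comp (by fun_prop) (fun y hy => hstar y (hsub hy) t (Set.Ioc_subset_Icc_self ht))
      · intro y hy
        exact ((hcont y (hsub hy)).mono Set.Ioc_subset_Icc_self).aestronglyMeasurable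
          measurableSet_Ioc
      · refine (ae_restrict_iff' measurableSet_Ioc).2 (ae_of_all _ fun t ht y hy => ?_)
        exact hC _ ⟨(t, y), ⟨Set.Ioc_subset_Icc_self ht, ball_subset_closedBall hy⟩, rfl⟩
    exact (this x (mem_ball_self (by positivity))).differentiableAt
      (ball_mem_nhds _ (by positivity))
  have hprod : HasDerivAt (fun x : ℂ => x * A x) (1 * A x + x * deriv A x) x :=
    (hasDerivAt_id x).mul hAd.hasDerivAt
  suffices hval : 1 * A x + x * deriv A x = h x by rwa [hval] at hprod
  rcases eq_or_ne x 0 with rfl | hx0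
  · simp [hA]
  -- Once the product is known to be holomorphic, its derivative can be read off along the real ray
  -- through `x`. There the substitution `t ↦ σt` turns it into `x ∫₀^σ h(tx) dt`, and the
  -- fundamental theorem of calculus applies.
  have hline : HasDerivAt (fun σ : ℝ => ((σ : ℂ) * x) * A ((σ : ℂ) * x))
      ((1 * A x + x * deriv A x) * x) 1 := by
    have h1 : HasDerivAt (fun σ : ℝ => (σ : ℂ) * x) x 1 := by
      simpa using (Complex.ofRealCLM.hasDerivAt (x := (1 : ℝ))).mul_const x
    have h2 : HasDerivAt (fun x : ℂ => x * A x) (1 * A x + x * deriv A x) (((1 : ℝ) : ℂ) * x) := by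
      rw [Complex.ofReal_one, one_mul x]; exact hprod
    exact HasDerivAt.comp (1 : ℝ) h2 h1
  have hint : ∀ σ : ℝ, ((σ : ℂ) * x) * A ((σ : ℂ) * x) = x * ∫ t in (0 : ℝ)..σ, h (t * x) := by
    intro σ
    have := intervalIntegral.smul_integral_comp_mul_right (a := 0) (b := 1)
      (fun t : ℝ => h (t * x)) σ
    simp only [zero_mul, one_mul] at this
    rw [← this, hA]
    simp only [Complex.real_smul]
    rw [mul_assoc, mul_left_comm]
    congr 2
    refine intervalIntegral.integral_congr fun t _ => ?_
    push_cast
    ring_nf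
  have hcU : ∀ᶠ t : ℝ in 𝓝 1, (t : ℂ) * x ∈ U := by
    have hc : Continuous fun t : ℝ => (t : ℂ) * x := by fun_prop
    exact hc.continuousAt.eventually (hU.mem_nhds (by simpa using hx))
  have hftc : HasDerivAt (fun σ : ℝ => x * ∫ t in (0 : ℝ)..σ, h (t * x)) (x * h x) 1 := by
    refine HasDerivAt.const_mul x ?_
    have hcat : ∀ t : ℝ, (t : ℂ) * x ∈ U → ContinuousAt (fun t : ℝ => h (t * x)) t := fun t ht =>
      ContinuousAt.comp (f := fun t : ℝ => (t : ℂ) * x)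
        (hh.continuousOn.continuousAt (hU.mem_nhds ht)) (by fun_prop)
    have := intervalIntegral.integral_hasDerivAt_right (f := fun t : ℝ => h (t * x))
      (a := 0) (b := 1)
      ((hcont x hx).intervalIntegrable_of_Icc zero_le_one)
      (by
        have hopen : IsOpen {t : ℝ | (t : ℂ) * x ∈ U} :=
          hU.preimage (by fun_prop : Continuous fun t : ℝ => (t : ℂ) * x)
        refine ContinuousOn.stronglyMeasurableAtFilter hopen
          (fun t ht => (hcat t ht).continuousWithinAt) 1 (by simpa using hx))
      (hcat 1 (by simpa using hx))
    simpa using this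
  have := hline.unique (hftc.congr_of_eventuallyEq (Eventually.of_forall hint))
  exact mul_right_cancel₀ hx0 (by rw [this, mul_comm])

/-! ### Fourier series in one complex angle -/

/-- An integral over a compact parameter set of functions holomorphic in the point and jointly
continuous is holomorphic. -/
theorem differentiableOn_setIntegral {E : Type*} [NormedAddCommGroup E] [NormedSpace ℂ E]
    [FiniteDimensional ℂ E] {T : Type*} [TopologicalSpace T] [MeasurableSpace T]
    [OpensMeasurableSpace T] {μ : Measure T} [IsFiniteMeasureOnCompacts μ] {K : Set T}
    (hK : IsCompact K) (hKm : MeasurableSet K)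
    {U : Set E} (hU : IsOpen U) {f : T → E → ℂ}
    (hc : ContinuousOn (fun p : T × E => f p.1 p.2) (K ×ˢ U))
    (hf : ∀ t ∈ K, DifferentiableOn ℂ (f t) U) :
    DifferentiableOn ℂ (fun z => ∫ t in K, f t z ∂μ) U := by
  have : ProperSpace E := FiniteDimensional.proper ℂ E
  intro z hz
  obtain ⟨ε, hε, hball⟩ := Metric.isOpen_iff.1 hU z hz
  have hsubU : closedBall z (ε / 2) ⊆ U := (closedBall_subset_ball (by linarith)).trans hball
  have hsub : ball z (ε / 2) ⊆ U := ball_subset_closedBall.trans hsubU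
  obtain ⟨C, hC⟩ := (hK.prod (isCompact_closedBall z (ε / 2))).exists_bound_of_continuousOn
    (hc.mono (Set.prod_mono subset_rfl hsubU))
  have : IsFiniteMeasure (μ.restrict K) := ⟨by simpa using hK.measure_lt_top⟩
  have hd : DifferentiableOn ℂ (fun z => ∫ t in K, f t z ∂μ) (ball z (ε / 2)) := by
    refine differentiableOn_integral isOpen_ball (C := fun _ => C) continuousOn_const ?_ ?_ ?_
    · exact (ae_restrict_iff' hKm).2 (ae_of_all _ fun t ht => (hf t ht).mono hsub)
    · intro y hy
      refine ContinuousOn.aestronglyMeasurable_of_isCompact ?_ hK hKm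
      exact hc.comp (f := fun t : T => (t, y)) (by fun_prop) (fun t ht => ⟨ht, hsub hy⟩)
    · exact (ae_restrict_iff' hKm).2 (ae_of_all _ fun t ht y hy =>
        hC (t, y) ⟨ht, ball_subset_closedBall hy⟩)
  exact (hd z (mem_ball_self (by positivity))).differentiableAt
    (ball_mem_nhds _ (by positivity)) |>.differentiableWithinAt

theorem exp_I_mul_int_two_pi (k : ℤ) (z : ℂ) :
    Complex.exp (Complex.I * (k * (z + 2 * Real.pi))) = Complex.exp (Complex.I * (k * z)) := by
  rw [Complex.exp_eq_exp_iff_exists_int]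
  exact ⟨k, by ring⟩

theorem norm_exp_I_mul (w : ℂ) : ‖Complex.exp (Complex.I * w)‖ = Real.exp (-w.im) := by
  rw [Complex.norm_exp]; simp

/-- The Fourier coefficient of a function of one complex angle. -/
def fourierCoef (h : ℂ → ℂ) (k : ℤ) : ℂ :=
  ((2 * Real.pi : ℝ) : ℂ)⁻¹ * ∫ t in (0 : ℝ)..2 * Real.pi,
    h t * Complex.exp (-(Complex.I * (k * t)))

section OneAngle

variable {S : Set ℝ} {h : ℂ → ℂ}

theorem continuous_line (hh : DifferentiableOn ℂ h {z | z.im ∈ S}) {y : ℝ}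
    (hy : y ∈ S) : Continuous fun t : ℝ => h (t + y * Complex.I) := by
  refine hh.continuousOn.comp_continuous (by fun_prop) fun t => ?_
  simpa using hy

/-- Cauchy's theorem on the rectangle with sides `[0, 2π]` and `[0, y]`: the two vertical sides
cancel by periodicity. -/
theorem fourierCoef_eq_shift (hc : S.OrdConnected) (h0 : (0 : ℝ) ∈ S)
    (hh : DifferentiableOn ℂ h {z | z.im ∈ S})
    (hper : ∀ z : ℂ, z.im ∈ S → h (z + 2 * Real.pi) = h z) (k : ℤ) {y : ℝ} (hy : y ∈ S) :
    fourierCoef h k = ((2 * Real.pi : ℝ) : ℂ)⁻¹ * ∫ t in (0 : ℝ)..2 * Real.pi,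
      h (t + y * Complex.I) * Complex.exp (-(Complex.I * (k * (t + y * Complex.I)))) := by
  unfold fourierCoef
  congr 1
  have hsub : (Set.uIcc (0 : ℝ) (2 * Real.pi) ×ℂ Set.uIcc 0 y) ⊆ {z : ℂ | z.im ∈ S} := by
    intro z hz
    exact hc.uIcc_subset h0 hy hz.2
  have H := Complex.integral_boundary_rect_eq_zero_of_differentiableOn
    (fun z => h z * Complex.exp (-(Complex.I * (k * z)))) 0 (2 * Real.pi + y * Complex.I)
    (by
      simp only [Complex.zero_re, Complex.zero_im, Complex.add_re, Complex.add_im]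
      have h1 : (2 * (Real.pi : ℂ)).re + ((y : ℂ) * Complex.I).re = 2 * Real.pi := by simp
      have h2 : (2 * (Real.pi : ℂ)).im + ((y : ℂ) * Complex.I).im = y := by simp
      rw [h1, h2]
      refine (hh.mono hsub).mul ?_
      fun_prop)
  simp only [Complex.zero_re, Complex.zero_im, Complex.add_re, Complex.add_im] at H
  have h1 : (2 * (Real.pi : ℂ)).re + ((y : ℂ) * Complex.I).re = 2 * Real.pi := by simp
  have h2 : (2 * (Real.pi : ℂ)).im + ((y : ℂ) * Complex.I).im = y := by simp
  rw [h1, h2] at H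
  have hside : (∫ x in (0 : ℝ)..y, h (((2 * Real.pi : ℝ) : ℂ) + x * Complex.I) *
      Complex.exp (-(Complex.I * (k * (((2 * Real.pi : ℝ) : ℂ) + x * Complex.I))))) =
      ∫ x in (0 : ℝ)..y, h (((0 : ℝ) : ℂ) + x * Complex.I) *
      Complex.exp (-(Complex.I * (k * (((0 : ℝ) : ℂ) + x * Complex.I)))) := by
    refine intervalIntegral.integral_congr fun x hx => ?_
    have hx' : x ∈ S := hc.uIcc_subset h0 hy hx
    have e1 : ((2 * Real.pi : ℝ) : ℂ) + x * Complex.I = x * Complex.I + 2 * Real.pi := by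
      push_cast; ring
    have e2 := exp_I_mul_int_two_pi k (x * Complex.I)
    simp only [e1, hper _ (show ((x : ℂ) * Complex.I).im ∈ S by simpa using hx'),
      Complex.exp_neg, e2, Complex.ofReal_zero, zero_add]
  rw [hside, add_sub_cancel_right, sub_eq_zero] at H
  simpa using H

theorem norm_fourierCoef_le (hc : S.OrdConnected) (h0 : (0 : ℝ) ∈ S)
    (hh : DifferentiableOn ℂ h {z | z.im ∈ S})
    (hper : ∀ z : ℂ, z.im ∈ S → h (z + 2 * Real.pi) = h z) (k : ℤ) {y M : ℝ} (hy : y ∈ S)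
    (hM : ∀ t ∈ Set.Icc (0 : ℝ) (2 * Real.pi), ‖h (t + y * Complex.I)‖ ≤ M) :
    ‖fourierCoef h k‖ ≤ M * Real.exp (k * y) := by
  rw [fourierCoef_eq_shift hc h0 hh hper k hy, norm_mul, norm_inv, Complex.norm_real,
    Real.norm_of_nonneg Real.two_pi_pos.le]
  have := intervalIntegral.norm_integral_le_of_norm_le_const (a := 0) (b := 2 * Real.pi)
    (f := fun t : ℝ => h (t + y * Complex.I) *
      Complex.exp (-(Complex.I * (k * (t + y * Complex.I))))) (C := M * Real.exp (k * y)) (by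
    intro t ht
    rw [Set.uIoc_of_le Real.two_pi_pos.le] at ht
    rw [norm_mul, ← mul_neg, norm_exp_I_mul]
    have e : -(-((k : ℂ) * (t + y * Complex.I))).im = k * y := by simp
    rw [e]
    gcongr
    exact hM t (Set.Ioc_subset_Icc_self ht))
  rw [sub_zero, abs_of_pos Real.two_pi_pos] at this
  rw [inv_mul_le_iff₀ Real.two_pi_pos]
  linarith

theorem summable_exp_neg_abs_int {ε : ℝ} (hε : 0 < ε) :
    Summable fun k : ℤ => Real.exp (-(ε * |(k : ℝ)|)) := by
  have h1 : Summable fun n : ℕ => Real.exp (-(ε * n)) := by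
    have := Real.summable_exp_nat_mul_of_ge (c := -ε) (by linarith) (f := fun n => n) (by simp)
    refine this.congr fun n => ?_
    ring_nf
  refine Summable.of_nat_of_neg ?_ ?_
  · refine h1.congr fun n => ?_
    simp
  · refine h1.congr fun n => ?_
    simp

theorem hasSum_fourierCoef (hS : IsOpen S) (hc : S.OrdConnected) (h0 : (0 : ℝ) ∈ S)
    (hh : DifferentiableOn ℂ h {z | z.im ∈ S})
    (hper : ∀ z : ℂ, z.im ∈ S → h (z + 2 * Real.pi) = h z) {z : ℂ} (hz : z.im ∈ S) :
    HasSum (fun k : ℤ => fourierCoef h k * Complex.exp (Complex.I * (k * z))) (h z) := by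
  set y := z.im with hy
  have hT : Fact (0 < 2 * Real.pi) := ⟨Real.two_pi_pos⟩
  have hp : Function.Periodic (fun t : ℝ => h (t + y * Complex.I)) (2 * Real.pi) := by
    intro t
    have := hper (t + y * Complex.I) (by simpa using hz)
    simp only
    rw [← this]
    congr 1
    push_cast
    ring
  let f : C(AddCircle (2 * Real.pi), ℂ) :=
    ⟨hp.lift, continuous_coinduced_dom.2 (continuous_line hh hz)⟩
  have hf : ∀ t : ℝ, f (t : AddCircle (2 * Real.pi)) = h (t + y * Complex.I) := fun t => rfl
  have hcoef : ∀ k, fourierCoeff f k = fourierCoef h k * Complex.exp (-(k * y : ℝ)) := by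
    intro k
    rw [fourierCoef_eq_shift hc h0 hh hper k hz, fourierCoeff_eq_intervalIntegral f k 0,
      zero_add, mul_assoc, ← intervalIntegral.integral_mul_const, Complex.real_smul]
    congr 1
    · push_cast; simp
    refine intervalIntegral.integral_congr fun t _ => ?_
    simp only [hf]
    rw [fourier_coe_apply, smul_eq_mul, mul_comm, mul_assoc (h _), ← Complex.exp_add]
    congr 2
    have : (Real.pi : ℂ) ≠ 0 := by exact_mod_cast Real.pi_ne_zero
    push_cast
    field_simp
    ring_nf
    simp
  obtain ⟨ε, hε, hball⟩ := Metric.isOpen_iff.1 hS y hz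
  have hbound : ∀ y' ∈ S, ∃ M, ∀ t ∈ Set.Icc (0 : ℝ) (2 * Real.pi),
      ‖h (t + y' * Complex.I)‖ ≤ M := fun y' hy' =>
    isCompact_Icc.exists_bound_of_continuousOn (continuous_line hh hy').continuousOn
  -- The line of integration is moved down for `k ≥ 0` and up for `k ≤ 0`; either way the
  -- coefficient on the line `Im = y` gains the factor `e^{-ε|k|/2}`.
  have hy1 : y + ε / 2 ∈ S := hball (by simp [abs_of_pos hε, hε])
  have hy2 : y - ε / 2 ∈ S := hball (by simp [abs_of_pos hε, hε])
  obtain ⟨M₁, hM₁⟩ := hbound _ hy1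
  obtain ⟨M₂, hM₂⟩ := hbound _ hy2
  have hM₁0 : 0 ≤ M₁ := (norm_nonneg _).trans (hM₁ 0 ⟨le_rfl, Real.two_pi_pos.le⟩)
  have hM₂0 : 0 ≤ M₂ := (norm_nonneg _).trans (hM₂ 0 ⟨le_rfl, Real.two_pi_pos.le⟩)
  have hsum : Summable (fourierCoeff f) := by
    refine Summable.of_norm_bounded
      ((summable_exp_neg_abs_int (half_pos hε)).mul_left (M₁ + M₂)) fun k => ?_
    rw [hcoef, norm_mul, ← Complex.ofReal_neg, ← Complex.ofReal_exp, Complex.norm_real,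
      Real.norm_of_nonneg (Real.exp_pos _).le]
    rcases le_total 0 (k : ℝ) with hk | hk
    · have := norm_fourierCoef_le hc h0 hh hper k hy2 hM₂
      calc _ ≤ M₂ * Real.exp (k * (y - ε / 2)) * Real.exp (-(k * y)) := by gcongr
        _ = M₂ * Real.exp (-(ε / 2 * |(k : ℝ)|)) := by
          rw [mul_assoc, ← Real.exp_add, abs_of_nonneg hk]; ring_nf
        _ ≤ _ := by gcongr; linarith
    · have := norm_fourierCoef_le hc h0 hh hper k hy1 hM₁
      calc _ ≤ M₁ * Real.exp (k * (y + ε / 2)) * Real.exp (-(k * y)) := by gcongr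
        _ = M₁ * Real.exp (-(ε / 2 * |(k : ℝ)|)) := by
          rw [mul_assoc, ← Real.exp_add, abs_of_nonpos hk]; ring_nf
        _ ≤ _ := by gcongr; linarith
  have key := has_pointwise_sum_fourier_series_of_summable hsum (z.re : AddCircle (2 * Real.pi))
  rw [hf] at key
  have hz' : (z.re : ℂ) + y * Complex.I = z := Complex.re_add_im z
  rw [hz'] at key
  refine key.congr_fun fun k => ?_
  rw [hcoef, fourier_coe_apply, smul_eq_mul, mul_assoc, ← Complex.exp_add]
  congr 2
  conv_lhs => rw [← hz']
  have : (Real.pi : ℂ) ≠ 0 := by exact_mod_cast Real.pi_ne_zero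
  push_cast
  field_simp
  ring_nf
  simp
  ring

end OneAngle

theorem summable_pi_prod {κ : Type*} [Countable κ] {f : κ → ℝ} (hf : Summable f)
    (hf0 : ∀ k, 0 ≤ f k) (ι : Type*) [Fintype ι] :
    Summable fun K : ι → κ => ∏ i, f (K i) := by
  have hfin : ∀ d : ℕ, Summable fun K : Fin d → κ => ∏ i, f (K i) := by
    intro d
    induction d with
    | zero => exact (hasSum_fintype _).summable
    | succ d ih =>
      rw [← (Fin.consEquiv fun _ => κ).summable_iff]
      have := hf.mul_of_nonneg ih hf0 (fun K => Finset.prod_nonneg fun i _ => hf0 _)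
      refine this.congr fun p => ?_
      simp [Fin.prod_univ_succ, Fin.consEquiv]
  have e := Fintype.equivFin ι
  rw [← (Equiv.arrowCongr e.symm (Equiv.refl κ)).summable_iff]
  refine (hfin _).congr fun K => ?_
  exact (Equiv.prod_comp e (fun i => f (K i))).symm.trans rfl

/-! ### Fourier series in several complex angles -/

section ManyAngles

/-- The several-angle version of the contour shift: each `K` is estimated at the corner of the box
`Im z ± ε` opposite to its signs. There are finitely many corners, so one constant serves for all
`K`. -/
theorem summable_of_fourier_bound {ι : Type*} [Fintype ι] {S : ι → Set ℝ}
    (hS : ∀ i, IsOpen (S i)) {c : (ι → ℤ) → ℂ} {M : (ι → ℝ) → ℝ}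
    (hb : ∀ K y, (∀ i, y i ∈ S i) → ‖c K‖ ≤ M y * Real.exp (∑ i, K i * y i)) {z : ι → ℂ}
    (hz : ∀ i, (z i).im ∈ S i) :
    Summable fun K : ι → ℤ => c K * Complex.exp (Complex.I * ∑ i, K i * z i) := by
  classical
  obtain ⟨ε, hε, hεS⟩ : ∃ ε > 0, ∀ i, (z i).im + ε ∈ S i ∧ (z i).im - ε ∈ S i := by
    have h1 : ∀ i, ∀ᶠ ε : ℝ in 𝓝[>] 0, (z i).im + ε ∈ S i ∧ (z i).im - ε ∈ S i := by
      intro i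
      refine nhdsWithin_le_nhds (Filter.Eventually.and ?_ ?_)
      · exact (continuous_const.add continuous_id).continuousAt.eventually
          ((hS i).mem_nhds (by simpa using hz i))
      · exact (continuous_const.sub continuous_id).continuousAt.eventually
          ((hS i).mem_nhds (by simpa using hz i))
    obtain ⟨ε, h⟩ := ((eventually_all.2 h1).and self_mem_nhdsWithin).exists
    exact ⟨ε, h.2, h.1⟩
  let Y : (ι → Bool) → ι → ℝ := fun σ i => (z i).im + if σ i then -ε else ε
  have hY : ∀ σ i, Y σ i ∈ S i := fun σ i => by
    by_cases h : σ i
    · simpa [Y, h, sub_eq_add_neg] using (hεS i).2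
    · simpa [Y, h] using (hεS i).1
  refine Summable.of_norm_bounded (((summable_pi_prod (summable_exp_neg_abs_int hε)
    (fun k => (Real.exp_pos _).le) ι)).mul_left (∑ σ, |M (Y σ)|)) fun K => ?_
  set σ : ι → Bool := fun i => decide (0 ≤ K i)
  rw [norm_mul, norm_exp_I_mul]
  calc _ ≤ M (Y σ) * Real.exp (∑ i, K i * Y σ i) *
        Real.exp (-(∑ i, (K i : ℂ) * z i).im) := by gcongr; exact hb K _ (hY σ)
    _ = M (Y σ) * ∏ i, Real.exp (-(ε * |(K i : ℝ)|)) := by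
      rw [mul_assoc, ← Real.exp_add, ← Real.exp_sum, Complex.im_sum, ← Finset.sum_neg_distrib,
        ← Finset.sum_add_distrib]
      congr 2
      refine Finset.sum_congr rfl fun i _ => ?_
      by_cases h : 0 ≤ K i
      · have h' : (0 : ℝ) ≤ K i := by exact_mod_cast h
        simp only [Y, σ, h, abs_of_nonneg h', decide_true, if_true]
        simp; ring
      · have h' : (K i : ℝ) ≤ 0 := by exact_mod_cast (not_le.1 h).le
        simp only [Y, σ, h, abs_of_nonpos h', decide_false]
        simp; ring
    _ ≤ _ := by
      gcongr
      · exact (le_abs_self _).trans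
          (Finset.single_le_sum (f := fun σ => |M (Y σ)|) (fun _ _ => abs_nonneg _)
            (Finset.mem_univ σ))

/-- A holomorphic function, `2π`-periodic in each coordinate. -/
structure IsPeriodicHol {ι : Type*} [Fintype ι] (S : ι → Set ℝ) (F : (ι → ℂ) → ℂ) : Prop where
  diff : DifferentiableOn ℂ F {z | ∀ i, (z i).im ∈ S i}
  per : ∀ z w : ι → ℂ, (∀ i, (z i).im ∈ S i) → ∀ i, (∀ j, j ≠ i → w j = z j) →
    w i = z i + 2 * Real.pi → F w = F z

theorem isOpen_strips {ι : Type*} [Finite ι] {S : ι → Set ℝ} (hS : ∀ i, IsOpen (S i)) :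
    IsOpen {z : ι → ℂ | ∀ i, (z i).im ∈ S i} := by
  simp only [Set.ofPred_forall]
  exact isOpen_iInter_of_finite fun i => (hS i).preimage (by fun_prop)

/-- Induction on the number of angles: the Fourier coefficients in the first angle are again
periodic and holomorphic in the others. The exponential bound makes the multiple series absolutely
summable, so it may be summed in any order. The majorant `M` depends on the imaginary parts only and
is tested on one period only, so that compactness can supply it. -/
theorem exists_fourier_expansion_fin : ∀ (d : ℕ) (S : Fin d → Set ℝ), (∀ i, IsOpen (S i)) →
    (∀ i, (S i).OrdConnected) → (∀ i, (0 : ℝ) ∈ S i) → ∀ F : (Fin d → ℂ) → ℂ,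
    IsPeriodicHol S F → ∀ M : (Fin d → ℝ) → ℝ,
    (∀ z : Fin d → ℂ, (∀ i, (z i).re ∈ Set.Icc 0 (2 * Real.pi)) → (∀ i, (z i).im ∈ S i) →
      ‖F z‖ ≤ M fun i => (z i).im) →
    ∃ c : (Fin d → ℤ) → ℂ,
      (∀ K y, (∀ i, y i ∈ S i) → ‖c K‖ ≤ M y * Real.exp (∑ i, K i * y i)) ∧
      ∀ z : Fin d → ℂ, (∀ i, (z i).im ∈ S i) →
        HasSum (fun K : Fin d → ℤ => c K * Complex.exp (Complex.I * ∑ i, K i * z i)) (F z) := by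
  intro d
  induction d with
  | zero =>
    intro S hS hc h0 F hF M hM
    refine ⟨fun _ => F 0, fun K y hy => ?_, fun z hz => ?_⟩
    · have := hM 0 (fun i => i.elim0) (fun i => i.elim0)
      simp only [Finset.univ_eq_empty, Finset.sum_empty, Real.exp_zero, mul_one]
      exact this.trans_eq (congrArg M (Subsingleton.elim _ _))
    · simp [Subsingleton.elim z 0]
  | succ d ih =>
    intro S hS hc h0 F hF M hM
    have hopen := isOpen_strips fun i : Fin d => hS i.succ
    have hslice : ∀ w : Fin d → ℂ, (∀ i, (w i).im ∈ S i.succ) →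
        DifferentiableOn ℂ (fun x : ℂ => F (Fin.cons x w)) {x | x.im ∈ S 0} := by
      intro w hw
      refine hF.diff.comp ?_ ?_
      · refine Differentiable.differentiableOn ?_
        rw [differentiable_pi]
        intro i
        refine Fin.cases ?_ (fun j => ?_) i <;> simp
      · intro x hx i
        refine Fin.cases ?_ (fun j => ?_) i
        · simpa using hx
        · simpa using hw j
    have hsper : ∀ w : Fin d → ℂ, (∀ i, (w i).im ∈ S i.succ) → ∀ x : ℂ, x.im ∈ S 0 →
        F (Fin.cons (x + 2 * Real.pi) w) = F (Fin.cons x w) := by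
      intro w hw x hx
      refine hF.per _ _ (fun i => ?_) 0 (fun j hj => ?_) (by simp)
      · refine Fin.cases ?_ (fun j => ?_) i
        · simpa using hx
        · simpa using hw j
      · obtain ⟨j', rfl⟩ := Fin.exists_succ_eq.2 hj
        simp
    have hcoefhol : ∀ k : ℤ, IsPeriodicHol (fun i : Fin d => S i.succ)
        (fun w => fourierCoef (fun x => F (Fin.cons x w)) k) := by
      intro k
      refine ⟨?_, ?_⟩
      · unfold fourierCoef
        refine DifferentiableOn.const_mul ?_ _
        simp only [intervalIntegral.integral_of_le Real.two_pi_pos.le]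
        simp only [← integral_Icc_eq_integral_Ioc]
        refine differentiableOn_setIntegral isCompact_Icc measurableSet_Icc hopen ?_ ?_
        · refine ContinuousOn.mul ?_ (by fun_prop)
          refine hF.diff.continuousOn.comp ?_ ?_
          · refine Continuous.continuousOn ?_
            refine continuous_pi fun i => ?_
            refine Fin.cases ?_ (fun j => ?_) i
            · simp only [Fin.cons_zero]; fun_prop
            · simp only [Fin.cons_succ]; fun_prop
          · rintro ⟨t, w⟩ ⟨_, hw⟩ i
            refine Fin.cases ?_ (fun j => ?_) i
            · simpa using h0 0
            · simpa using hw j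
        · intro t _
          refine DifferentiableOn.mul_const ?_ _
          refine hF.diff.comp ?_ ?_
          · refine Differentiable.differentiableOn ?_
            rw [differentiable_pi]
            intro i
            refine Fin.cases ?_ (fun j => ?_) i
            · simp
            · simp only [Fin.cons_succ]; fun_prop
          · intro w hw i
            refine Fin.cases ?_ (fun j => ?_) i
            · simpa using h0 0
            · simpa using hw j
      · intro z w hz i hij hi
        unfold fourierCoef
        congr 1
        refine intervalIntegral.integral_congr fun t _ => ?_
        simp only
        congr 1
        refine hF.per _ _ (fun j => ?_) i.succ (fun j hj => ?_) (by simpa using hi)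
        · refine Fin.cases ?_ (fun j => ?_) j
          · simpa using h0 0
          · simpa using hz j
        · revert hj
          refine Fin.cases ?_ (fun j => ?_) j
          · simp
          · intro hj
            simpa using hij j (fun h => hj (by rw [h]))
    have hcoefbd : ∀ k : ℤ, ∀ y₀ ∈ S 0, ∀ w : Fin d → ℂ,
        (∀ i, (w i).re ∈ Set.Icc 0 (2 * Real.pi)) → (∀ i, (w i).im ∈ S i.succ) →
        ‖fourierCoef (fun x => F (Fin.cons x w)) k‖ ≤
          M (Fin.cons y₀ fun i => (w i).im) * Real.exp (k * y₀) := by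
      intro k y₀ hy₀ w hwre hw
      refine norm_fourierCoef_le (hc 0) (h0 0) (hslice w hw) (hsper w hw) k hy₀ fun t ht => ?_
      refine (hM _ (fun i => ?_) (fun i => ?_)).trans_eq (congrArg M ?_)
      · refine Fin.cases ?_ (fun j => ?_) i
        · simpa using ht
        · simpa using hwre j
      · refine Fin.cases ?_ (fun j => ?_) i
        · simpa using hy₀
        · simpa using hw j
      · funext i
        refine Fin.cases ?_ (fun j => ?_) i <;> simp
    have hIH : ∀ k : ℤ, ∃ c : (Fin d → ℤ) → ℂ,
        (∀ y₀ ∈ S 0, ∀ K y, (∀ i, y i ∈ S i.succ) →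
          ‖c K‖ ≤ M (Fin.cons y₀ y) * Real.exp (k * y₀) * Real.exp (∑ i, K i * y i)) ∧
        ∀ z : Fin d → ℂ, (∀ i, (z i).im ∈ S i.succ) →
        HasSum (fun K : Fin d → ℤ => c K * Complex.exp (Complex.I * ∑ i, K i * z i))
          (fourierCoef (fun x => F (Fin.cons x z)) k) := by
      intro k
      obtain ⟨c, hc1, hc2⟩ := ih _ (fun i => hS i.succ) (fun i => hc i.succ) (fun i => h0 i.succ) _
        (hcoefhol k)
        -- The heights of the first angle are optimized before the induction hypothesis is applied:
        -- the coefficients it produces must satisfy the estimate for all `y₀` at once.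
        (fun y => ⨅ y₀ : S 0, M (Fin.cons y₀ y) * Real.exp (k * y₀)) (by
          intro w hwre hw
          have : Nonempty (S 0) := ⟨⟨0, h0 0⟩⟩
          exact le_ciInf fun y₀ => hcoefbd k y₀ y₀.2 w hwre hw)
      refine ⟨c, fun y₀ hy₀ K y hy => (hc1 K y hy).trans ?_, hc2⟩
      gcongr
      refine ciInf_le (f := fun y₀ : S 0 => M (Fin.cons y₀ y) * Real.exp (k * y₀)) ?_ ⟨y₀, hy₀⟩
      -- Zero is a lower bound because each candidate majorizes the norm of a coefficient, evaluated
      -- here at a point with zero real parts.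
      refine ⟨0, ?_⟩
      rintro _ ⟨y₁, rfl⟩
      have := hcoefbd k y₁ y₁.2 (fun i => y i * Complex.I)
        (fun i => by simpa using Real.pi_pos.le) (fun i => by simpa using hy i)
      refine (norm_nonneg _).trans (this.trans_eq ?_)
      simp
    choose c hcb hcs using hIH
    have hb : ∀ (K : Fin (d + 1) → ℤ) (y : Fin (d + 1) → ℝ), (∀ i, y i ∈ S i) →
        ‖c (K 0) (Fin.tail K)‖ ≤ M y * Real.exp (∑ i, K i * y i) := by
      intro K y hy
      refine (hcb (K 0) (y 0) (hy 0) (Fin.tail K) (Fin.tail y) (fun i => hy i.succ)).trans_eq ?_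
      rw [Fin.cons_self_tail, mul_assoc, ← Real.exp_add, Fin.sum_univ_succ]
      rfl
    refine ⟨fun K => c (K 0) (Fin.tail K), hb, fun z hz => ?_⟩
    have hsum := summable_of_fourier_bound hS hb hz
    rw [← (Fin.consEquiv fun _ => ℤ).summable_iff] at hsum
    rw [← (Fin.consEquiv fun _ => ℤ).hasSum_iff]
    have h1 := hasSum_fourierCoef (hS 0) (hc 0) (h0 0) (hslice (Fin.tail z) fun i => hz i.succ)
      (hsper (Fin.tail z) fun i => hz i.succ) (hz 0)
    have h2 := hsum.hasSum.prod_fiberwise (g := fun k =>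
      fourierCoef (fun x => F (Fin.cons x (Fin.tail z))) k * Complex.exp (Complex.I * (k * z 0)))
      (by
        intro k
        refine ((hcs k (Fin.tail z) fun i => hz i.succ).mul_right _).congr_fun fun K => ?_
        simp only [Function.comp, Fin.consEquiv, Equiv.coe_fn_mk, Fin.cons_zero, Fin.tail_cons,
          Fin.sum_univ_succ, Fin.cons_succ, Fin.tail]
        rw [mul_assoc, ← Complex.exp_add, mul_add]
        congr 2
        ring)
    rw [Fin.cons_self_tail] at h1
    rw [← h2.unique h1]
    exact hsum.hasSum

/-- Fourier expansion of a holomorphic function periodic in finitely many complex angles. -/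
theorem exists_fourier_expansion {ι : Type*} [Fintype ι] {S : ι → Set ℝ}
    (hS : ∀ i, IsOpen (S i)) (hc : ∀ i, (S i).OrdConnected) (h0 : ∀ i, (0 : ℝ) ∈ S i)
    {F : (ι → ℂ) → ℂ} (hF : IsPeriodicHol S F) {M : (ι → ℝ) → ℝ}
    (hM : ∀ z : ι → ℂ, (∀ i, (z i).re ∈ Set.Icc 0 (2 * Real.pi)) → (∀ i, (z i).im ∈ S i) →
      ‖F z‖ ≤ M fun i => (z i).im) :
    ∃ c : (ι → ℤ) → ℂ,
      (∀ K y, (∀ i, y i ∈ S i) → ‖c K‖ ≤ M y * Real.exp (∑ i, K i * y i)) ∧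
      ∀ z : ι → ℂ, (∀ i, (z i).im ∈ S i) →
        HasSum (fun K : ι → ℤ => c K * Complex.exp (Complex.I * ∑ i, K i * z i)) (F z) := by
  let e := Fintype.equivFin ι
  obtain ⟨c, hc1, hc2⟩ := exists_fourier_expansion_fin _ (fun i => S (e.symm i))
    (fun i => hS _) (fun i => hc _) (fun i => h0 _) (fun z => F fun i => z (e i))
    ⟨by
      refine hF.diff.comp (by fun_prop) fun z hz i => ?_
      simpa using hz (e i), by
      intro z w hz i hij hi
      refine hF.per _ _ (fun j => by simpa using hz (e j)) (e.symm i) (fun j hj => ?_) (by simpa)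
      refine hij _ fun h => hj ?_
      rw [← h, e.symm_apply_apply]⟩
    (fun y => M fun i => y (e i)) (by
      intro z hzr hz
      exact hM _ (fun i => hzr _) (fun i => by simpa using hz (e i)))
  refine ⟨fun K => c fun i => K (e.symm i), fun K y hy => ?_, fun z hz => ?_⟩
  · have := hc1 (fun i => K (e.symm i)) (fun i => y (e.symm i)) (fun i => hy _)
    simp only [Equiv.symm_apply_apply] at this
    rwa [← Equiv.sum_comp e.symm (fun i => (K i : ℝ) * y i)]
  · have := hc2 (fun i => z (e.symm i)) (fun i => hz _)
    simp only [Equiv.symm_apply_apply] at this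
    rw [← (Equiv.arrowCongr e (Equiv.refl ℤ)).hasSum_iff] at this
    refine this.congr_fun fun K => ?_
    simp only [Function.comp, Equiv.arrowCongr, Equiv.coe_fn_mk, Equiv.coe_refl, id]
    rw [← Equiv.sum_comp e.symm (fun i => (K i : ℂ) * z i)]
    rfl

end ManyAngles

/-! ### Coefficients of the Taylor–Fourier expansion -/

section Orthogonality

/-- The period is left free: `T = 2π` serves the Cauchy integrals for the coefficients, `T = 1` the
averages over the unit cube. -/
theorem integral_Icc_exp {T : ℝ} (hT : 0 < T) (k : ℤ) :
    ∫ t in Set.Icc 0 T, Complex.exp (Complex.I * (k * (2 * Real.pi / T * t : ℂ))) =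
      if k = 0 then (T : ℂ) else 0 := by
  rw [integral_Icc_eq_integral_Ioc, ← intervalIntegral.integral_of_le hT.le]
  split_ifs with hk
  · simp [hk]
  have hT' : (T : ℂ) ≠ 0 := by exact_mod_cast hT.ne'
  have hpi : (Real.pi : ℂ) ≠ 0 := by exact_mod_cast Real.pi_ne_zero
  have hk' : (k : ℂ) ≠ 0 := by exact_mod_cast hk
  have h1 := integral_exp_mul_complex (a := 0) (b := T)
    (c := Complex.I * (k * (2 * Real.pi / T))) (by simp [hk', hT', hpi])
  have e : ∀ t : ℝ, Complex.I * (k * (2 * Real.pi / T)) * t =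
      Complex.I * (k * (2 * Real.pi / T * t : ℂ)) := fun t => by ring
  simp only [e] at h1
  rw [h1]
  have e2 : Complex.I * (k * (2 * Real.pi / T * T : ℂ)) = k * (2 * Real.pi * Complex.I) := by
    field_simp
  rw [e2, Complex.exp_int_mul_two_pi_mul_I]
  simp

/-- Orthogonality of the exponentials on a cube. -/
theorem integral_cube_exp {ι : Type*} [Fintype ι] {T : ℝ} (hT : 0 < T) (K : ι → ℤ) :
    ∫ t in Set.Icc (0 : ι → ℝ) (fun _ => T),
      Complex.exp (Complex.I * ∑ i, K i * (2 * Real.pi / T * t i : ℂ)) =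
      if K = 0 then (T : ℂ) ^ Fintype.card ι else 0 := by
  have hset : Set.Icc (0 : ι → ℝ) (fun _ => T) = Set.univ.pi fun _ => Set.Icc 0 T :=
    (Set.pi_univ_Icc _ _).symm
  rw [hset, volume_pi, Measure.restrict_pi_pi]
  simp only [Finset.mul_sum, Complex.exp_sum]
  rw [integral_fintype_prod_eq_prod
    (f := fun i (t : ℝ) => Complex.exp (Complex.I * (K i * (2 * Real.pi / T * t : ℂ))))]
  simp only [integral_Icc_exp hT]
  split_ifs with hK
  · simp [hK]
  · obtain ⟨i, hi⟩ := Function.ne_iff.1 hK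
    exact Finset.prod_eq_zero (Finset.mem_univ i) (if_neg hi)

end Orthogonality

section Coefficients

variable {n m : ℕ}

/-- Multi-indices `(k, h, j)` of the Taylor–Fourier expansion. -/
abbrev Index (n m : ℕ) : Type := (Fin n → ℤ) × (Fin m → ℕ) × (Fin m → ℕ)

/-- The variables `(φ, p, q)`. -/
abbrev Fast (n m : ℕ) : Type := (Fin n → ℂ) × (Fin m → ℂ) × (Fin m → ℂ)

/-- `|h| + |j|`. -/
def Index.deg (K : Index n m) : ℕ := ∑ l, K.2.1 l + ∑ l, K.2.2 l

/-- `e^{i k·φ} p^h q^j`. -/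
def monom (K : Index n m) (w : Fast n m) : ℂ :=
  Complex.exp (Complex.I * ∑ i, K.1 i * w.1 i) * ((∏ l, w.2.1 l ^ K.2.1 l) * ∏ l, w.2.2 l ^ K.2.2 l)

/-- The point `φ = t`, `p = δ e^{iα}`, `q = δ e^{iβ}` of the torus of radius `δ`. -/
def torusPoint (δ : ℝ) (t : (Fin n → ℝ) × (Fin m → ℝ) × (Fin m → ℝ)) : Fast n m :=
  (fun i => (t.1 i : ℂ), fun l => (δ : ℂ) * Complex.exp (Complex.I * (t.2.1 l : ℂ)),
    fun l => (δ : ℂ) * Complex.exp (Complex.I * (t.2.2 l : ℂ)))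

theorem mono_torusPoint (δ : ℝ) (K : Index n m) (t : (Fin n → ℝ) × (Fin m → ℝ) × (Fin m → ℝ)) :
    monom K (torusPoint δ t) = (δ : ℂ) ^ K.deg *
      Complex.exp (Complex.I * (∑ i, (K.1 i : ℂ) * (t.1 i : ℂ) +
          ∑ l, (K.2.1 l : ℂ) * (t.2.1 l : ℂ) + ∑ l, (K.2.2 l : ℂ) * (t.2.2 l : ℂ))) := by
  have h : ∀ (h : Fin m → ℕ) (a : Fin m → ℝ),
      ∏ l, ((δ : ℂ) * Complex.exp (Complex.I * (a l : ℂ))) ^ h l =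
      (δ : ℂ) ^ (∑ l, h l) * Complex.exp (Complex.I * ∑ l, (h l : ℂ) * (a l : ℂ)) := by
    intro h a
    simp only [mul_pow, Finset.prod_mul_distrib, Finset.prod_pow_eq_pow_sum, ← Complex.exp_nat_mul,
      ← Complex.exp_sum, Finset.mul_sum]
    congr 2
    exact Finset.sum_congr rfl fun l _ => by ring
  simp only [monom, torusPoint, h, Index.deg, pow_add, mul_add, Complex.exp_add]
  ring

theorem norm_mono_torusPoint {δ : ℝ} (hδ : 0 ≤ δ) (K : Index n m)
    (t : (Fin n → ℝ) × (Fin m → ℝ) × (Fin m → ℝ)) :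
    ‖monom K (torusPoint δ t)‖ = δ ^ K.deg := by
  rw [mono_torusPoint, norm_mul, norm_exp_I_mul, norm_pow, Complex.norm_real,
    Real.norm_of_nonneg hδ]
  simp

theorem continuous_mono (K : Index n m) : Continuous (monom K : Fast n m → ℂ) := by
  unfold monom; fun_prop

theorem continuous_torusPoint (δ : ℝ) : Continuous (torusPoint δ :
    (Fin n → ℝ) × (Fin m → ℝ) × (Fin m → ℝ) → Fast n m) := by
  unfold torusPoint; fun_prop

theorem integral_box_exp (k : Fin n → ℤ) (h j : Fin m → ℤ) :
    ∫ t in Set.Icc (0 : (Fin n → ℝ) × (Fin m → ℝ) × (Fin m → ℝ))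
        (fun _ => 2 * Real.pi, fun _ => 2 * Real.pi, fun _ => 2 * Real.pi),
      Complex.exp (Complex.I * (∑ i, (k i : ℂ) * (t.1 i : ℂ) +
          ∑ l, (h l : ℂ) * (t.2.1 l : ℂ) + ∑ l, (j l : ℂ) * (t.2.2 l : ℂ))) =
      if k = 0 ∧ h = 0 ∧ j = 0 then ((2 * Real.pi : ℝ) : ℂ) ^ (n + 2 * m) else 0 := by
  have hone : ∀ (d : ℕ) (K : Fin d → ℤ), ∫ t in Set.Icc (0 : Fin d → ℝ) (fun _ => 2 * Real.pi),
      Complex.exp (Complex.I * ∑ i, (K i : ℂ) * (t i : ℂ)) =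
      if K = 0 then ((2 * Real.pi : ℝ) : ℂ) ^ d else 0 := by
    intro d K
    have := integral_cube_exp Real.two_pi_pos K
    rw [Fintype.card_fin] at this
    rw [← this]
    refine integral_congr_ae (ae_of_all _ fun t => ?_)
    simp only
    congr 2
    refine Finset.sum_congr rfl fun i _ => ?_
    have : (Real.pi : ℂ) ≠ 0 := by exact_mod_cast Real.pi_ne_zero
    push_cast
    field_simp
  have hset : Set.Icc (0 : (Fin n → ℝ) × (Fin m → ℝ) × (Fin m → ℝ))
        (fun _ => 2 * Real.pi, fun _ => 2 * Real.pi, fun _ => 2 * Real.pi) =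
      Set.Icc 0 (fun _ => 2 * Real.pi) ×ˢ
        (Set.Icc 0 (fun _ => 2 * Real.pi) ×ˢ Set.Icc 0 (fun _ => 2 * Real.pi)) := by
    rw [Set.Icc_prod_Icc, Set.Icc_prod_Icc]
    rfl
  rw [hset]
  simp only [add_assoc, mul_add, Complex.exp_add]
  rw [Measure.volume_eq_prod, setIntegral_prod_mul
    (f := fun t : Fin n → ℝ => Complex.exp (Complex.I * ∑ i, (k i : ℂ) * (t i : ℂ)))
    (g := fun t : (Fin m → ℝ) × (Fin m → ℝ) =>
      Complex.exp (Complex.I * ∑ l, (h l : ℂ) * (t.1 l : ℂ)) *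
        Complex.exp (Complex.I * ∑ l, (j l : ℂ) * (t.2 l : ℂ))),
    Measure.volume_eq_prod, setIntegral_prod_mul
    (f := fun t : Fin m → ℝ => Complex.exp (Complex.I * ∑ i, (h i : ℂ) * (t i : ℂ)))
    (g := fun t : Fin m → ℝ => Complex.exp (Complex.I * ∑ i, (j i : ℂ) * (t i : ℂ))),
    hone, hone, hone]
  by_cases h1 : k = 0 <;> by_cases h2 : h = 0 <;> by_cases h3 : j = 0 <;> simp [h1, h2, h3]
  ring

theorem coeff_eq (δ : ℝ) (g : Phase n m → ℂ) (K : Index n m) (r : ℂ) (I : Fin n → ℂ) (x : ℂ) :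
    coeff δ g K.1 K.2.1 K.2.2 r I x = (((2 * Real.pi) ^ (n + 2 * m) : ℝ) : ℂ)⁻¹ *
    ∫ t in Set.Icc (0 : (Fin n → ℝ) × (Fin m → ℝ) × (Fin m → ℝ))
        (fun _ => 2 * Real.pi, fun _ => 2 * Real.pi, fun _ => 2 * Real.pi),
      g (r, I, x, torusPoint δ t) *
        Complex.exp (-Complex.I * (∑ i, (K.1 i : ℂ) * (t.1 i : ℂ) +
          ∑ l, (K.2.1 l : ℂ) * (t.2.1 l : ℂ) + ∑ l, (K.2.2 l : ℂ) * (t.2.2 l : ℂ))) /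
        (δ : ℂ) ^ K.deg := rfl

/-- The coefficients of an absolutely convergent Taylor–Fourier series. -/
theorem hasSum_coeff {β : Type*} [Countable β] {δ : ℝ} (hδ : 0 < δ) {g : Phase n m → ℂ}
    {r : ℂ} {I : Fin n → ℂ} {x : ℂ} {c : β → ℂ} {L : β → Index n m}
    (hs : Summable fun b => ‖c b‖ * δ ^ (L b).deg)
    (hg : ∀ t, HasSum (fun b => c b * monom (L b) (torusPoint δ t)) (g (r, I, x, torusPoint δ t)))
    (K : Index n m) :
    HasSum (fun b => if L b = K then c b else 0) (coeff δ g K.1 K.2.1 K.2.2 r I x) := by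
  set box := Set.Icc (0 : (Fin n → ℝ) × (Fin m → ℝ) × (Fin m → ℝ))
        (fun _ => 2 * Real.pi, fun _ => 2 * Real.pi, fun _ => 2 * Real.pi) with hbox
  have hboxc : IsCompact box := isCompact_Icc
  have : IsFiniteMeasure (volume.restrict box) := ⟨by simpa using hboxc.measure_lt_top⟩
  set E : Index n m → (Fin n → ℝ) × (Fin m → ℝ) × (Fin m → ℝ) → ℂ := fun K t =>
    Complex.exp (-Complex.I * (∑ i, (K.1 i : ℂ) * (t.1 i : ℂ) +
          ∑ l, (K.2.1 l : ℂ) * (t.2.1 l : ℂ) + ∑ l, (K.2.2 l : ℂ) * (t.2.2 l : ℂ))) with hE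
  have hEc : ∀ K, Continuous (E K) := fun K => by
    simp only [hE]; fun_prop
  have hEn : ∀ K t, ‖E K t‖ = 1 := fun K t => by
    simp only [hE]
    rw [neg_mul, ← mul_neg, norm_exp_I_mul]
    simp
  set F : β → (Fin n → ℝ) × (Fin m → ℝ) × (Fin m → ℝ) → ℂ := fun b t =>
    c b * monom (L b) (torusPoint δ t) * E K t / (δ : ℂ) ^ K.deg with hF
  have hδ' : (δ : ℂ) ≠ 0 := by exact_mod_cast hδ.ne'
  have hFc : ∀ b, Continuous (F b) := fun b => by
    have := (continuous_mono (L b)).comp (continuous_torusPoint δ)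
    have h2 := hEc K
    simp only [hF]
    exact ((continuous_const.mul this).mul h2).div_const _
  have hFn : ∀ b t, ‖F b t‖ = ‖c b‖ * δ ^ (L b).deg / δ ^ K.deg := fun b t => by
    simp only [hF]
    rw [norm_div, norm_mul, norm_mul, norm_mono_torusPoint hδ.le, hEn, norm_pow,
      Complex.norm_real, Real.norm_of_nonneg hδ.le, mul_one]
  -- Each term has constant modulus on the torus, so absolute summability dominates the series. `L`
  -- need not be injective: terms sharing an index are simply added up.
  have hsum := hasSum_integral_of_summable_integral_norm (μ := volume.restrict box) (F := F)
    (fun b => ((hFc b).continuousOn.integrableOn_compact hboxc)) (by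
      simp only [hFn, integral_const, smul_eq_mul]
      exact (hs.div_const _).mul_left _)
  rw [coeff_eq]
  have htot : ∀ t, ∑' b, F b t = g (r, I, x, torusPoint δ t) * E K t / (δ : ℂ) ^ K.deg :=
    fun t => (((hg t).mul_right _).div_const _).tsum_eq
  simp only [htot] at hsum
  refine (hsum.mul_left ((((2 * Real.pi) ^ (n + 2 * m) : ℝ) : ℂ)⁻¹)).congr_fun fun b => ?_
  have hFe : ∀ t, F b t = c b * (δ : ℂ) ^ (L b).deg / (δ : ℂ) ^ K.deg *
      Complex.exp (Complex.I * (∑ i, (((L b).1 - K.1) i : ℂ) * (t.1 i : ℂ) +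
        ∑ l, (((fun l => ((L b).2.1 l : ℤ) - K.2.1 l) l : ℤ) : ℂ) * (t.2.1 l : ℂ) +
        ∑ l, (((fun l => ((L b).2.2 l : ℤ) - K.2.2 l) l : ℤ) : ℂ) * (t.2.2 l : ℂ))) := by
    intro t
    simp only [hF, hE, mono_torusPoint]
    have : ∀ A B C : ℂ, c b * ((δ : ℂ) ^ (L b).deg * A) * B / (δ : ℂ) ^ K.deg =
        c b * (δ : ℂ) ^ (L b).deg / (δ : ℂ) ^ K.deg * (A * B) := fun A B C => by ring
    rw [this _ _ 0, ← Complex.exp_add]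
    congr 2
    simp only [Pi.sub_apply, Int.cast_sub, Int.cast_natCast, sub_mul, Finset.sum_sub_distrib]
    ring
  simp only [hFe]
  rw [integral_const_mul]
  have := integral_box_exp ((L b).1 - K.1) (fun l => ((L b).2.1 l : ℤ) - K.2.1 l)
    (fun l => ((L b).2.2 l : ℤ) - K.2.2 l)
  simp only [Pi.sub_apply] at this ⊢
  rw [this]
  have hiff : ((L b).1 - K.1 = 0 ∧ (fun l => ((L b).2.1 l : ℤ) - K.2.1 l) = 0 ∧
      (fun l => ((L b).2.2 l : ℤ) - K.2.2 l) = 0) ↔ L b = K := by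
    rw [Prod.ext_iff, Prod.ext_iff, sub_eq_zero]
    simp only [funext_iff, Pi.zero_apply, sub_eq_zero, Nat.cast_inj]
  rw [if_congr hiff rfl rfl]
  split_ifs with hK
  · rw [hK]
    have : (Real.pi : ℂ) ≠ 0 := by exact_mod_cast Real.pi_ne_zero
    push_cast
    field_simp
  · simp

end Coefficients

/-! ### Expansion in the fast variables -/

section FastExpansion

variable {n m : ℕ}

/-- The domain `Im φ_i ∈ S`, `|p_l| < δ`, `|q_l| < δ` of the fast variables. -/
def fastDomain (n m : ℕ) (S : Set ℝ) (δ : ℝ) : Set (Fast n m) :=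
  {w | (∀ i, (w.1 i).im ∈ S) ∧ (∀ l, ‖w.2.1 l‖ < δ) ∧ ∀ l, ‖w.2.2 l‖ < δ}

/-- The point with `p = δ e^{iα}`, `q = δ e^{iβ}` for complex angles. -/
def expPoint (δ : ℝ) (z : Fin n ⊕ Fin m ⊕ Fin m → ℂ) : Fast n m :=
  (fun i => z (.inl i), fun l => (δ : ℂ) * Complex.exp (Complex.I * z (.inr (.inl l))),
    fun l => (δ : ℂ) * Complex.exp (Complex.I * z (.inr (.inr l))))

/-- With `p = δ e^{iα}` the disc `|p| < δ'` becomes the half-plane `Im α > -log (δ'/δ)`. It contains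
the real axis when `δ < δ'`, and it is unbounded above, which is what excludes negative powers. -/
def angleStrips (n m : ℕ) (S : Set ℝ) (δ δ' : ℝ) : Fin n ⊕ Fin m ⊕ Fin m → Set ℝ :=
  Sum.elim (fun _ => S) fun _ => Set.Ioi (-Real.log (δ' / δ))

theorem norm_mul_exp_lt {δ δ' y : ℝ} (hδ : 0 < δ) (hδ' : 0 < δ') :
    δ * Real.exp (-y) < δ' ↔ -Real.log (δ' / δ) < y := by
  rw [← lt_div_iff₀' hδ, ← Real.lt_log_iff_exp_lt (by positivity)]
  constructor <;> intro h <;> linarith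

theorem expPoint_mem {S : Set ℝ} {δ δ' : ℝ} (hδ : 0 < δ) (hδ' : 0 < δ')
    {z : Fin n ⊕ Fin m ⊕ Fin m → ℂ} (hz : ∀ i, (z i).im ∈ angleStrips n m S δ δ' i) :
    expPoint δ z ∈ fastDomain n m S δ' := by
  refine ⟨fun i => hz (.inl i), fun l => ?_, fun l => ?_⟩
  · simp only [expPoint, norm_mul, norm_exp_I_mul, Complex.norm_real, Real.norm_of_nonneg hδ.le]
    exact (norm_mul_exp_lt hδ hδ').2 (hz (.inr (.inl l)))
  · simp only [expPoint, norm_mul, norm_exp_I_mul, Complex.norm_real, Real.norm_of_nonneg hδ.le]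
    exact (norm_mul_exp_lt hδ hδ').2 (hz (.inr (.inr l)))

/-- `(k, h, j)` as a family of Fourier indices of the angles `(φ, α, β)`. -/
def Index.toAngles (K : Index n m) : Fin n ⊕ Fin m ⊕ Fin m → ℤ :=
  Sum.elim K.1 (Sum.elim (fun l => (K.2.1 l : ℤ)) fun l => (K.2.2 l : ℤ))

theorem Index.toAngles_injective : Function.Injective (Index.toAngles : Index n m → _) := by
  rintro ⟨k, h, j⟩ ⟨k', h', j'⟩ hK
  simp only [Prod.mk.injEq]
  refine ⟨funext fun i => congrFun hK (.inl i), funext fun l => ?_, funext fun l => ?_⟩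
  · exact Int.ofNat.inj (congrFun hK (.inr (.inl l)))
  · exact Int.ofNat.inj (congrFun hK (.inr (.inr l)))

theorem mono_expPoint (δ : ℝ) (K : Index n m) (z : Fin n ⊕ Fin m ⊕ Fin m → ℂ) :
    monom K (expPoint δ z) = (δ : ℂ) ^ K.deg *
      Complex.exp (Complex.I * ∑ i, K.toAngles i * z i) := by
  have h : ∀ (h : Fin m → ℕ) (a : Fin m → ℂ),
      ∏ l, ((δ : ℂ) * Complex.exp (Complex.I * a l)) ^ h l =
      (δ : ℂ) ^ (∑ l, h l) * Complex.exp (Complex.I * ∑ l, (h l : ℂ) * a l) := by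
    intro h a
    simp only [mul_pow, Finset.prod_mul_distrib, Finset.prod_pow_eq_pow_sum, ← Complex.exp_nat_mul,
      ← Complex.exp_sum, Finset.mul_sum]
    congr 2
    exact Finset.sum_congr rfl fun l _ => by ring
  simp only [monom, expPoint, h, Index.deg, pow_add, Fintype.sum_sum_type, Index.toAngles,
    Sum.elim_inl, Sum.elim_inr, mul_add, Complex.exp_add, Int.cast_natCast]
  ring

theorem isPeriodicHol_expPoint {S : Set ℝ} {δ δ' : ℝ} (hδ : 0 < δ) (hδ' : 0 < δ')
    {G : Fast n m → ℂ} (hd : DifferentiableOn ℂ G (fastDomain n m S δ'))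
    (hper : ∀ w ∈ fastDomain n m S δ', ∀ i,
      G (w.1 + Pi.single i (2 * (Real.pi : ℂ)), w.2) = G w) :
    IsPeriodicHol (angleStrips n m S δ δ') (fun z => G (expPoint δ z)) := by
  refine ⟨hd.comp ?_ fun z hz => expPoint_mem hδ hδ' hz, ?_⟩
  · unfold expPoint; fun_prop
  · intro z w hz i hij hi
    have hexp : Complex.exp (Complex.I * w i) = Complex.exp (Complex.I * z i) := by
      have := exp_I_mul_int_two_pi 1 (z i)
      rw [hi]; simpa using this
    rcases i with i | l | l
    · rw [← hper _ (expPoint_mem hδ hδ' hz) i]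
      congr 1
      refine Prod.ext (funext fun j => ?_) (Prod.ext (funext fun j => ?_) (funext fun j => ?_))
      · rcases eq_or_ne j i with rfl | hj
        · simp [expPoint, hi]
        · simp [expPoint, hj, hij (.inl j) (by simpa using hj)]
      · simp [expPoint, hij]
      · simp [expPoint, hij]
    · congr 1
      refine Prod.ext (funext fun j => ?_) (Prod.ext (funext fun j => ?_) (funext fun j => ?_))
      · simp [expPoint, hij]
      · rcases eq_or_ne j l with rfl | hj
        · simp [expPoint, hexp]
        · simp [expPoint, hij (.inr (.inl j)) (by simpa using hj)]
      · simp [expPoint, hij]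
    · congr 1
      refine Prod.ext (funext fun j => ?_) (Prod.ext (funext fun j => ?_) (funext fun j => ?_))
      · simp [expPoint, hij]
      · simp [expPoint, hij]
      · rcases eq_or_ne j l with rfl | hj
        · simp [expPoint, hexp]
        · simp [expPoint, hij (.inr (.inr j)) (by simpa using hj)]

theorem exists_expPoint {S : Set ℝ} {δ δ' : ℝ} (hδ : 0 < δ) (hδ' : 0 < δ') {w : Fast n m}
    (hw : w ∈ fastDomain n m S δ') (hp : ∀ l, w.2.1 l ≠ 0) (hq : ∀ l, w.2.2 l ≠ 0) :
    ∃ z, (∀ i, (z i).im ∈ angleStrips n m S δ δ' i) ∧ expPoint δ z = w := by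
  have hδc : (δ : ℂ) ≠ 0 := by exact_mod_cast hδ.ne'
  have key : ∀ p : ℂ, p ≠ 0 →
      (δ : ℂ) * Complex.exp (Complex.I * (-Complex.I * Complex.log (p / δ))) = p := by
    intro p hp
    have : Complex.I * (-Complex.I * Complex.log (p / δ)) = Complex.log (p / δ) := by
      rw [← mul_assoc]; simp
    rw [this, Complex.exp_log (div_ne_zero hp hδc)]
    field_simp
  have him : ∀ p : ℂ, p ≠ 0 → ‖p‖ < δ' →
      -Real.log (δ' / δ) < (-Complex.I * Complex.log (p / δ)).im := by
    intro p hp hpd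
    rw [← norm_mul_exp_lt hδ hδ', ← norm_exp_I_mul]
    rw [← key p hp, norm_mul, Complex.norm_real, Real.norm_of_nonneg hδ.le] at hpd
    exact hpd
  refine ⟨Sum.elim w.1 (Sum.elim (fun l => -Complex.I * Complex.log (w.2.1 l / δ))
    (fun l => -Complex.I * Complex.log (w.2.2 l / δ))), ?_, ?_⟩
  · rintro (i | l | l)
    · exact hw.1 i
    · exact him _ (hp l) (hw.2.1 l)
    · exact him _ (hq l) (hw.2.2 l)
  · refine Prod.ext rfl (Prod.ext (funext fun l => ?_) (funext fun l => ?_))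
    · exact key _ (hp l)
    · exact key _ (hq l)

theorem norm_mono (K : Index n m) (w : Fast n m) :
    ‖monom K w‖ = Real.exp (-∑ i, K.1 i * (w.1 i).im) *
      ((∏ l, ‖w.2.1 l‖ ^ K.2.1 l) * ∏ l, ‖w.2.2 l‖ ^ K.2.2 l) := by
  rw [monom, norm_mul, norm_mul, norm_exp_I_mul, norm_prod, norm_prod]
  simp [Complex.im_sum]

theorem norm_mono_le {K : Index n m} {w w' : Fast n m} (h0 : ∀ i, (w.1 i).im = (w'.1 i).im)
    (h1 : ∀ l, ‖w.2.1 l‖ ≤ ‖w'.2.1 l‖) (h2 : ∀ l, ‖w.2.2 l‖ ≤ ‖w'.2.2 l‖) :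
    ‖monom K w‖ ≤ ‖monom K w'‖ := by
  simp only [norm_mono, h0]
  gcongr with l _ l _
  · exact h1 l
  · exact h2 l

/-- Taylor–Fourier expansion in the fast variables, with Cauchy estimates. -/
theorem exists_fast_expansion {S : Set ℝ} (hS : IsOpen S) (hSc : S.OrdConnected)
    (hS0 : (0 : ℝ) ∈ S) {δ δ' : ℝ} (hδ : 0 < δ) (hδδ' : δ < δ')
    {G : Fast n m → ℂ} (hd : DifferentiableOn ℂ G (fastDomain n m S δ'))
    (hper : ∀ w ∈ fastDomain n m S δ', ∀ i,
      G (w.1 + Pi.single i (2 * (Real.pi : ℂ)), w.2) = G w)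
    {M : (Fin n → ℝ) → ℝ}
    (hM : ∀ w ∈ fastDomain n m S δ', (∀ i, (w.1 i).re ∈ Set.Icc 0 (2 * Real.pi)) →
      ‖G w‖ ≤ M fun i => (w.1 i).im) :
    ∃ c : Index n m → ℂ,
      (∀ K y, (∀ i, y i ∈ S) → ∀ δ'', 0 < δ'' → δ'' < δ' →
        ‖c K‖ * δ'' ^ K.deg ≤ M y * Real.exp (∑ i, K.1 i * y i)) ∧
      ∀ w ∈ fastDomain n m S δ', HasSum (fun K => c K * monom K w) (G w) := by
  have hδ' : 0 < δ' := hδ.trans hδδ'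
  have hδc : (δ : ℂ) ≠ 0 := by exact_mod_cast hδ.ne'
  have hlog : 0 < Real.log (δ' / δ) := Real.log_pos ((one_lt_div hδ).2 hδδ')
  have hSo : ∀ i, IsOpen (angleStrips n m S δ δ' i) := by
    rintro (i | l)
    · exact hS
    · exact isOpen_Ioi
  obtain ⟨c, hcb, hcs⟩ := exists_fourier_expansion (S := angleStrips n m S δ δ') hSo
    (by
      rintro (i | l)
      · exact hSc
      · exact Set.ordConnected_Ioi)
    (by
      rintro (i | l)
      · exact hS0
      · simpa [angleStrips] using hlog)
    (isPeriodicHol_expPoint hδ hδ' hd hper) (M := fun y => M fun i => y (.inl i)) (by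
      intro z hzr hz
      exact hM _ (expPoint_mem hδ hδ' hz) fun i => hzr (.inl i))
  -- negative powers are absent
  have hneg : ∀ K : Fin n ⊕ Fin m ⊕ Fin m → ℤ, (∃ l, K (.inr l) < 0) → c K = 0 := by
    classical
    rintro K ⟨l, hl⟩
    -- The imaginary part of the offending angle may be sent to `+∞`, that is `p` or `q` to `0`; a
    -- negative exponent then forces the coefficient to vanish.
    have hle : ∀ Y : ℝ, 0 ≤ Y → ‖c K‖ ≤ M 0 * Real.exp (-Y) := by
      intro Y hY
      have := hcb K (Pi.single (.inr l) Y) (by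
        rintro (i | l')
        · simpa [angleStrips] using hS0
        · rw [Pi.single_apply]
          simp only [angleStrips, Sum.elim_inr, Set.mem_Ioi]
          split_ifs <;> linarith)
      have hM0 : (fun i : Fin n => (Pi.single (.inr l) Y : Fin n ⊕ Fin m ⊕ Fin m → ℝ) (.inl i)) =
          0 := by
        funext i; simp
      rw [hM0] at this
      have hM0' : 0 ≤ M 0 := by
        by_contra hcon
        have h2 : M 0 * Real.exp (∑ i, K i *
          (Pi.single (.inr l) Y : Fin n ⊕ Fin m ⊕ Fin m → ℝ) i) < 0 :=
          mul_neg_of_neg_of_pos (not_le.1 hcon) (Real.exp_pos _)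
        linarith [norm_nonneg (c K)]
      refine this.trans ?_
      gcongr
      rw [Finset.sum_eq_single (.inr l) (fun b _ hb => by simp [hb]) (by simp)]
      rw [Pi.single_eq_same]
      have h1 : (K (.inr l) : ℝ) ≤ -1 := by
        have : K (.inr l) ≤ -1 := by omega
        exact_mod_cast this
      nlinarith
    have hlim : Tendsto (fun Y : ℝ => M 0 * Real.exp (-Y)) atTop (𝓝 (M 0 * 0)) :=
      Real.tendsto_exp_neg_atTop_nhds_zero.const_mul _
    have := ge_of_tendsto hlim ((eventually_ge_atTop 0).mono hle)
    rw [mul_zero] at this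
    exact norm_le_zero_iff.1 this
  have hrange : ∀ K : Fin n ⊕ Fin m ⊕ Fin m → ℤ, K ∉ Set.range (Index.toAngles : Index n m → _) →
      c K = 0 := by
    intro K hK
    refine hneg K ?_
    by_contra! hcon
    refine hK ⟨(fun i => K (.inl i), fun l => (K (.inr (.inl l))).toNat,
      fun l => (K (.inr (.inr l))).toNat), funext ?_⟩
    rintro (i | l | l)
    · rfl
    · exact Int.toNat_of_nonneg (hcon _)
    · exact Int.toNat_of_nonneg (hcon _)
  set C : Index n m → ℂ := fun K => c K.toAngles / (δ : ℂ) ^ K.deg with hC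
  have hsum : ∀ z, (∀ i, (z i).im ∈ angleStrips n m S δ δ' i) →
      HasSum (fun K => C K * monom K (expPoint δ z)) (G (expPoint δ z)) := by
    intro z hz
    have h1 := hcs z hz
    rw [← Index.toAngles_injective.hasSum_iff] at h1
    · refine h1.congr_fun fun K => ?_
      simp only [Function.comp, hC, mono_expPoint]
      have : (δ : ℂ) ^ K.deg ≠ 0 := pow_ne_zero _ hδc
      field_simp
    · intro K hK
      rw [hrange K hK, zero_mul]
  have hsum' : ∀ w ∈ fastDomain n m S δ', (∀ l, w.2.1 l ≠ 0) → (∀ l, w.2.2 l ≠ 0) →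
      HasSum (fun K => C K * monom K w) (G w) := by
    intro w hw hp hq
    obtain ⟨z, hz, rfl⟩ := exists_expPoint hδ hδ' hw hp hq
    exact hsum z hz
  refine ⟨C, fun K y hy δ'' h0 h1 => ?_, fun w hw => ?_⟩
  · have h2 := hcb K.toAngles (Sum.elim y fun _ => Real.log (δ / δ'')) (by
      rintro (i | l)
      · exact hy i
      · simp only [angleStrips, Sum.elim_inr, Set.mem_Ioi, ← Real.log_inv, inv_div]
        exact Real.log_lt_log (by positivity) (by gcongr))
    simp only [Fintype.sum_sum_type, Index.toAngles, Sum.elim_inl, Sum.elim_inr,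
      ← Finset.sum_mul, Int.cast_natCast] at h2
    have e : ((∑ l, (K.2.1 l : ℝ)) + ∑ l, (K.2.2 l : ℝ)) = (K.deg : ℝ) := by
      simp [Index.deg]
    rw [e, Real.exp_add, Real.exp_nat_mul, Real.exp_log (by positivity)] at h2
    simp only [hC, norm_div, norm_pow, Complex.norm_real, Real.norm_of_nonneg hδ.le]
    rw [div_mul_eq_mul_div, div_le_iff₀ (by positivity)]
    calc _ ≤ (M y * (Real.exp (∑ i, K.1 i * y i) * (δ / δ'') ^ K.deg)) * δ'' ^ K.deg := by
          gcongr
          exact h2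
      _ = _ := by
          rw [div_pow]
          field_simp
  · -- approach `w` through points with nonzero components
    obtain ⟨ε, hε, hεp, hεq⟩ : ∃ ε > 0, (∀ l, ‖w.2.1 l‖ + ε < δ') ∧ ∀ l, ‖w.2.2 l‖ + ε < δ' := by
      have h1 : ∀ l, ∀ᶠ ε : ℝ in 𝓝[>] 0, ‖w.2.1 l‖ + ε < δ' := fun l =>
        nhdsWithin_le_nhds ((continuous_const.add continuous_id).continuousAt.eventually
          (gt_mem_nhds (by simpa using hw.2.1 l)))
      have h2 : ∀ l, ∀ᶠ ε : ℝ in 𝓝[>] 0, ‖w.2.2 l‖ + ε < δ' := fun l =>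
        nhdsWithin_le_nhds ((continuous_const.add continuous_id).continuousAt.eventually
          (gt_mem_nhds (by simpa using hw.2.2 l)))
      obtain ⟨ε, h⟩ := (((eventually_all.2 h1).and (eventually_all.2 h2)).and
        self_mem_nhdsWithin).exists
      exact ⟨ε, h.2, h.1.1, h.1.2⟩
    let W : ℝ → Fast n m := fun t => (w.1, fun l => if w.2.1 l = 0 then (t : ℂ) else w.2.1 l,
      fun l => if w.2.2 l = 0 then (t : ℂ) else w.2.2 l)
    have hWc : Continuous W := by
      refine continuous_const.prodMk
        ((continuous_pi fun l => ?_).prodMk (continuous_pi fun l => ?_))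
      · split_ifs <;> fun_prop
      · split_ifs <;> fun_prop
    have hW0 : W 0 = w := by
      refine Prod.ext rfl (Prod.ext (funext fun l => ?_) (funext fun l => ?_))
      · simp only [W]; split_ifs with h <;> simp [h]
      · simp only [W]; split_ifs with h <;> simp [h]
    have hWmem : ∀ t ∈ Set.Icc 0 ε, W t ∈ fastDomain n m S δ' := by
      intro t ht
      refine ⟨hw.1, fun l => ?_, fun l => ?_⟩
      · simp only [W]
        split_ifs
        · rw [Complex.norm_real, Real.norm_of_nonneg ht.1]
          linarith [hεp l, norm_nonneg (w.2.1 l), ht.2]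
        · exact hw.2.1 l
      · simp only [W]
        split_ifs
        · rw [Complex.norm_real, Real.norm_of_nonneg ht.1]
          linarith [hεq l, norm_nonneg (w.2.2 l), ht.2]
        · exact hw.2.2 l
    have hWne : ∀ t ∈ Set.Ioc 0 ε, (∀ l, (W t).2.1 l ≠ 0) ∧ ∀ l, (W t).2.2 l ≠ 0 := by
      intro t ht
      have : (t : ℂ) ≠ 0 := by exact_mod_cast ht.1.ne'
      constructor
      · intro l
        simp only [W]
        split_ifs with h
        · exact this
        · exact h
      · intro l
        simp only [W]
        split_ifs with h
        · exact this
        · exact h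
    -- The exponential substitution misses `p_l = 0` and `q_l = 0`. Filling the zero components with
    -- `t` gives monomials whose moduli increase with `t`, so the series at `t = ε` dominates and
    -- the expansion passes to the limit `t → 0`.
    have hdom : ∀ K, ∀ t ∈ Set.Icc 0 ε, ‖C K * monom K (W t)‖ ≤ ‖C K * monom K (W ε)‖ := by
      intro K t ht
      rw [norm_mul, norm_mul]
      gcongr
      refine norm_mono_le (fun i => rfl) (fun l => ?_) (fun l => ?_)
      · simp only [W]
        split_ifs
        · simpa [abs_of_nonneg ht.1, abs_of_pos hε] using ht.2
        · exact le_rfl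
      · simp only [W]
        split_ifs
        · simpa [abs_of_nonneg ht.1, abs_of_pos hε] using ht.2
        · exact le_rfl
    have hεmem : ε ∈ Set.Icc 0 ε := ⟨hε.le, le_rfl⟩
    have hsumε : Summable fun K => ‖C K * monom K (W ε)‖ :=
      (hsum' _ (hWmem ε hεmem) (hWne ε ⟨hε, le_rfl⟩).1 (hWne ε ⟨hε, le_rfl⟩).2).summable.norm
    have hcont : ContinuousOn (fun t => ∑' K, C K * monom K (W t)) (Set.Icc 0 ε) :=
      continuousOn_tsum (fun K => (continuous_const.mul
        ((continuous_mono K).comp hWc)).continuousOn) hsumε hdom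
    have hGc : ContinuousOn (fun t => G (W t)) (Set.Icc 0 ε) :=
      hd.continuousOn.comp hWc.continuousOn hWmem
    have h0mem : (0 : ℝ) ∈ Set.Icc 0 ε := ⟨le_rfl, hε.le⟩
    have hlim1 : Tendsto (fun t => ∑' K, C K * monom K (W t)) (𝓝[Set.Ioc 0 ε] 0)
        (𝓝 (∑' K, C K * monom K (W 0))) :=
      ((hcont 0 h0mem).mono Set.Ioc_subset_Icc_self)
    have hlim2 : Tendsto (fun t => G (W t)) (𝓝[Set.Ioc 0 ε] 0) (𝓝 (G (W 0))) :=
      ((hGc 0 h0mem).mono Set.Ioc_subset_Icc_self)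
    have hNB : (𝓝[Set.Ioc 0 ε] (0 : ℝ)).NeBot := by
      rw [nhdsWithin_Ioc_eq_nhdsGT hε]; infer_instance
    have heq := tendsto_nhds_unique_of_eventuallyEq hlim1 hlim2 (by
      filter_upwards [self_mem_nhdsWithin] with t ht
      exact (hsum' _ (hWmem t (Set.Ioc_subset_Icc_self ht)) (hWne t ht).1 (hWne t ht).2).tsum_eq)
    rw [hW0] at heq
    rw [← heq]
    refine (Summable.of_norm_bounded hsumε fun K => ?_).hasSum
    have := hdom K 0 h0mem
    rwa [hW0] at this

/-- The coefficients `coeff` satisfy the Cauchy estimates and sum up to the function. -/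
theorem coeff_expansion {g : Phase n m → ℂ} {r : ℂ} {I : Fin n → ℂ} {x : ℂ}
    {S : Set ℝ} (hS : IsOpen S) (hSc : S.OrdConnected)
    (hS0 : (0 : ℝ) ∈ S) {δ δ' : ℝ} (hδ : 0 < δ) (hδδ' : δ < δ')
    (hd : DifferentiableOn ℂ (fun w : Fast n m => g (r, I, x, w)) (fastDomain n m S δ'))
    (hper : ∀ w ∈ fastDomain n m S δ', ∀ i,
      g (r, I, x, w.1 + Pi.single i (2 * (Real.pi : ℂ)), w.2) = g (r, I, x, w))
    {M : (Fin n → ℝ) → ℝ}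
    (hM : ∀ w ∈ fastDomain n m S δ', (∀ i, (w.1 i).re ∈ Set.Icc 0 (2 * Real.pi)) →
      ‖g (r, I, x, w)‖ ≤ M fun i => (w.1 i).im) :
    (∀ (K : Index n m) y, (∀ i, y i ∈ S) → ∀ δ'', 0 < δ'' → δ'' < δ' →
        ‖coeff δ g K.1 K.2.1 K.2.2 r I x‖ * δ'' ^ K.deg ≤
          M y * Real.exp (∑ i, K.1 i * y i)) ∧
      ∀ w ∈ fastDomain n m S δ',
        HasSum (fun K : Index n m => coeff δ g K.1 K.2.1 K.2.2 r I x * monom K w)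
          (g (r, I, x, w)) := by
  obtain ⟨c, hc1, hc2⟩ := exists_fast_expansion hS hSc hS0 hδ hδδ' hd hper hM
  have htor : ∀ t, (torusPoint δ t : Fast n m) ∈ fastDomain n m S δ' := by
    intro t
    have hn : ∀ a : ℝ, ‖(δ : ℂ) * Complex.exp (Complex.I * (a : ℂ))‖ < δ' := fun a => by
      rw [norm_mul, norm_exp_I_mul, Complex.norm_real, Real.norm_of_nonneg hδ.le]
      simpa using hδδ'
    exact ⟨fun i => by simpa [torusPoint] using hS0, fun l => hn _, fun l => hn _⟩
  have hs : Summable fun K => ‖c K‖ * δ ^ K.deg := by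
    refine (hc2 _ (htor 0)).summable.norm.congr fun K => ?_
    rw [norm_mul, norm_mono_torusPoint hδ.le]
  have hcoef : ∀ K : Index n m, coeff δ g K.1 K.2.1 K.2.2 r I x = c K := by
    classical
    intro K
    have h1 := hasSum_coeff hδ hs (L := fun K => K) (fun t => hc2 _ (htor t)) K
    have h2 : HasSum (fun b => if b = K then c b else 0) (c K) := by
      have := hasSum_ite_eq K (c K)
      refine this.congr_fun fun b => ?_
      split_ifs with hb
      · rw [hb]
      · rfl
    exact h1.unique h2
  simp only [hcoef]
  exact ⟨hc1, hc2⟩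

end FastExpansion

/-! ### Domains, expansions and atomic decompositions -/

section Geometry

theorem nbhd_eq_thickening (A : Set ℝ) (θ : ℝ) :
    nbhd A θ = thickening θ (Complex.ofReal '' A) := by
  ext z
  simp [nbhd, mem_thickening_iff, dist_eq_norm]

theorem isOpen_nbhd (A : Set ℝ) (θ : ℝ) : IsOpen (nbhd A θ) := by
  rw [nbhd_eq_thickening]; exact isOpen_thickening

theorem nbhd_mono (A : Set ℝ) {θ θ' : ℝ} (h : θ ≤ θ') : nbhd A θ ⊆ nbhd A θ' :=
  fun _ ⟨a, ha, hz⟩ => ⟨a, ha, hz.trans_le h⟩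

theorem nbhdVec_mono {n : ℕ} (A : Set (Fin n → ℝ)) {θ θ' : ℝ} (h : θ ≤ θ') :
    nbhdVec A θ ⊆ nbhdVec A θ' :=
  fun _ ⟨a, ha, hz⟩ => ⟨a, ha, hz.trans_le h⟩

theorem nbhdVec_eq_preimage {n : ℕ} (A : Set (Fin n → ℝ)) (θ : ℝ) :
    nbhdVec A θ = (WithLp.toLp 2 : (Fin n → ℂ) → EuclideanSpace ℂ (Fin n)) ⁻¹'
      thickening θ ((fun a : Fin n → ℝ => WithLp.toLp 2 fun i => (a i : ℂ)) '' A) := by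
  ext z
  simp [nbhdVec, mem_thickening_iff, dist_eq_norm, EuclideanSpace.norm_eq]

theorem isOpen_nbhdVec {n : ℕ} (A : Set (Fin n → ℝ)) (θ : ℝ) : IsOpen (nbhdVec A θ) := by
  rw [nbhdVec_eq_preimage]
  exact isOpen_thickening.preimage (PiLp.continuous_toLp 2 _)

theorem exists_compact_nbhd {A : Set ℝ} (hA : Bornology.IsBounded A) {θ θ' : ℝ} (hθ : 0 < θ')
    (h : θ < θ') : ∃ K, IsCompact K ∧ nbhd A θ ⊆ K ∧ K ⊆ nbhd A θ' := by
  rw [nbhd_eq_thickening, nbhd_eq_thickening]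
  refine ⟨cthickening θ (Complex.ofReal '' A), ?_, thickening_subset_cthickening _ _,
    cthickening_subset_thickening' hθ h _⟩
  refine isCompact_of_isClosed_isBounded isClosed_cthickening (Bornology.IsBounded.cthickening ?_)
  exact Complex.isometry_ofReal.lipschitz.isBounded_image hA

theorem exists_compact_nbhdVec {n : ℕ} {A : Set (Fin n → ℝ)} (hA : Bornology.IsBounded A)
    {θ θ' : ℝ} (hθ : 0 < θ') (h : θ < θ') :
    ∃ K, IsCompact K ∧ nbhdVec A θ ⊆ K ∧ K ⊆ nbhdVec A θ' := by
  rw [nbhdVec_eq_preimage, nbhdVec_eq_preimage]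
  set A' :=
    (fun a : Fin n → ℝ => (WithLp.toLp 2 fun i => (a i : ℂ) : EuclideanSpace ℂ (Fin n))) '' A
  have hcomp : IsCompact (cthickening θ A') := by
    refine isCompact_of_isClosed_isBounded isClosed_cthickening
      (Bornology.IsBounded.cthickening ?_)
    have hK : IsCompact ((fun a : Fin n → ℝ =>
        (WithLp.toLp 2 fun i => (a i : ℂ) : EuclideanSpace ℂ (Fin n))) '' closure A) := by
      refine hA.isCompact_closure.image ?_
      exact (PiLp.continuous_toLp 2 _).comp (by fun_prop)
    exact hK.isBounded.subset (Set.image_mono subset_closure)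
  refine ⟨WithLp.ofLp '' cthickening θ A', hcomp.image (PiLp.continuous_ofLp 2 _), ?_, ?_⟩
  · intro z hz
    exact ⟨WithLp.toLp 2 z, thickening_subset_cthickening _ _ hz, rfl⟩
  · rintro _ ⟨z, hz, rfl⟩
    exact cthickening_subset_thickening' hθ h _ hz

/-- The domain of the slow variables `(r, I, x)`. -/
def slowDomain {n : ℕ} (B : BaseSets n) (v : Width) : Set (ℂ × (Fin n → ℂ) × ℂ) :=
  nbhd B.setR v.r ×ˢ nbhdVec B.setI v.ρ ×ˢ nbhd B.setX v.ξ

theorem isOpen_slowDomain {n : ℕ} (B : BaseSets n) (v : Width) : IsOpen (slowDomain B v) :=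
  (isOpen_nbhd _ _).prod ((isOpen_nbhdVec _ _).prod (isOpen_nbhd _ _))

theorem mem_nbhd_of_mem {A : Set ℝ} {θ a : ℝ} (hθ : 0 < θ) (ha : a ∈ A) : (a : ℂ) ∈ nbhd A θ :=
  ⟨a, ha, by simpa using hθ⟩

theorem mem_nbhdVec_of_mem {n : ℕ} {A : Set (Fin n → ℝ)} {θ : ℝ} {a : Fin n → ℝ} (hθ : 0 < θ)
    (ha : a ∈ A) : (fun i => (a i : ℂ)) ∈ nbhdVec A θ :=
  ⟨a, ha, by simpa using hθ⟩

theorem slowDomain_nonempty {n : ℕ} (B : BaseSets n) {v : Width} (hv : v.Pos) :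
    (slowDomain B v).Nonempty := by
  obtain ⟨r, hr⟩ := B.isConnected_R.nonempty
  obtain ⟨I, hI⟩ := B.isConnected_I.nonempty
  exact ⟨((r : ℂ), fun i => (I i : ℂ), ((0 : ℝ) : ℂ)), mem_nbhd_of_mem hv.1 hr,
    mem_nbhdVec_of_mem hv.2.1 hI, mem_nbhd_of_mem hv.2.2.1 B.zero_mem_X⟩

theorem exists_compact_slowDomain {n : ℕ} (B : BaseSets n) {v v' : Width} (hv : v'.Pos)
    (h : v.Lt v') : ∃ K, IsCompact K ∧ slowDomain B v ⊆ K ∧ K ⊆ slowDomain B v' := by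
  obtain ⟨K₁, h₁, h₁', h₁''⟩ := exists_compact_nbhd B.isBounded_R hv.1 h.1
  obtain ⟨K₂, h₂, h₂', h₂''⟩ := exists_compact_nbhdVec B.isBounded_I hv.2.1 h.2.1
  obtain ⟨K₃, h₃, h₃', h₃''⟩ := exists_compact_nbhd B.isBounded_X hv.2.2.1 h.2.2.1
  exact ⟨K₁ ×ˢ K₂ ×ˢ K₃, h₁.prod (h₂.prod h₃), Set.prod_mono h₁' (Set.prod_mono h₂' h₃'),
    Set.prod_mono h₁'' (Set.prod_mono h₂'' h₃'')⟩

theorem Width.Lt.le {v w : Width} (h : v.Lt w) : v.Le w :=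
  ⟨h.1.le, h.2.1.le, h.2.2.1.le, h.2.2.2.1.le, h.2.2.2.2.le⟩

theorem Width.Le.trans_lt {u v w : Width} (h : u.Le v) (h' : v.Lt w) : u.Lt w :=
  ⟨h.1.trans_lt h'.1, h.2.1.trans_lt h'.2.1, h.2.2.1.trans_lt h'.2.2.1,
    h.2.2.2.1.trans_lt h'.2.2.2.1, h.2.2.2.2.trans_lt h'.2.2.2.2⟩

theorem Width.Lt.pos {v w : Width} (h : v.Lt w) (hv : v.Pos) : w.Pos :=
  ⟨hv.1.trans h.1, hv.2.1.trans h.2.1, hv.2.2.1.trans h.2.2.1, hv.2.2.2.1.trans h.2.2.2.1,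
    hv.2.2.2.2.trans h.2.2.2.2⟩

theorem Width.exists_between {v w : Width} (h : v.Lt w) : ∃ v', v.Lt v' ∧ v'.Lt w := by
  obtain ⟨h1, h2, h3, h4, h5⟩ := h
  refine ⟨⟨(v.r + w.r) / 2, (v.ρ + w.ρ) / 2, (v.ξ + w.ξ) / 2, (v.s + w.s) / 2, (v.δ + w.δ) / 2⟩,
    ?_, ?_⟩ <;> refine ⟨?_, ?_, ?_, ?_, ?_⟩ <;> simp only <;> linarith

theorem slowDomain_mono {n : ℕ} (B : BaseSets n) {v w : Width} (h : v.Le w) :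
    slowDomain B v ⊆ slowDomain B w :=
  Set.prod_mono (nbhd_mono _ h.1) (Set.prod_mono (nbhdVec_mono _ h.2.1) (nbhd_mono _ h.2.2.1))

theorem IsHol.mono {n m : ℕ} {B : BaseSets n} {v w : Width} (h : v.Le w) {g : Phase n m → ℂ}
    (hg : IsHol B w g) : IsHol B v g := by
  obtain ⟨w', hw, h1, h2⟩ := hg
  exact ⟨w', h.trans_lt hw, h1, h2⟩

variable {n m : ℕ}

/-- The open domain of `(r, I, x, p, q)`, with no restriction on the angles. -/
def slab (m : ℕ) (B : BaseSets n) (v : Width) : Set (Phase n m) :=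
  {z | (z.1, z.2.1, z.2.2.1) ∈ slowDomain B v ∧
    (∀ l, ‖z.2.2.2.2.1 l‖ < v.δ) ∧ ∀ l, ‖z.2.2.2.2.2 l‖ < v.δ}

/-- The part `|Im φ_i| < s` of the slab. -/
def strip (m : ℕ) (B : BaseSets n) (v : Width) : Set (Phase n m) :=
  {z | z ∈ slab m B v ∧ ∀ i, |(z.2.2.2.1 i).im| < v.s}

theorem isOpen_slab (B : BaseSets n) (v : Width) : IsOpen (slab m B v) := by
  simp only [slab, Set.ofPred_and, Set.ofPred_forall]
  refine ((isOpen_slowDomain B v).preimage (by fun_prop)).inter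
    ((isOpen_iInter_of_finite fun i => ?_).inter (isOpen_iInter_of_finite fun i => ?_))
  · exact isOpen_lt (by fun_prop) continuous_const
  · exact isOpen_lt (by fun_prop) continuous_const

theorem isOpen_strip (B : BaseSets n) (v : Width) : IsOpen (strip m B v) := by
  simp only [strip, Set.ofPred_and, Set.ofPred_forall]
  refine (isOpen_slab B v).inter (isOpen_iInter_of_finite fun i => ?_)
  exact isOpen_lt (by fun_prop) continuous_const

theorem slab_mono (B : BaseSets n) {v w : Width} (h : v.Le w) : slab m B v ⊆ slab m B w :=
  fun _ hz => ⟨slowDomain_mono B h hz.1, fun l => (hz.2.1 l).trans_le h.2.2.2.2,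
    fun l => (hz.2.2 l).trans_le h.2.2.2.2⟩

theorem strip_mono (B : BaseSets n) {v w : Width} (h : v.Le w) : strip m B v ⊆ strip m B w :=
  fun _ hz => ⟨slab_mono B h hz.1, fun i => (hz.2 i).trans_le h.2.2.2.1⟩

theorem strip_subset_domain (B : BaseSets n) (v : Width) : strip m B v ⊆ domain m B v :=
  fun _ hz => ⟨hz.1.1.1, hz.1.1.2.1, hz.1.1.2.2, fun i => (hz.2 i).le, fun l => (hz.1.2.1 l).le,
    fun l => (hz.1.2.2 l).le⟩

theorem domain_subset_strip (B : BaseSets n) {v w : Width} (h : v.Lt w) :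
    domain m B v ⊆ strip m B w :=
  fun _ hz => ⟨⟨slowDomain_mono B h.le ⟨hz.1, hz.2.1, hz.2.2.1⟩,
    fun l => (hz.2.2.2.2.1 l).trans_lt h.2.2.2.2, fun l => (hz.2.2.2.2.2 l).trans_lt h.2.2.2.2⟩,
    fun i => (hz.2.2.2.1 i).trans_lt h.2.2.2.1⟩

end Geometry

/-! ### Uniform coefficient estimates for functions of class `𝒪_w` -/

section Expansion

variable {n m : ℕ} {B : BaseSets n}

theorem summable_index {ε θ : ℝ} (hε : 0 < ε) (hθ : 0 ≤ θ) (hθ1 : θ < 1) :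
    Summable fun K : Index n m => Real.exp (-(ε * ∑ i, |(K.1 i : ℝ)|)) * θ ^ K.deg := by
  have h1 := summable_pi_prod (summable_exp_neg_abs_int hε) (fun k => (Real.exp_pos _).le) (Fin n)
  have h2 := summable_pi_prod (summable_geometric_of_lt_one hθ hθ1) (fun k => pow_nonneg hθ k)
    (Fin m)
  have hp : ∀ h : Fin m → ℕ, 0 ≤ ∏ l, θ ^ h l := fun h =>
    Finset.prod_nonneg fun l _ => pow_nonneg hθ _
  have h3 := h1.mul_of_nonneg (h2.mul_of_nonneg h2 hp hp)
    (fun k => Finset.prod_nonneg fun i _ => (Real.exp_pos _).le)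
    (fun p => mul_nonneg (hp _) (hp _))
  refine h3.congr fun K => ?_
  simp only [Index.deg, pow_add, Finset.prod_pow_eq_pow_sum, ← Real.exp_sum, Finset.mul_sum,
    Finset.sum_neg_distrib]

/-- A function of class `𝒪_w` is bounded on compactly smaller domains, and its Taylor–Fourier
coefficients satisfy uniform exponential estimates. -/
theorem IsHol.expansion {w : Width} (hw : w.Pos) {g : Phase n m → ℂ} (hg : IsHol B w g) :
    ∃ C s' δ' : ℝ, 0 ≤ C ∧ w.s < s' ∧ w.δ < δ' ∧ ∀ y ∈ slowDomain B w,
      (∀ K : Index n m, ‖coeff w.δ g K.1 K.2.1 K.2.2 y.1 y.2.1 y.2.2‖ * δ' ^ K.deg *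
        Real.exp (s' * ∑ i, |(K.1 i : ℝ)|) ≤ C) ∧
      ∀ a : Fast n m, (∀ i, |(a.1 i).im| ≤ w.s) → (∀ l, ‖a.2.1 l‖ ≤ w.δ) →
        (∀ l, ‖a.2.2 l‖ ≤ w.δ) →
        HasSum (fun K : Index n m => coeff w.δ g K.1 K.2.1 K.2.2 y.1 y.2.1 y.2.2 * monom K a)
          (g (y.1, y.2.1, y.2.2, a)) := by
  obtain ⟨v, hwv, hd, hper⟩ := hg
  -- The boundedness and the expansion are obtained at `v'`; the coefficient estimates are stated at
  -- the smaller `v''`, which is still strictly larger than `w`, and this leaves room for geometric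
  -- convergence at `w`.
  obtain ⟨v', hwv', hv'v⟩ := Width.exists_between hwv
  obtain ⟨v'', hwv'', hv''v'⟩ := Width.exists_between hwv'
  have hv : v.Pos := hwv.pos hw
  have hv' : v'.Pos := hwv'.pos hw
  have hv'' : v''.Pos := hwv''.pos hw
  obtain ⟨K₀, hK₀, hK₀', hK₀''⟩ := exists_compact_slowDomain B hv hwv
  have hcompF : IsCompact ((Set.univ.pi fun _ => Set.Icc 0 (2 * Real.pi) ×ℂ Set.Icc (-v'.s) v'.s) ×ˢ
      ((Set.univ.pi fun _ => closedBall 0 v'.δ) ×ˢ (Set.univ.pi fun _ => closedBall 0 v'.δ)) :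
      Set (Fast n m)) := by
    refine (isCompact_univ_pi fun _ => ?_).prod
      ((isCompact_univ_pi fun _ => isCompact_closedBall _ _).prod
        (isCompact_univ_pi fun _ => isCompact_closedBall _ _))
    exact isCompact_Icc.reProdIm isCompact_Icc
  have hmapc : Continuous fun p : (ℂ × (Fin n → ℂ) × ℂ) × Fast n m =>
    ((p.1.1, p.1.2.1, p.1.2.2, p.2) : Phase n m) := by fun_prop
  have hcomp := (hK₀.prod hcompF).image hmapc
  have hin : ∀ y ∈ slowDomain B w, ∀ a : Fast n m, (∀ i, |(a.1 i).im| ≤ v'.s) →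
      (∀ l, ‖a.2.1 l‖ ≤ v'.δ) → (∀ l, ‖a.2.2 l‖ ≤ v'.δ) →
      ((y.1, y.2.1, y.2.2, a) : Phase n m) ∈ domain m B v := by
    intro y hy a h1 h2 h3
    have hy' := slowDomain_mono B hwv.le hy
    exact ⟨hy'.1, hy'.2.1, hy'.2.2, fun i => (h1 i).trans hv'v.2.2.2.1.le,
      fun i => (h2 i).trans hv'v.2.2.2.2.le, fun i => (h3 i).trans hv'v.2.2.2.2.le⟩
  have hsub : (fun p : (ℂ × (Fin n → ℂ) × ℂ) × Fast n m =>
      ((p.1.1, p.1.2.1, p.1.2.2, p.2) : Phase n m)) '' (K₀ ×ˢ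
      ((Set.univ.pi fun _ => Set.Icc 0 (2 * Real.pi) ×ℂ Set.Icc (-v'.s) v'.s) ×ˢ
      ((Set.univ.pi fun _ => closedBall 0 v'.δ) ×ˢ (Set.univ.pi fun _ => closedBall 0 v'.δ)))) ⊆
      domain m B v := by
    rintro _ ⟨⟨y, a⟩, ⟨hy, ha1, ha2, ha3⟩, rfl⟩
    have hy' := hK₀'' hy
    refine ⟨hy'.1, hy'.2.1, hy'.2.2, fun i => ?_, fun i => ?_, fun i => ?_⟩
    · exact (abs_le.2 (ha1 i trivial).2).trans hv'v.2.2.2.1.le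
    · have := ha2 i trivial
      rw [mem_closedBall_zero_iff] at this
      exact this.trans hv'v.2.2.2.2.le
    · have := ha3 i trivial
      rw [mem_closedBall_zero_iff] at this
      exact this.trans hv'v.2.2.2.2.le
  obtain ⟨C, hC⟩ := hcomp.exists_bound_of_continuousOn (hd.continuousOn.mono hsub)
  refine ⟨|C|, v''.s, v''.δ, abs_nonneg _, hwv''.2.2.2.1, hwv''.2.2.2.2, fun y hy => ?_⟩
  have hinF : ∀ a ∈ fastDomain n m (Set.Ioo (-v'.s) v'.s) v'.δ,
      ((y.1, y.2.1, y.2.2, a) : Phase n m) ∈ domain m B v := fun a ha =>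
    hin y hy a (fun i => (abs_lt.2 (ha.1 i)).le) (fun l => (ha.2.1 l).le) (fun l => (ha.2.2 l).le)
  have hexp := coeff_expansion (g := g) (r := y.1) (I := y.2.1) (x := y.2.2)
    (S := Set.Ioo (-v'.s) v'.s) isOpen_Ioo Set.ordConnected_Ioo
    ⟨by linarith [hv'.2.2.2.1], hv'.2.2.2.1⟩ hw.2.2.2.2 hwv'.2.2.2.2
    (hd.comp (by fun_prop) hinF) (fun a ha i => hper _ (hinF a ha) i) (M := fun _ => |C|) (by
      intro a ha hre
      refine (hC _ ⟨(y, a), ⟨hK₀' hy, ?_, ?_, ?_⟩, rfl⟩).trans (le_abs_self _)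
      · exact fun i _ => ⟨hre i, (ha.1 i).1.le, (ha.1 i).2.le⟩
      · exact fun l _ => mem_closedBall_zero_iff.2 (ha.2.1 l).le
      · exact fun l _ => mem_closedBall_zero_iff.2 (ha.2.2 l).le)
  refine ⟨fun K => ?_, fun a h1 h2 h3 => hexp.2 a ⟨fun i => ?_, fun l => ?_, fun l => ?_⟩⟩
  -- Heights opposite in sign to `k_i` turn `e^{k·y}` into `e^{-s''|k|}`.
  · have := hexp.1 K (fun i => if 0 ≤ K.1 i then -v''.s else v''.s) (by
      intro i
      have h1 := hv''v'.2.2.2.1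
      have h2 := hv''.2.2.2.1
      split_ifs <;> constructor <;> linarith) v''.δ hv''.2.2.2.2 hv''v'.2.2.2.2
    have e : ∑ i, (K.1 i : ℝ) * (if 0 ≤ K.1 i then -v''.s else v''.s) =
        -(v''.s * ∑ i, |(K.1 i : ℝ)|) := by
      rw [Finset.mul_sum, ← Finset.sum_neg_distrib]
      refine Finset.sum_congr rfl fun i _ => ?_
      split_ifs with h
      · rw [abs_of_nonneg (by exact_mod_cast h)]; ring
      · rw [abs_of_nonpos (by exact_mod_cast (not_le.1 h).le)]; ring
    simp only [e] at this
    calc _ ≤ |C| * Real.exp (-(v''.s * ∑ i, |(K.1 i : ℝ)|)) *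
          Real.exp (v''.s * ∑ i, |(K.1 i : ℝ)|) := by gcongr
      _ = |C| := by rw [mul_assoc, ← Real.exp_add]; simp
  · exact abs_lt.1 ((h1 i).trans_lt hwv'.2.2.2.1)
  · exact (h2 l).trans_lt hwv'.2.2.2.2
  · exact (h3 l).trans_lt hwv'.2.2.2.2

/-- `sup |g_{khj}|` over the slow variables. -/
def coeffSup (B : BaseSets n) (w : Width) (g : Phase n m → ℂ) (K : Index n m) : ℝ≥0∞ :=
  ⨆ r ∈ nbhd B.setR w.r, ⨆ I ∈ nbhdVec B.setI w.ρ, ⨆ x ∈ nbhd B.setX w.ξ,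
    ‖coeff w.δ g K.1 K.2.1 K.2.2 r I x‖ₑ

theorem norm_eq (B : BaseSets n) (w : Width) (g : Phase n m → ℂ) :
    norm B w g = ∑' K : Index n m, coeffSup B w g K *
      ENNReal.ofReal (Real.exp (w.s * ∑ i, |(K.1 i : ℝ)|) * w.δ ^ K.deg) := rfl

theorem coeffSup_le_iff {w : Width} {g : Phase n m → ℂ} {K : Index n m} {c : ℝ≥0∞} :
    coeffSup B w g K ≤ c ↔ ∀ y ∈ slowDomain B w,
      ‖coeff w.δ g K.1 K.2.1 K.2.2 y.1 y.2.1 y.2.2‖ₑ ≤ c := by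
  simp only [coeffSup, iSup_le_iff]
  exact ⟨fun h y hy => h _ hy.1 _ hy.2.1 _ hy.2.2, fun h r hr I hI x hx => h (r, I, x) ⟨hr, hI, hx⟩⟩

theorem IsHol.norm_lt_top {w : Width} (hw : w.Pos) {g : Phase n m → ℂ} (hg : IsHol B w g) :
    norm B w g < ⊤ := by
  obtain ⟨C, s', δ', hC, hs, hδ, hexp⟩ := hg.expansion hw
  have hδ0 : 0 < δ' := hw.2.2.2.2.trans hδ
  have hsum := (summable_index (n := n) (m := m) (ε := s' - w.s) (θ := w.δ / δ')
    (by linarith) (by have := hw.2.2.2.2; positivity) ((div_lt_one hδ0).2 hδ)).mul_left C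
  have hfin := hsum.tsum_ofReal_lt_top
  rw [norm_eq]
  refine lt_of_le_of_lt (ENNReal.tsum_le_tsum fun K => ?_) hfin
  have hle : coeffSup B w g K ≤ ENNReal.ofReal (C / (δ' ^ K.deg *
      Real.exp (s' * ∑ i, |(K.1 i : ℝ)|))) := by
    refine coeffSup_le_iff.2 fun y hy => ?_
    rw [← ofReal_norm]
    refine ENNReal.ofReal_le_ofReal ?_
    rw [le_div_iff₀ (by positivity), ← mul_assoc]
    exact (hexp y hy).1 K
  calc _ ≤ ENNReal.ofReal (C / (δ' ^ K.deg * Real.exp (s' * ∑ i, |(K.1 i : ℝ)|))) *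
        ENNReal.ofReal (Real.exp (w.s * ∑ i, |(K.1 i : ℝ)|) * w.δ ^ K.deg) := by gcongr
    _ = _ := by
      rw [← ENNReal.ofReal_mul (by positivity)]
      congr 1
      have e : -((s' - w.s) * ∑ i, |(K.1 i : ℝ)|) =
        w.s * (∑ i, |(K.1 i : ℝ)|) - s' * ∑ i, |(K.1 i : ℝ)| := by ring
      rw [e, Real.exp_sub, div_pow]
      field_simp

theorem IsHol.differentiableOn_coeff {w : Width} (hw : w.Pos) {g : Phase n m → ℂ}
    (hg : IsHol B w g) (K : Index n m) :
    DifferentiableOn ℂ (fun y : ℂ × (Fin n → ℂ) × ℂ =>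
      coeff w.δ g K.1 K.2.1 K.2.2 y.1 y.2.1 y.2.2) (slowDomain B w) := by
  obtain ⟨v, hwv, hd, hper⟩ := hg
  have hv : v.Pos := hwv.pos hw
  have hin : ∀ t, ∀ y ∈ slowDomain B w,
      ((y.1, y.2.1, y.2.2, torusPoint w.δ t) : Phase n m) ∈ domain m B v := by
    intro t y hy
    have hy' := slowDomain_mono B hwv.le hy
    have hn : ∀ a : ℝ, ‖(w.δ : ℂ) * Complex.exp (Complex.I * (a : ℂ))‖ ≤ v.δ := fun a => by
      rw [norm_mul, norm_exp_I_mul, Complex.norm_real, Real.norm_of_nonneg hw.2.2.2.2.le]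
      simpa using hwv.2.2.2.2.le
    exact ⟨hy'.1, hy'.2.1, hy'.2.2, fun i => by simpa [torusPoint] using hv.2.2.2.1.le,
      fun l => hn _, fun l => hn _⟩
  simp only [coeff_eq]
  refine DifferentiableOn.const_mul ?_ _
  refine differentiableOn_setIntegral isCompact_Icc measurableSet_Icc (isOpen_slowDomain B w) ?_ ?_
  · refine ContinuousOn.div_const (ContinuousOn.mul ?_ (by fun_prop)) _
    refine hd.continuousOn.comp ?_ fun p hp => hin p.1 p.2 hp.2
    have := continuous_torusPoint (n := n) (m := m) w.δ
    fun_prop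
  · intro t _
    simp only [div_eq_mul_inv]
    refine DifferentiableOn.mul_const (DifferentiableOn.mul_const ?_ _) _
    exact hd.comp (by fun_prop) fun y hy => hin t y hy

end Expansion

/-! ### Fourier modes and atomic decompositions -/

section Atoms

variable {n m : ℕ}

/-- Translation of the angles. -/
def shift (θ : Fin n → ℂ) (z : Phase n m) : Phase n m :=
  (z.1, z.2.1, z.2.2.1, z.2.2.2.1 + θ, z.2.2.2.2)

/-- A single Fourier mode `e^{i k·φ} G(r, I, x, p, q)` with `sup |G| e^{s|k|} ≤ a`. -/
structure IsAtom (B : BaseSets n) (v : Width) (k : Fin n → ℤ) (a : ℝ) (F : Phase n m → ℂ) :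
    Prop where
  diff : DifferentiableOn ℂ F (slab m B v)
  qper : ∀ z ∈ slab m B v, ∀ θ, F (shift θ z) = Complex.exp (Complex.I * ∑ i, k i * θ i) * F z
  nonneg : 0 ≤ a
  bound : ∀ z ∈ slab m B v, ‖F z‖ ≤
    a * Real.exp (-(v.s * ∑ i, |(k i : ℝ)|) - ∑ i, k i * (z.2.2.2.1 i).im)

/-- `g` is a sum of Fourier modes of total weight at most `M`. -/
def Bd (B : BaseSets n) (v : Width) (M : ℝ) (g : Phase n m → ℂ) : Prop :=
  ∃ (ι : Type) (_ : Countable ι) (k : ι → Fin n → ℤ) (a : ι → ℝ) (F : ι → Phase n m → ℂ),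
    (∀ i, IsAtom B v (k i) (a i) (F i)) ∧ Summable a ∧ ∑' i, a i ≤ M ∧
    ∀ z ∈ strip m B v, HasSum (fun i => F i z) (g z)

variable {B : BaseSets n} {v : Width}

/-- A Taylor–Fourier term is itself a Fourier mode, and its weight as a mode is its contribution to
the norm since `|p_l|, |q_l| < δ`. Hence decomposing into modes costs no constant. -/
theorem isAtom_mono_term {w : Width} (hw : w.Pos) {g : Phase n m → ℂ} (hg : IsHol B w g)
    (K : Index n m) {a : ℝ} (ha : 0 ≤ a)
    (hK : coeffSup B w g K * ENNReal.ofReal (Real.exp (w.s * ∑ i, |(K.1 i : ℝ)|) * w.δ ^ K.deg) ≤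
      ENNReal.ofReal a) :
    IsAtom B w K.1 a (fun z : Phase n m =>
      coeff w.δ g K.1 K.2.1 K.2.2 z.1 z.2.1 z.2.2.1 * monom K z.2.2.2) where
  diff := by
    refine DifferentiableOn.mul ?_ ?_
    · exact (hg.differentiableOn_coeff hw K).comp
        (f := fun z : Phase n m => (z.1, z.2.1, z.2.2.1)) (by fun_prop) fun z hz => hz.1
    · unfold monom; fun_prop
  qper := by
    intro z _ θ
    simp only [shift, monom, Pi.add_apply, mul_add, Finset.sum_add_distrib, Complex.exp_add]
    ring
  nonneg := ha
  bound := by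
    intro z hz
    have hδ := hw.2.2.2.2
    have h1 : ‖coeff w.δ g K.1 K.2.1 K.2.2 z.1 z.2.1 z.2.2.1‖ *
        (Real.exp (w.s * ∑ i, |(K.1 i : ℝ)|) * w.δ ^ K.deg) ≤ a := by
      rw [← ENNReal.ofReal_le_ofReal_iff ha, ENNReal.ofReal_mul (norm_nonneg _), ofReal_norm]
      refine le_trans ?_ hK
      gcongr
      exact coeffSup_le_iff.1 (le_refl (coeffSup B w g K)) (z.1, z.2.1, z.2.2.1) hz.1
    have h2 : ‖monom K z.2.2.2‖ ≤
        Real.exp (-∑ i, K.1 i * (z.2.2.2.1 i).im) * w.δ ^ K.deg := by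
      rw [norm_mono, Index.deg, pow_add, ← Finset.prod_pow_eq_pow_sum,
        ← Finset.prod_pow_eq_pow_sum]
      gcongr with l _ l _
      · exact (hz.2.1 l).le
      · exact (hz.2.2 l).le
    rw [norm_mul]
    calc _ ≤ ‖coeff w.δ g K.1 K.2.1 K.2.2 z.1 z.2.1 z.2.2.1‖ *
          (Real.exp (-∑ i, K.1 i * (z.2.2.2.1 i).im) * w.δ ^ K.deg) := by gcongr
      _ = ‖coeff w.δ g K.1 K.2.1 K.2.2 z.1 z.2.1 z.2.2.1‖ *
          (Real.exp (w.s * ∑ i, |(K.1 i : ℝ)|) * w.δ ^ K.deg) *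
          Real.exp (-(w.s * ∑ i, |(K.1 i : ℝ)|) - ∑ i, K.1 i * (z.2.2.2.1 i).im) := by
        rw [sub_eq_add_neg, Real.exp_add, Real.exp_neg (w.s * _)]
        field_simp
      _ ≤ _ := by gcongr

/-- A function of class `𝒪_w` is a sum of Fourier modes of total weight at most its norm. -/
theorem IsHol.bd {w : Width} (hw : w.Pos) {g : Phase n m → ℂ} (hg : IsHol B w g) :
    Bd B w (norm B w g).toReal g := by
  have hfin := (hg.norm_lt_top hw).ne
  rw [norm_eq] at hfin ⊢
  obtain ⟨C, s', δ', hC, hs, hδ, hexp⟩ := hg.expansion hw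
  refine ⟨Index n m, inferInstance, fun K => K.1, fun K => (coeffSup B w g K *
    ENNReal.ofReal (Real.exp (w.s * ∑ i, |(K.1 i : ℝ)|) * w.δ ^ K.deg)).toReal,
    fun K z => coeff w.δ g K.1 K.2.1 K.2.2 z.1 z.2.1 z.2.2.1 * monom K z.2.2.2,
    fun K => isAtom_mono_term hw hg K ENNReal.toReal_nonneg ?_, ENNReal.summable_toReal hfin,
    ?_, fun z hz => ?_⟩
  · rw [ENNReal.ofReal_toReal (ENNReal.ne_top_of_tsum_ne_top hfin K)]
  · rw [ENNReal.tsum_toReal_eq (ENNReal.ne_top_of_tsum_ne_top hfin)]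
  · exact (hexp _ hz.1.1).2 z.2.2.2 (fun i => (hz.2 i).le) (fun l => (hz.1.2.1 l).le)
      (fun l => (hz.1.2.2 l).le)

end Atoms

/-! ### The algebra of atomic bounds and the Poisson bracket -/

section AtomicNormTheory

variable {n m : ℕ} {B : BaseSets n} {v w : Width}

/-! ### Operations on a single Fourier mode -/

section AtomLemmas

variable {k : Fin n → ℤ} {a : ℝ} {F : Phase n m → ℂ}

theorem exp_mode_le_one {s : ℝ} (k : Fin n → ℤ) {y : Fin n → ℝ} (hy : ∀ i, |y i| ≤ s) :
    Real.exp (-(s * ∑ i, |(k i : ℝ)|) - ∑ i, k i * y i) ≤ 1 := by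
  rw [Real.exp_le_one_iff, Finset.mul_sum, ← Finset.sum_neg_distrib, ← Finset.sum_sub_distrib]
  refine Finset.sum_nonpos fun i _ => ?_
  have h1 : |(k i : ℝ) * y i| ≤ s * |(k i : ℝ)| := by
    rw [abs_mul, mul_comm]
    exact mul_le_mul_of_nonneg_right (hy i) (abs_nonneg _)
  have := neg_abs_le ((k i : ℝ) * y i)
  linarith

theorem IsAtom.norm_le (h : IsAtom B v k a F) {z : Phase n m} (hz : z ∈ slab m B v)
    (hy : ∀ i, |(z.2.2.2.1 i).im| ≤ v.s) : ‖F z‖ ≤ a :=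
  (h.bound z hz).trans (mul_le_of_le_one_right h.nonneg (exp_mode_le_one k hy))

theorem IsAtom.norm_le_strip (h : IsAtom B v k a F) {z : Phase n m} (hz : z ∈ strip m B v) :
    ‖F z‖ ≤ a :=
  h.norm_le hz.1 fun i => (hz.2 i).le

theorem IsAtom.mono_width (h : IsAtom B w k a F) (hvw : v.Le w) : IsAtom B v k a F where
  diff := h.diff.mono (slab_mono B hvw)
  qper := fun z hz => h.qper z (slab_mono B hvw hz)
  nonneg := h.nonneg
  bound := fun z hz => by
    refine (h.bound z (slab_mono B hvw hz)).trans ?_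
    have := h.nonneg
    have hs := hvw.2.2.2.1
    have h2 : 0 ≤ ∑ i, |(k i : ℝ)| := Finset.sum_nonneg fun i _ => abs_nonneg _
    gcongr

theorem IsAtom.const_mul (h : IsAtom B v k a F) (c : ℂ) :
    IsAtom B v k (‖c‖ * a) (fun z => c * F z) where
  diff := h.diff.const_mul c
  qper := fun z hz θ => by rw [h.qper z hz]; ring
  nonneg := mul_nonneg (norm_nonneg _) h.nonneg
  bound := fun z hz => by
    rw [norm_mul, mul_assoc]
    exact mul_le_mul_of_nonneg_left (h.bound z hz) (norm_nonneg _)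

theorem IsAtom.mul (h : IsAtom B v k a F) {k' : Fin n → ℤ} {a' : ℝ} {F' : Phase n m → ℂ}
    (h' : IsAtom B v k' a' F') (hs : 0 ≤ v.s) :
    IsAtom B v (k + k') (a * a') (fun z => F z * F' z) where
  diff := h.diff.mul h'.diff
  qper := fun z hz θ => by
    rw [h.qper z hz, h'.qper z hz]
    simp only [Pi.add_apply, Int.cast_add, add_mul, Finset.sum_add_distrib, mul_add,
      Complex.exp_add]
    ring
  nonneg := mul_nonneg h.nonneg h'.nonneg
  bound := fun z hz => by
    rw [norm_mul]
    have h1 := h.bound z hz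
    have h2 := h'.bound z hz
    -- The weight is submultiplicative because `|k + k'| ≤ |k| + |k'|`.
    have e : ∑ i, |((k + k') i : ℝ)| ≤ ∑ i, |(k i : ℝ)| + ∑ i, |(k' i : ℝ)| := by
      rw [← Finset.sum_add_distrib]
      refine Finset.sum_le_sum fun i _ => ?_
      rw [Pi.add_apply, Int.cast_add]
      exact abs_add_le _ _
    calc _ ≤ _ := mul_le_mul h1 h2 (norm_nonneg _) (mul_nonneg h.nonneg (Real.exp_pos _).le)
      _ = a * a' * Real.exp (-(v.s * (∑ i, |(k i : ℝ)| + ∑ i, |(k' i : ℝ)|)) -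
          ∑ i, (k + k') i * (z.2.2.2.1 i).im) := by
        rw [mul_mul_mul_comm, ← Real.exp_add]
        simp only [Pi.add_apply, Int.cast_add, add_mul, Finset.sum_add_distrib]
        ring_nf
      _ ≤ _ := by
        have := mul_nonneg h.nonneg h'.nonneg
        simp only [Pi.add_apply, Int.cast_add] at e ⊢
        gcongr

theorem shift_eq_add (θ : Fin n → ℂ) (z : Phase n m) :
    shift θ z = z + ((0, 0, 0, θ, 0, 0) : Phase n m) := by
  simp [shift, Prod.ext_iff]

theorem IsAtom.hasFDerivAt (h : IsAtom B v k a F) {z : Phase n m} (hz : z ∈ slab m B v) :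
    HasFDerivAt F (fderiv ℂ F z) z :=
  ((h.diff z hz).differentiableAt ((isOpen_slab B v).mem_nhds hz)).hasFDerivAt

theorem IsAtom.fderiv_shift (h : IsAtom B v k a F) {z : Phase n m} (hz : z ∈ slab m B v)
    (θ : Fin n → ℂ) : fderiv ℂ F (shift θ z) =
      Complex.exp (Complex.I * ∑ i, k i * θ i) • fderiv ℂ F z := by
  have h1 : fderiv ℂ (fun x => F (shift θ x)) z = fderiv ℂ F (shift θ z) := by
    simp only [shift_eq_add]
    rw [fderiv_comp_add_right]
  have h2 : (fun x => F (shift θ x)) =ᶠ[𝓝 z]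
      fun x => Complex.exp (Complex.I * ∑ i, k i * θ i) * F x := by
    filter_upwards [(isOpen_slab B v).mem_nhds hz] with x hx using h.qper x hx θ
  rw [← h1, h2.fderiv_eq, fderiv_const_mul (h.hasFDerivAt hz).differentiableAt]

/-- Cauchy estimate for the derivative of a mode in a direction not involving the angles. -/
theorem IsAtom.fderiv_apply (h : IsAtom B w k a F) (hvw : v.Le w) {e : Phase n m}
    (he : e.2.2.2.1 = 0) {ρ : ℝ} (hρ : 0 < ρ)
    (hmem : ∀ z ∈ slab m B v, ∀ ζ : ℂ, ‖ζ‖ ≤ ρ → z + ζ • e ∈ slab m B w) :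
    IsAtom B v k (a / ρ) (fun z => fderiv ℂ F z e) where
  diff := (differentiableOn_fderiv_apply (isOpen_slab B w) h.diff e).mono (slab_mono B hvw)
  qper := fun z hz θ => by
    rw [h.fderiv_shift (slab_mono B hvw hz) θ]; rfl
  nonneg := div_nonneg h.nonneg hρ.le
  bound := fun z hz => by
    have := h.nonneg
    have h2 : 0 ≤ ∑ i, |(k i : ℝ)| := Finset.sum_nonneg fun i _ => abs_nonneg _
    have hs := hvw.2.2.2.1
    have h1 := norm_fderiv_apply_le (isOpen_slab B w) h.diff (z := z) (e := e) hρ (hmem z hz)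
      (C := a * Real.exp (-(v.s * ∑ i, |(k i : ℝ)|) - ∑ i, k i * (z.2.2.2.1 i).im))
      (fun ζ hζ => by
        have h3 := h.bound _ (hmem z hz ζ hζ)
        have e1 : (z + ζ • e).2.2.2.1 = z.2.2.2.1 := by simp [he]
        rw [e1] at h3
        refine h3.trans ?_
        gcongr)
    refine h1.trans_eq ?_
    ring

theorem abs_le_sum_abs (k : Fin n → ℤ) (i : Fin n) : |(k i : ℝ)| ≤ ∑ i, |(k i : ℝ)| :=
  Finset.single_le_sum (f := fun i => |(k i : ℝ)|) (fun _ _ => abs_nonneg _) (Finset.mem_univ i)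

/-- Quasi-periodicity under complex translations makes `F` an explicit exponential along the angle
directions. -/
theorem IsAtom.fderiv_angle_eq (h : IsAtom B v k a F) {z : Phase n m} (hz : z ∈ slab m B v)
    (θ : Fin n → ℂ) : fderiv ℂ F z ((0, 0, 0, θ, 0, 0) : Phase n m) =
      Complex.I * (∑ i, k i * θ i) * F z := by
  have hz' : z + (0 : ℂ) • ((0, 0, 0, θ, 0, 0) : Phase n m) ∈ slab m B v := by simpa using hz
  have h1 := hasDerivAt_line (isOpen_slab B v) h.diff hz'
  have h2 : (fun ζ : ℂ => F (z + ζ • ((0, 0, 0, θ, 0, 0) : Phase n m))) =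
      fun ζ => Complex.exp (ζ * (Complex.I * ∑ i, k i * θ i)) * F z := by
    funext ζ
    have h3 := h.qper z hz (ζ • θ)
    rw [shift_eq_add] at h3
    have e : ((0, 0, 0, ζ • θ, 0, 0) : Phase n m) = ζ • ((0, 0, 0, θ, 0, 0) : Phase n m) := by
      simp
    rw [e] at h3
    rw [h3]
    congr 2
    simp only [Pi.smul_apply, smul_eq_mul, Finset.mul_sum]
    exact Finset.sum_congr rfl fun i _ => by ring
  rw [h2] at h1
  have h4 : HasDerivAt (fun ζ : ℂ => Complex.exp (ζ * (Complex.I * ∑ i, k i * θ i)) * F z)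
      (Complex.exp (0 * (Complex.I * ∑ i, k i * θ i)) * (1 * (Complex.I * ∑ i, k i * θ i)) * F z)
      0 :=
    (((hasDerivAt_id (0 : ℂ)).mul_const _).cexp).mul_const _
  have := h1.unique h4
  simpa using this

/-- The derivative of a mode with respect to an angle. -/
theorem IsAtom.fderiv_angle (h : IsAtom B w k a F) (hvw : v.Le w) (hs : v.s < w.s) (i : Fin n) :
    IsAtom B v k (a / (w.s - v.s))
      (fun z => fderiv ℂ F z ((0, 0, 0, Pi.single i 1, 0, 0) : Phase n m)) := by
  have heq : ∀ z ∈ slab m B w, fderiv ℂ F z ((0, 0, 0, Pi.single i 1, 0, 0) : Phase n m) =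
      Complex.I * k i * F z := by
    intro z hz
    rw [h.fderiv_angle_eq hz]
    simp [Pi.single_apply]
  have hpos : 0 < w.s - v.s := sub_pos.2 hs
  refine ⟨(differentiableOn_fderiv_apply (isOpen_slab B w) h.diff _).mono (slab_mono B hvw),
    fun z hz θ => ?_, div_nonneg h.nonneg hpos.le, fun z hz => ?_⟩
  · rw [h.fderiv_shift (slab_mono B hvw hz) θ]; rfl
  · have hz' := slab_mono B hvw hz
    rw [heq z hz', norm_mul, norm_mul, Complex.norm_I, one_mul, Complex.norm_intCast]
    set κ := ∑ i, |(k i : ℝ)| with hκ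
    have hk : |(k i : ℝ)| ≤ κ := abs_le_sum_abs k i
    have h0 : 0 ≤ κ := (abs_nonneg _).trans hk
    -- This is `t ≤ e^t`: the factor `|k|` from the derivative is absorbed by narrowing the strip,
    -- at the price `1/(w.s - v.s)`.
    have h1 : κ * (w.s - v.s) ≤ Real.exp (κ * (w.s - v.s)) := by
      have := Real.add_one_le_exp (κ * (w.s - v.s)); linarith
    have ha := h.nonneg
    have e2 : Real.exp (-(w.s * κ) - ∑ i, k i * (z.2.2.2.1 i).im) * Real.exp (κ * (w.s - v.s)) =
        Real.exp (-(v.s * κ) - ∑ i, k i * (z.2.2.2.1 i).im) := by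
      rw [← Real.exp_add]; ring_nf
    calc |(k i : ℝ)| * ‖F z‖ ≤ κ * (a * Real.exp (-(w.s * κ) - ∑ i, k i * (z.2.2.2.1 i).im)) := by
          gcongr
          exact h.bound z hz'
      _ = a / (w.s - v.s) * (Real.exp (-(w.s * κ) - ∑ i, k i * (z.2.2.2.1 i).im) *
          (κ * (w.s - v.s))) := by field_simp
      _ ≤ a / (w.s - v.s) * (Real.exp (-(w.s * κ) - ∑ i, k i * (z.2.2.2.1 i).im) *
          Real.exp (κ * (w.s - v.s))) := by gcongr
      _ = _ := by rw [e2]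

end AtomLemmas

/-! ### Calculus of atomic bounds -/

section Algebra

variable {M M' : ℝ} {f g : Phase n m → ℂ}

theorem Bd.congr (h : Bd B v M f) (hfg : ∀ z ∈ strip m B v, g z = f z) : Bd B v M g := by
  obtain ⟨ι, hι, k, a, F, h1, h2, h3, h4⟩ := h
  exact ⟨ι, hι, k, a, F, h1, h2, h3, fun z hz => by rw [hfg z hz]; exact h4 z hz⟩

theorem Bd.mono (h : Bd B v M f) (hM : M ≤ M') : Bd B v M' f := by
  obtain ⟨ι, hι, k, a, F, h1, h2, h3, h4⟩ := h
  exact ⟨ι, hι, k, a, F, h1, h2, h3.trans hM, h4⟩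

theorem Bd.mono_width (h : Bd B w M f) (hvw : v.Le w) : Bd B v M f := by
  obtain ⟨ι, hι, k, a, F, h1, h2, h3, h4⟩ := h
  exact ⟨ι, hι, k, a, F, fun i => (h1 i).mono_width hvw, h2, h3,
    fun z hz => h4 z (strip_mono B hvw hz)⟩

theorem Bd.nonneg (h : Bd B v M f) : 0 ≤ M := by
  obtain ⟨ι, hι, k, a, F, h1, h2, h3, h4⟩ := h
  exact (tsum_nonneg fun i => (h1 i).nonneg).trans h3

theorem Bd.const_mul (h : Bd B v M f) (c : ℂ) : Bd B v (‖c‖ * M) (fun z => c * f z) := by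
  obtain ⟨ι, hι, k, a, F, h1, h2, h3, h4⟩ := h
  refine ⟨ι, hι, k, _, _, fun i => (h1 i).const_mul c, h2.mul_left _, ?_,
    fun z hz => (h4 z hz).mul_left c⟩
  rw [tsum_mul_left]
  gcongr

theorem Bd.neg (h : Bd B v M f) : Bd B v M (fun z => -f z) := by
  have := h.const_mul (-1)
  simpa using this

/-- Countable sums. -/
theorem Bd.tsum {κ : Type} [Countable κ] {M : κ → ℝ} {f : κ → Phase n m → ℂ}
    (h : ∀ j, Bd B v (M j) (f j)) (hM : Summable M) :
    (∀ z ∈ strip m B v, Summable fun j => f j z) ∧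
      Bd B v (∑' j, M j) (fun z => ∑' j, f j z) := by
  choose ι hι k a F h1 h2 h3 h4 using h
  have hS : Summable fun p : Σ j, ι j => a p.1 p.2 := by
    refine (summable_sigma_of_nonneg fun p => (h1 p.1 p.2).nonneg).2 ⟨h2, ?_⟩
    exact Summable.of_nonneg_of_le (fun j => tsum_nonneg fun i => (h1 j i).nonneg) h3 hM
  have hz : ∀ z ∈ strip m B v, Summable fun p : Σ j, ι j => F p.1 p.2 z := fun z hz =>
    Summable.of_norm_bounded hS fun p => (h1 p.1 p.2).norm_le_strip hz
  have hz' : ∀ z, (hz : z ∈ strip m B v) → HasSum (fun j => f j z) (∑' p : Σ j, ι j, F p.1 p.2 z) :=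
    fun z hzm => (hz z hzm).hasSum.sigma fun j => h4 j z hzm
  refine ⟨fun z hzm => (hz' z hzm).summable, Σ j, ι j, inferInstance, fun p => k p.1 p.2,
    fun p => a p.1 p.2, fun p => F p.1 p.2, fun p => h1 p.1 p.2, hS, ?_, fun z hzm => ?_⟩
  · rw [hS.tsum_sigma]
    exact hS.sigma.tsum_le_tsum h3 hM
  · show HasSum _ (∑' j, f j z)
    rw [(hz' z hzm).tsum_eq]
    exact (hz z hzm).hasSum

theorem Bd.sum {κ : Type} [Fintype κ] {M : κ → ℝ} {f : κ → Phase n m → ℂ}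
    (h : ∀ j, Bd B v (M j) (f j)) : Bd B v (∑ j, M j) (fun z => ∑ j, f j z) := by
  have := (Bd.tsum h (hasSum_fintype M).summable).2
  simpa only [tsum_fintype] using this

theorem Bd.add (hf : Bd B v M f) (hg : Bd B v M' g) :
    Bd B v (M + M') (fun z => f z + g z) := by
  have := Bd.sum (κ := Bool) (M := fun b => if b then M else M')
    (f := fun b => if b then f else g) (by rintro (_ | _) <;> simpa)
  simpa using this

theorem Bd.sub (hf : Bd B v M f) (hg : Bd B v M' g) :
    Bd B v (M + M') (fun z => f z - g z) := by
  simpa only [sub_eq_add_neg] using hf.add hg.neg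

theorem Bd.mul (hf : Bd B v M f) (hg : Bd B v M' g) (hs : 0 ≤ v.s) :
    Bd B v (M * M') (fun z => f z * g z) := by
  have hM := hf.nonneg
  obtain ⟨ι, hι, k, a, F, h1, h2, h3, h4⟩ := hf
  obtain ⟨ι', hι', k', a', F', h1', h2', h3', h4'⟩ := hg
  refine ⟨ι × ι', inferInstance, fun p => k p.1 + k' p.2, fun p => a p.1 * a' p.2,
    fun p z => F p.1 z * F' p.2 z, fun p => (h1 p.1).mul (h1' p.2) hs,
    h2.mul_of_nonneg h2' (fun i => (h1 i).nonneg) (fun i => (h1' i).nonneg), ?_, fun z hz => ?_⟩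
  · rw [← h2.tsum_mul_tsum h2'
      (h2.mul_of_nonneg h2' (fun i => (h1 i).nonneg) (fun i => (h1' i).nonneg))]
    exact mul_le_mul h3 h3' (tsum_nonneg fun i => (h1' i).nonneg) hM
  · have hs3 : Summable fun p : ι × ι' => F p.1 z * F' p.2 z := by
      refine Summable.of_norm_bounded (h2.mul_of_nonneg h2' (fun i => (h1 i).nonneg)
        (fun i => (h1' i).nonneg)) fun p => ?_
      rw [norm_mul]
      exact mul_le_mul ((h1 p.1).norm_le_strip hz) ((h1' p.2).norm_le_strip hz) (norm_nonneg _)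
        (h1 p.1).nonneg
    exact HasSum.mul (f := fun i => F i z) (g := fun i => F' i z) (h4 z hz) (h4' z hz) hs3

theorem Bd.hasFDerivAt (h : Bd B v M f) {z : Phase n m} (hz : z ∈ strip m B v) :
    HasFDerivAt f (fderiv ℂ f z) z := by
  obtain ⟨ι, hι, k, a, F, h1, h2, h3, h4⟩ := h
  obtain ⟨g', hg', -⟩ := hasFDerivAt_of_hasSum (isOpen_strip B v) h2
    (fun i => (h1 i).diff.mono fun z hz => hz.1) (fun i z hz => (h1 i).norm_le_strip hz) h4 hz
  exact hg'.differentiableAt.hasFDerivAt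

theorem Bd.differentiableOn (h : Bd B v M f) : DifferentiableOn ℂ f (strip m B v) :=
  fun _ hz => (h.hasFDerivAt hz).differentiableAt.differentiableWithinAt

/-- Termwise derivative of a sum of modes. -/
theorem Bd.fderiv_of_atoms (h : Bd B w M f) (hvw : v.Le w) {e : Phase n m} {c : ℝ}
    (hc : ∀ k a F, IsAtom B w k a F → IsAtom B v k (a / c) (fun z => fderiv ℂ F z e))
    (hc0 : 0 < c) :
    Bd B v (M / c) (fun z => fderiv ℂ f z e) := by
  obtain ⟨ι, hι, k, a, F, h1, h2, h3, h4⟩ := h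
  refine ⟨ι, hι, k, _, _, fun i => hc _ _ _ (h1 i), h2.div_const c, ?_, fun z hz => ?_⟩
  · rw [tsum_div_const]
    gcongr
  · obtain ⟨g', hg', hs⟩ := hasFDerivAt_of_hasSum (isOpen_strip B w) h2
      (fun i => (h1 i).diff.mono fun z hz => hz.1) (fun i z hz => (h1 i).norm_le_strip hz) h4
      (strip_mono B hvw hz)
    show HasSum _ (fderiv ℂ f z e)
    rw [hg'.fderiv]
    exact hs.mapL (ContinuousLinearMap.apply ℂ ℂ e)

theorem add_mem_nbhd {A : Set ℝ} {θ θ' : ℝ} {x ζ : ℂ} (hx : x ∈ nbhd A θ) (hζ : ‖ζ‖ ≤ θ' - θ) :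
    x + ζ ∈ nbhd A θ' := by
  obtain ⟨a, ha, hxa⟩ := hx
  refine ⟨a, ha, ?_⟩
  calc ‖x + ζ - a‖ = ‖(x - a) + ζ‖ := by ring_nf
    _ ≤ ‖x - a‖ + ‖ζ‖ := norm_add_le _ _
    _ < θ' := by linarith

/-- A displacement along one coordinate axis has Euclidean length `|ζ|`, so the full difference of
radii is available in each direction. -/
theorem add_mem_nbhdVec {A : Set (Fin n → ℝ)} {θ θ' : ℝ} {x : Fin n → ℂ} {ζ : ℂ} {i : Fin n}
    (hx : x ∈ nbhdVec A θ) (hζ : ‖ζ‖ ≤ θ' - θ) : x + ζ • Pi.single i 1 ∈ nbhdVec A θ' := by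
  rw [nbhdVec_eq_preimage, Set.mem_preimage, mem_thickening_iff] at hx ⊢
  obtain ⟨a, ha, hxa⟩ := hx
  refine ⟨a, ha, ?_⟩
  have e : WithLp.toLp 2 (x + ζ • Pi.single i 1) =
      WithLp.toLp 2 x + EuclideanSpace.single i ζ := by
    ext j
    by_cases h : j = i
    · subst h; simp
    · simp [h]
  rw [e, dist_eq_norm]
  rw [dist_eq_norm] at hxa
  calc ‖WithLp.toLp 2 x + EuclideanSpace.single i ζ - a‖ =
        ‖(WithLp.toLp 2 x - a) + EuclideanSpace.single i ζ‖ := by congr 1; abel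
    _ ≤ ‖WithLp.toLp 2 x - a‖ + ‖EuclideanSpace.single i ζ‖ := norm_add_le _ _
    _ < θ' := by
      rw [PiLp.norm_single]; linarith

theorem add_single_norm_lt {x : Fin m → ℂ} {ζ : ℂ} {l : Fin m} {θ θ' : ℝ} (hx : ∀ i, ‖x i‖ < θ)
    (hζ : ‖ζ‖ ≤ θ' - θ) (i : Fin m) : ‖(x + ζ • (Pi.single l 1 : Fin m → ℂ)) i‖ < θ' := by
  have h1 : ‖(ζ • (Pi.single l 1 : Fin m → ℂ)) i‖ ≤ ‖ζ‖ := by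
    by_cases h : i = l
    · subst h; simp
    · simp [h]
  calc _ ≤ ‖x i‖ + ‖(ζ • (Pi.single l 1 : Fin m → ℂ)) i‖ := norm_add_le _ _
    _ < θ' := by linarith [hx i]

theorem Bd.fderiv_R (h : Bd B w M f) (hvw : v.Le w) (hlt : v.r < w.r) :
    Bd B v (M / (w.r - v.r)) (fun z => fderiv ℂ f z ((1, 0, 0, 0, 0, 0) : Phase n m)) := by
  refine h.fderiv_of_atoms hvw (fun k a F hF => hF.fderiv_apply hvw rfl (sub_pos.2 hlt) ?_)
    (sub_pos.2 hlt)
  intro z hz ζ hζ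
  have hz' := slab_mono B hvw hz
  refine ⟨⟨?_, ?_, ?_⟩, fun l => ?_, fun l => ?_⟩
  · simpa using add_mem_nbhd hz.1.1 hζ
  · simpa using hz'.1.2.1
  · simpa using hz'.1.2.2
  · simpa using hz'.2.1 l
  · simpa using hz'.2.2 l

theorem Bd.fderiv_X (h : Bd B w M f) (hvw : v.Le w) (hlt : v.ξ < w.ξ) :
    Bd B v (M / (w.ξ - v.ξ)) (fun z => fderiv ℂ f z ((0, 0, 1, 0, 0, 0) : Phase n m)) := by
  refine h.fderiv_of_atoms hvw (fun k a F hF => hF.fderiv_apply hvw rfl (sub_pos.2 hlt) ?_)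
    (sub_pos.2 hlt)
  intro z hz ζ hζ
  have hz' := slab_mono B hvw hz
  refine ⟨⟨?_, ?_, ?_⟩, fun l => ?_, fun l => ?_⟩
  · simpa using hz'.1.1
  · simpa using hz'.1.2.1
  · simpa using add_mem_nbhd hz.1.2.2 hζ
  · simpa using hz'.2.1 l
  · simpa using hz'.2.2 l

theorem Bd.fderiv_I (h : Bd B w M f) (hvw : v.Le w) (hlt : v.ρ < w.ρ) (i : Fin n) :
    Bd B v (M / (w.ρ - v.ρ))
      (fun z => fderiv ℂ f z ((0, Pi.single i 1, 0, 0, 0, 0) : Phase n m)) := by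
  refine h.fderiv_of_atoms hvw (fun k a F hF => hF.fderiv_apply hvw rfl (sub_pos.2 hlt) ?_)
    (sub_pos.2 hlt)
  intro z hz ζ hζ
  have hz' := slab_mono B hvw hz
  refine ⟨⟨?_, ?_, ?_⟩, fun l => ?_, fun l => ?_⟩
  · simpa using hz'.1.1
  · exact add_mem_nbhdVec hz.1.2.1 hζ
  · simpa using hz'.1.2.2
  · simpa using hz'.2.1 l
  · simpa using hz'.2.2 l

theorem Bd.fderiv_A (h : Bd B w M f) (hvw : v.Le w) (hlt : v.s < w.s) (i : Fin n) :
    Bd B v (M / (w.s - v.s))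
      (fun z => fderiv ℂ f z ((0, 0, 0, Pi.single i 1, 0, 0) : Phase n m)) :=
  h.fderiv_of_atoms hvw (fun _ _ _ hF => hF.fderiv_angle hvw hlt i) (sub_pos.2 hlt)

theorem Bd.fderiv_P (h : Bd B w M f) (hvw : v.Le w) (hlt : v.δ < w.δ) (l : Fin m) :
    Bd B v (M / (w.δ - v.δ))
      (fun z => fderiv ℂ f z ((0, 0, 0, 0, Pi.single l 1, 0) : Phase n m)) := by
  refine h.fderiv_of_atoms hvw (fun k a F hF => hF.fderiv_apply hvw rfl (sub_pos.2 hlt) ?_)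
    (sub_pos.2 hlt)
  intro z hz ζ hζ
  have hz' := slab_mono B hvw hz
  refine ⟨⟨?_, ?_, ?_⟩, fun l => ?_, fun l => ?_⟩
  · simpa using hz'.1.1
  · simpa using hz'.1.2.1
  · simpa using hz'.1.2.2
  · exact add_single_norm_lt hz.2.1 hζ l
  · simpa using hz'.2.2 l

theorem Bd.fderiv_Q (h : Bd B w M f) (hvw : v.Le w) (hlt : v.δ < w.δ) (l : Fin m) :
    Bd B v (M / (w.δ - v.δ))
      (fun z => fderiv ℂ f z ((0, 0, 0, 0, 0, Pi.single l 1) : Phase n m)) := by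
  refine h.fderiv_of_atoms hvw (fun k a F hF => hF.fderiv_apply hvw rfl (sub_pos.2 hlt) ?_)
    (sub_pos.2 hlt)
  intro z hz ζ hζ
  have hz' := slab_mono B hvw hz
  refine ⟨⟨?_, ?_, ?_⟩, fun l => ?_, fun l => ?_⟩
  · simpa using hz'.1.1
  · simpa using hz'.1.2.1
  · simpa using hz'.1.2.2
  · simpa using hz'.2.1 l
  · exact add_single_norm_lt hz.2.2 hζ l

end Algebra

/-! ### Rescaled widths and the Poisson bracket -/

section PoissonBracket

/-- The widths `τ u`. -/
def Width.scale (τ : ℝ) (u : Width) : Width := ⟨τ * u.r, τ * u.ρ, τ * u.ξ, τ * u.s, τ * u.δ⟩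

variable {u : Width}

theorem Width.scale_pos (hu : u.Pos) {τ : ℝ} (hτ : 0 < τ) : (u.scale τ).Pos :=
  ⟨mul_pos hτ hu.1, mul_pos hτ hu.2.1, mul_pos hτ hu.2.2.1, mul_pos hτ hu.2.2.2.1,
    mul_pos hτ hu.2.2.2.2⟩

theorem Width.scale_lt (hu : u.Pos) {τ σ : ℝ} (h : τ < σ) : (u.scale τ).Lt (u.scale σ) :=
  ⟨mul_lt_mul_of_pos_right h hu.1, mul_lt_mul_of_pos_right h hu.2.1,
    mul_lt_mul_of_pos_right h hu.2.2.1, mul_lt_mul_of_pos_right h hu.2.2.2.1,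
    mul_lt_mul_of_pos_right h hu.2.2.2.2⟩

theorem Width.scale_le (hu : u.Pos) {τ σ : ℝ} (h : τ ≤ σ) : (u.scale τ).Le (u.scale σ) :=
  ⟨mul_le_mul_of_nonneg_right h hu.1.le, mul_le_mul_of_nonneg_right h hu.2.1.le,
    mul_le_mul_of_nonneg_right h hu.2.2.1.le, mul_le_mul_of_nonneg_right h hu.2.2.2.1.le,
    mul_le_mul_of_nonneg_right h hu.2.2.2.2.le⟩

theorem Width.scale_one (u : Width) : u.scale 1 = u := by
  simp [Width.scale]

theorem Width.third_eq (u : Width) : u.third = u.scale (1 / 3) := by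
  simp only [Width.third, Width.scale, Width.mk.injEq]
  refine ⟨?_, ?_, ?_, ?_, ?_⟩ <;> ring

theorem Width.frakd_pos (hu : u.Pos) : 0 < u.frakd :=
  lt_min (mul_pos hu.2.1 hu.2.2.2.1) (lt_min (mul_pos hu.1 hu.2.2.1) (pow_pos hu.2.2.2.2 2))

theorem poisson_def (F G : Phase n m → ℂ) (z : Phase n m) : poisson F G z =
    (fderiv ℂ F z (1, 0, 0, 0, 0, 0) * fderiv ℂ G z (0, 0, 1, 0, 0, 0) -
      fderiv ℂ G z (1, 0, 0, 0, 0, 0) * fderiv ℂ F z (0, 0, 1, 0, 0, 0)) +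
    ∑ i, (fderiv ℂ F z (0, Pi.single i 1, 0, 0, 0, 0) * fderiv ℂ G z (0, 0, 0, Pi.single i 1, 0, 0)
      - fderiv ℂ G z (0, Pi.single i 1, 0, 0, 0, 0) *
        fderiv ℂ F z (0, 0, 0, Pi.single i 1, 0, 0)) +
    ∑ l, (fderiv ℂ F z (0, 0, 0, 0, Pi.single l 1, 0) * fderiv ℂ G z (0, 0, 0, 0, 0, Pi.single l 1)
      - fderiv ℂ G z (0, 0, 0, 0, Pi.single l 1, 0) *
        fderiv ℂ F z (0, 0, 0, 0, 0, Pi.single l 1)) := rfl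

/-- Cauchy estimate for the Poisson bracket. -/
theorem Bd.poissonBracket (hu : u.Pos) {τ σ₁ σ₂ M₁ M₂ : ℝ} (hτ : 0 < τ) (h1 : τ < σ₁) (h2 : τ < σ₂)
    {f g : Phase n m → ℂ} (hf : Bd B (u.scale σ₁) M₁ f) (hg : Bd B (u.scale σ₂) M₂ g) :
    Bd B (u.scale τ) (2 * (1 + n + m) * (M₁ * M₂ / ((σ₁ - τ) * (σ₂ - τ) * u.frakd)))
      (poisson f g) := by
  have hM1 := hf.nonneg
  have hM2 := hg.nonneg
  have hd := Width.frakd_pos hu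
  have hd1 : u.frakd ≤ u.ρ * u.s := min_le_left _ _
  have hd2 : u.frakd ≤ u.r * u.ξ := (min_le_right _ _).trans (min_le_left _ _)
  have hd3 : u.frakd ≤ u.δ ^ 2 := (min_le_right _ _).trans (min_le_right _ _)
  have hs : 0 ≤ (u.scale τ).s := (Width.scale_pos hu hτ).2.2.2.1.le
  have l1 := Width.scale_lt hu h1
  have l2 := Width.scale_lt hu h2
  set D := M₁ * M₂ / ((σ₁ - τ) * (σ₂ - τ) * u.frakd) with hD
  have hp1 : 0 < σ₁ - τ := sub_pos.2 h1
  have hp2 : 0 < σ₂ - τ := sub_pos.2 h2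
  -- Each conjugate pair loses a product of two widths, `r ξ`, `ρ s` or `δ²`, and `𝔡` is below all
  -- three. The constant counts `1 + n + m` pairs with two terms each.
  have key : ∀ A C : ℝ, 0 < A → 0 < C → u.frakd ≤ A * C →
      M₁ / (σ₁ * A - τ * A) * (M₂ / (σ₂ * C - τ * C)) ≤ D := by
    intro A C hA hC hAC
    rw [← sub_mul, ← sub_mul, div_mul_div_comm, hD]
    refine div_le_div_of_nonneg_left (by positivity) (by positivity) ?_
    calc _ ≤ (σ₁ - τ) * (σ₂ - τ) * (A * C) := by gcongr
      _ = _ := by ring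
  have key' : ∀ A C : ℝ, 0 < A → 0 < C → u.frakd ≤ A * C →
      M₂ / (σ₂ * C - τ * C) * (M₁ / (σ₁ * A - τ * A)) ≤ D := by
    intro A C hA hC hAC
    rw [mul_comm]
    exact key A C hA hC hAC
  obtain ⟨ur, uρ, uξ, us, uδ⟩ := hu
  have b1 := (((hf.fderiv_R l1.le l1.1).mul (hg.fderiv_X l2.le l2.2.2.1) hs).mono
    (key _ _ ur uξ hd2)).sub
    (((hg.fderiv_R l2.le l2.1).mul (hf.fderiv_X l1.le l1.2.2.1) hs).mono (M' := D)
    (key' _ _ uξ ur (by rwa [mul_comm])))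
  have b2 := Bd.sum fun i : Fin n =>
    (((hf.fderiv_I l1.le l1.2.1 i).mul (hg.fderiv_A l2.le l2.2.2.2.1 i) hs).mono
    (key _ _ uρ us hd1)).sub
    (((hg.fderiv_I l2.le l2.2.1 i).mul (hf.fderiv_A l1.le l1.2.2.2.1 i) hs).mono (M' := D)
    (key' _ _ us uρ (by rwa [mul_comm])))
  have b3 := Bd.sum fun l : Fin m =>
    (((hf.fderiv_P l1.le l1.2.2.2.2 l).mul (hg.fderiv_Q l2.le l2.2.2.2.2 l) hs).mono
    (key _ _ uδ uδ (by rwa [← sq]))).sub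
    (((hg.fderiv_P l2.le l2.2.2.2.2 l).mul (hf.fderiv_Q l1.le l1.2.2.2.2 l) hs).mono (M' := D)
    (key' _ _ uδ uδ (by rwa [← sq])))
  refine (((b1.add b2).add b3).congr fun z _ => rfl).mono (le_of_eq ?_)
  simp only [Finset.sum_const, Finset.card_univ, Fintype.card_fin, nsmul_eq_mul]
  ring

end PoissonBracket

end AtomicNormTheory

/-! ### Lie series -/

section LieSeriesTheory

variable {n m : ℕ} {B : BaseSets n} {v w u : Width}

/-! ### From sums of modes to the class `𝒪_v` -/

section Holomorphic

theorem Bd.isHol {M : ℝ} {g : Phase n m → ℂ} (h : Bd B w M g) (hvw : v.Lt w) :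
    IsHol B v g := by
  obtain ⟨v', h1, h2⟩ := Width.exists_between hvw
  refine ⟨v', h1, h.differentiableOn.mono (domain_subset_strip B h2), fun z hz i => ?_⟩
  have hz1 := domain_subset_strip B h2 hz
  have hz2 : shift (Pi.single i (2 * (Real.pi : ℂ))) z ∈ strip m B w := by
    refine ⟨hz1.1, fun j => ?_⟩
    have e : (shift (Pi.single i (2 * (Real.pi : ℂ))) z).2.2.2.1 j =
      z.2.2.2.1 j + (Pi.single i (2 * (Real.pi : ℂ)) : Fin n → ℂ) j := rfl
    rw [e, Complex.add_im]
    by_cases hij : j = i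
    · subst hij; simpa using hz1.2 j
    · simpa [hij] using hz1.2 j
  obtain ⟨ι, hι, k, a, F, h1, -, -, h4⟩ := h
  refine (h4 _ hz2).unique ((h4 z hz1).congr_fun ?_)
  intro j
  rw [(h1 j).qper z hz1.1]
  have : ∑ x, (k j x : ℂ) * (Pi.single i (2 * (Real.pi : ℂ)) : Fin n → ℂ) x =
      k j i * (2 * Real.pi) := by
    simp [Pi.single_apply]
  rw [this]
  have := Complex.exp_int_mul_two_pi_mul_I (k j i)
  rw [show Complex.I * ((k j i : ℂ) * (2 * Real.pi)) =
      (k j i : ℂ) * (2 * Real.pi * Complex.I) by ring,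
    this, one_mul]

end Holomorphic

/-! ### Linearity and locality of iterated brackets -/

section Iterates

variable {U : Set (Phase n m)} {χ f g : Phase n m → ℂ}

theorem differentiableOn_poisson (hU : IsOpen U) (hf : DifferentiableOn ℂ f U)
    (hg : DifferentiableOn ℂ g U) : DifferentiableOn ℂ (poisson f g) U := by
  have e : poisson f g = fun z => poisson f g z := rfl
  rw [e]
  simp only [poisson_def]
  have h1 := differentiableOn_fderiv_apply hU hf
  have h2 := differentiableOn_fderiv_apply hU hg
  refine ((((h1 _).mul (h2 _)).sub ((h2 _).mul (h1 _))).add ?_).add ?_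
  · exact DifferentiableOn.fun_sum fun i _ => ((h1 _).mul (h2 _)).sub ((h2 _).mul (h1 _))
  · exact DifferentiableOn.fun_sum fun i _ => ((h1 _).mul (h2 _)).sub ((h2 _).mul (h1 _))

theorem differentiableOn_iterate_poisson (hU : IsOpen U) (hf : DifferentiableOn ℂ χ U)
    (hg : DifferentiableOn ℂ g U) (j : ℕ) : DifferentiableOn ℂ ((poisson χ)^[j] g) U := by
  induction j with
  | zero => exact hg
  | succ j ih =>
    rw [Function.iterate_succ_apply']
    exact differentiableOn_poisson hU hf ih

theorem poisson_congr (hU : IsOpen U) (h : ∀ z ∈ U, f z = g z) {z : Phase n m} (hz : z ∈ U) :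
    poisson χ f z = poisson χ g z := by
  have : f =ᶠ[𝓝 z] g := by filter_upwards [hU.mem_nhds hz] with x hx using h x hx
  simp only [poisson_def, this.fderiv_eq]

theorem iterate_poisson_congr (hU : IsOpen U) (h : ∀ z ∈ U, f z = g z) (j : ℕ) :
    ∀ z ∈ U, (poisson χ)^[j] f z = (poisson χ)^[j] g z := by
  induction j with
  | zero => exact h
  | succ j ih =>
    intro z hz
    rw [Function.iterate_succ_apply', Function.iterate_succ_apply']
    exact poisson_congr hU ih hz

theorem poisson_add_smul (c : ℂ) {z : Phase n m} (hf : DifferentiableAt ℂ f z)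
    (hg : DifferentiableAt ℂ g z) :
    poisson χ (fun z => f z + c * g z) z = poisson χ f z + c * poisson χ g z := by
  have e : fderiv ℂ (fun z => f z + c * g z) z = fderiv ℂ f z + c • fderiv ℂ g z := by
    rw [fderiv_fun_add hf (hg.const_mul c), fderiv_const_mul hg]
  simp only [poisson_def, e, _root_.add_apply, _root_.smul_apply,
    smul_eq_mul, mul_add, Finset.mul_sum]
  rw [show ∀ a b c d e f : ℂ, a + b + c + (d + e + f) = (a + d) + (b + e) + (c + f) by
    intros; ring, ← Finset.sum_add_distrib, ← Finset.sum_add_distrib]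
  congr 1
  · congr 1
    · ring
    · exact Finset.sum_congr rfl fun i _ => by ring
  · exact Finset.sum_congr rfl fun i _ => by ring

theorem iterate_poisson_add_smul (hU : IsOpen U) (hχ : DifferentiableOn ℂ χ U)
    (hf : DifferentiableOn ℂ f U) (hg : DifferentiableOn ℂ g U) (c : ℂ) (j : ℕ) :
    ∀ z ∈ U, (poisson χ)^[j] (fun z => f z + c * g z) z =
      (poisson χ)^[j] f z + c * (poisson χ)^[j] g z := by
  induction j with
  | zero => intro z _; rfl
  | succ j ih =>
    intro z hz
    simp only [Function.iterate_succ_apply']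
    rw [poisson_congr hU ih hz]
    exact poisson_add_smul c
      (((differentiableOn_iterate_poisson hU hχ hf j) z hz).differentiableAt (hU.mem_nhds hz))
      (((differentiableOn_iterate_poisson hU hχ hg j) z hz).differentiableAt (hU.mem_nhds hz))

end Iterates

/-! ### Convergence of Lie series -/

section LieSeries

variable {χ g : Phase n m → ℂ} {σ ν K M : ℝ}

theorem pow_self_le_exp_mul_factorial (j : ℕ) :
    (j : ℝ) ^ j ≤ Real.exp 1 ^ j * j.factorial := by
  have h := Real.pow_div_factorial_le_exp (j : ℝ) (Nat.cast_nonneg j) j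
  rw [div_le_iff₀ (by positivity)] at h
  rwa [← Real.exp_nat_mul, mul_one]

/-- The ratio of the geometric series majorizing the Lie series. -/
def lieRatio (n m : ℕ) (u : Width) (ν K : ℝ) : ℝ :=
  2 * (1 + n + m) * Real.exp 1 * K / (ν ^ 2 * u.frakd)

/-- The loss `ν` is divided into `j` equal parts, one for each bracket. The generator is always used
at distance at least `ν` from its own domain, so each bracket costs `1/(ν · ν/j)`; the resulting
`j^j` is absorbed by `e^j j!`. -/
theorem Bd.iterate_poisson (hu : u.Pos) (hν : 0 < ν) (hσ : 0 < σ - 2 * ν)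
    (hg : Bd B (u.scale (σ - ν)) M g) (hχ : Bd B (u.scale σ) K χ) (j : ℕ) :
    Bd B (u.scale (σ - 2 * ν)) (lieRatio n m u ν K ^ j * j.factorial * M)
      ((poisson χ)^[j] g) := by
  have hd := Width.frakd_pos hu
  have hK := hχ.nonneg
  have hM := hg.nonneg
  rcases Nat.eq_zero_or_pos j with rfl | hj
  · simpa using hg.mono_width (Width.scale_le hu (by linarith))
  have hj0 : (0 : ℝ) < j := by exact_mod_cast hj
  have main : ∀ t : ℕ, t ≤ j → Bd B (u.scale (σ - ν - t * (ν / j)))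
      ((2 * (1 + n + m) * K / (ν * (ν / j) * u.frakd)) ^ t * M) ((poisson χ)^[t] g) := by
    intro t
    induction t with
    | zero => intro _; simpa using hg
    | succ t ih =>
      intro ht
      have ih := ih (by omega)
      rw [Function.iterate_succ_apply']
      have h1 : ((t + 1 : ℕ) : ℝ) * (ν / j) ≤ ν := by
        have : ((t + 1 : ℕ) : ℝ) ≤ j := by exact_mod_cast ht
        calc _ ≤ (j : ℝ) * (ν / j) := by gcongr
          _ = ν := by field_simp
      have h0 : 0 < ν / j := by positivity
      have h2 : ((t + 1 : ℕ) : ℝ) * (ν / j) = t * (ν / j) + ν / j := by push_cast; ring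
      have h3 : (0 : ℝ) ≤ t * (ν / j) := by positivity
      have hb := Bd.poissonBracket hu (τ := σ - ν - (t + 1 : ℕ) * (ν / j)) (by linarith)
        (by linarith) (by linarith) hχ ih
      refine hb.mono ?_
      have e : σ - ν - t * (ν / j) - (σ - ν - (t + 1 : ℕ) * (ν / j)) = ν / j := by
        rw [h2]; ring
      rw [e, pow_succ']
      set Q := (2 * (1 + n + m) * K / (ν * (ν / j) * u.frakd)) ^ t * M with hQ
      have hQ0 : 0 ≤ Q := ih.nonneg
      have h4 : ν ≤ σ - (σ - ν - (t + 1 : ℕ) * (ν / j)) := by linarith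
      calc _ ≤ 2 * (1 + n + m) * (K * Q / (ν * (ν / j) * u.frakd)) := by gcongr
        _ = _ := by rw [hQ]; ring
  have h := main j le_rfl
  have e : σ - ν - j * (ν / j) = σ - 2 * ν := by field_simp; ring
  rw [e] at h
  refine h.mono ?_
  gcongr
  have e2 : 2 * (1 + n + m) * K / (ν * (ν / j) * u.frakd) =
      2 * (1 + n + m) * K / (ν ^ 2 * u.frakd) * j := by field_simp
  have e3 : lieRatio n m u ν K = 2 * (1 + n + m) * K / (ν ^ 2 * u.frakd) * Real.exp 1 := by
    rw [lieRatio]; ring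
  have hA : 0 ≤ (2 * (1 + n + m) * K / (ν ^ 2 * u.frakd)) ^ j := by positivity
  rw [e2, e3, mul_pow _ (j : ℝ), mul_pow _ (Real.exp 1), mul_assoc (_ ^ j)]
  exact mul_le_mul_of_nonneg_left (pow_self_le_exp_mul_factorial j) hA

/-- The coefficients are kept general because the transformed Hamiltonian involves `1/(j+1)!` and
`1/(j+2)!` besides `1/j!`. The factor `2` is the sum of the geometric series of ratio `1/2`. -/
theorem Bd.lieSum (hu : u.Pos) (hν : 0 < ν) (hσ : 0 < σ - 2 * ν)
    (hg : Bd B (u.scale (σ - ν)) M g) (hχ : Bd B (u.scale σ) K χ)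
    (hη : lieRatio n m u ν K ≤ 1 / 2) {c : ℕ → ℂ} (hc : ∀ j, ‖c j‖ ≤ ((j.factorial : ℝ))⁻¹) :
    (∀ z ∈ strip m B (u.scale (σ - 2 * ν)), Summable fun j => c j * (poisson χ)^[j] g z) ∧
      Bd B (u.scale (σ - 2 * ν)) (2 * M) (fun z => ∑' j, c j * (poisson χ)^[j] g z) := by
  have hM := hg.nonneg
  have hη0 : 0 ≤ lieRatio n m u ν K := by
    have := Width.frakd_pos hu
    have := hχ.nonneg
    rw [lieRatio]; positivity
  have hj : ∀ j, Bd B (u.scale (σ - 2 * ν)) ((1 / 2) ^ j * M)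
      (fun z => c j * (poisson χ)^[j] g z) := fun j => by
    refine ((hg.iterate_poisson hu hν hσ hχ j).const_mul (c j)).mono ?_
    have hf : (0 : ℝ) < j.factorial := by positivity
    calc _ ≤ ((j.factorial : ℝ))⁻¹ * ((1 / 2) ^ j * j.factorial * M) := by
          gcongr
          exact hc j
      _ = _ := by field_simp
  have hs : HasSum (fun j : ℕ => (1 / 2 : ℝ) ^ j * M) (2 * M) := hasSum_geometric_two.mul_right M
  have := Bd.tsum hj hs.summable
  rw [hs.tsum_eq] at this
  exact this

/-- The transformed Hamiltonian when `χ` solves the homological equation `{χ, H} = -G₁`. -/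
theorem Bd.lieExp_sub (hu : u.Pos) (hν : 0 < ν) (hσ : 0 < σ - 2 * ν)
    (hχ : Bd B (u.scale σ) K χ) (hη : lieRatio n m u ν K ≤ 1 / 2) {H G G₁ : Phase n m → ℂ}
    (hH : DifferentiableOn ℂ H (strip m B (u.scale σ)))
    (hG : DifferentiableOn ℂ G (strip m B (u.scale σ)))
    (hG₁ : DifferentiableOn ℂ G₁ (strip m B (u.scale σ)))
    (heq : ∀ z ∈ strip m B (u.scale σ), poisson χ H z = -G₁ z) {M₁ M₂ : ℝ}
    (h1 : Bd B (u.scale (σ - ν)) M₁ (poisson χ G))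
    (h2 : Bd B (u.scale (σ - ν)) M₂ (poisson χ G₁)) :
    Bd B (u.scale (σ - 2 * ν)) (2 * M₁ + 2 * M₂)
      (fun z => lieExp χ (fun z => H z + G z) z - H z - (G z - G₁ z)) := by
  set U := strip m B (u.scale σ)
  have hU : IsOpen U := isOpen_strip B _
  have hχd : DifferentiableOn ℂ χ U := hχ.differentiableOn
  obtain ⟨s1, b1⟩ := h1.lieSum hu hν hσ hχ hη (c := fun j => (((j + 1).factorial : ℂ))⁻¹)
    (fun j => by
      rw [norm_inv, Complex.norm_natCast]
      gcongr
      omega)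
  obtain ⟨s2, b2⟩ := h2.lieSum hu hν hσ hχ hη (c := fun j => (((j + 2).factorial : ℂ))⁻¹)
    (fun j => by
      rw [norm_inv, Complex.norm_natCast]
      gcongr
      omega)
  refine (b1.sub b2).congr fun z hz => ?_
  have hzU : z ∈ U := strip_mono B (Width.scale_le hu (by linarith)) hz
  -- The first bracket with `H` is replaced by `-G₁`, so no estimate of `H` is needed.
  have t1 : ∀ j, (poisson χ)^[j + 1] (fun z => H z + G z) z =
      (poisson χ)^[j] (poisson χ G) z - (poisson χ)^[j] G₁ z := by
    intro j
    have e1 := iterate_poisson_add_smul hU hχd hH hG 1 (j + 1) z hzU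
    simp only [one_mul] at e1
    rw [e1, Function.iterate_succ_apply, Function.iterate_succ_apply]
    have e2 := iterate_poisson_congr (χ := χ) (f := poisson χ H)
      (g := fun z => (0 : ℂ) + (-1) * G₁ z) hU
      (fun z hz => by rw [heq z hz]; ring) j z hzU
    have e3 := iterate_poisson_add_smul hU hχd (differentiableOn_const (0 : ℂ)) hG₁ (-1) j z hzU
    -- Iterated brackets of the zero function vanish: linearity gives `Y = Y - Y`.
    have e4 := iterate_poisson_add_smul hU hχd (differentiableOn_const (0 : ℂ))
      (differentiableOn_const (0 : ℂ)) (-1) j z hzU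
    have e5 : (fun _ : Phase n m => (0 : ℂ) + (-1) * 0) = fun _ => 0 := by simp
    rw [e5] at e4
    rw [e2, e3, show (poisson χ)^[j] (fun _ => (0 : ℂ)) z = 0 by linear_combination e4]
    ring
  -- The term `j = 0` of this series is `G₁` itself; it combines with `G` into `G - G₁`, and the
  -- rest starts from `{χ, G₁}` with coefficients `1/(j+2)!`.
  have hs2 : HasSum (fun j : ℕ => (((j + 1).factorial : ℂ))⁻¹ * (poisson χ)^[j] G₁ z)
      ((∑' j, (((j + 2).factorial : ℂ))⁻¹ * (poisson χ)^[j] (poisson χ G₁) z) + G₁ z) := by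
    rw [← hasSum_nat_add_iff' 1]
    simpa using (s2 z hz).hasSum
  have hs : HasSum (fun j : ℕ => ((j.factorial : ℂ))⁻¹ *
      (poisson χ)^[j] (fun z => H z + G z) z)
      ((∑' j, (((j + 1).factorial : ℂ))⁻¹ * (poisson χ)^[j] (poisson χ G) z) -
        ((∑' j, (((j + 2).factorial : ℂ))⁻¹ * (poisson χ)^[j] (poisson χ G₁) z) + G₁ z) +
        (H z + G z)) := by
    rw [← hasSum_nat_add_iff' 1]
    have := (s1 z hz).hasSum.sub hs2
    simp only [t1, mul_sub]
    simpa using this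
  rw [lieExp, hs.tsum_eq]
  ring

theorem Bd.lieSeries (hu : u.Pos) (hν : 0 < ν) (hσ : 0 < σ - 2 * ν)
    (hg : Bd B (u.scale (σ - ν)) M g) (hχ : Bd B (u.scale σ) K χ)
    (hη : lieRatio n m u ν K ≤ 1 / 2) :
    Bd B (u.scale (σ - 2 * ν)) (2 * M) (lieExp χ g) :=
  (hg.lieSum hu hν hσ hχ hη (c := fun j => ((j.factorial : ℂ))⁻¹)
    (fun j => by rw [norm_inv, Complex.norm_natCast])).2

end LieSeries

end LieSeriesTheory

/-! ### From atomic bounds to the Taylor–Fourier norm -/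

section NormBound

variable {n m : ℕ} {B : BaseSets n} {v w u : Width}

/-- Taylor expansion of a Fourier mode in the variables `(p, q)`. -/
theorem IsAtom.expansion {k : Fin n → ℤ} {a : ℝ} {F : Phase n m → ℂ} (hF : IsAtom B w k a F)
    {δ δ' : ℝ} (hδ : 0 < δ) (hδδ' : δ < δ') (hδ' : δ' < w.δ) {y : ℂ × (Fin n → ℂ) × ℂ}
    (hy : y ∈ slowDomain B w) :
    (∀ p : (Fin m → ℕ) × (Fin m → ℕ), ‖coeff δ F k p.1 p.2 y.1 y.2.1 y.2.2‖ *
      δ' ^ Index.deg ((k, p) : Index n m) ≤ a * Real.exp (-(w.s * ∑ i, |(k i : ℝ)|))) ∧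
    ∀ b : Fast n m, (∀ l, ‖b.2.1 l‖ < w.δ) → (∀ l, ‖b.2.2 l‖ < w.δ) →
      HasSum (fun p : (Fin m → ℕ) × (Fin m → ℕ) =>
        coeff δ F k p.1 p.2 y.1 y.2.1 y.2.2 * monom (k, p) b) (F (y.1, y.2.1, y.2.2, b)) := by
  have hin : ∀ b ∈ fastDomain n m Set.univ w.δ, ((y.1, y.2.1, y.2.2, b) : Phase n m) ∈ slab m B w :=
    fun b hb => ⟨hy, hb.2.1, hb.2.2⟩
  have hexp := coeff_expansion (g := F) (r := y.1) (I := y.2.1) (x := y.2.2) (S := Set.univ)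
    isOpen_univ Set.ordConnected_univ trivial hδ (hδδ'.trans hδ')
    (hF.diff.comp (by fun_prop) hin) (fun b hb i => by
      have := hF.qper _ (hin b hb) (Pi.single i (2 * (Real.pi : ℂ)))
      refine this.trans ?_
      have e : ∑ x, (k x : ℂ) * (Pi.single i (2 * (Real.pi : ℂ)) : Fin n → ℂ) x =
          k i * (2 * Real.pi) := by simp [Pi.single_apply]
      rw [e, show Complex.I * ((k i : ℂ) * (2 * Real.pi)) = (k i : ℂ) * (2 * Real.pi * Complex.I) by
        ring, Complex.exp_int_mul_two_pi_mul_I, one_mul])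
    (M := fun t => a * Real.exp (-(w.s * ∑ i, |(k i : ℝ)|) - ∑ i, k i * t i))
    (fun b hb _ => hF.bound _ (hin b hb))
  set A := a * Real.exp (-(w.s * ∑ i, |(k i : ℝ)|)) with hA
  have hb : ∀ (K : Index n m) (t : Fin n → ℝ),
      ‖coeff δ F K.1 K.2.1 K.2.2 y.1 y.2.1 y.2.2‖ * δ' ^ K.deg ≤
        A * Real.exp (∑ i, ((K.1 i : ℝ) - k i) * t i) := by
    intro K t
    refine (hexp.1 K t (fun _ => trivial) δ' (hδ.trans hδδ') hδ').trans_eq ?_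
    rw [hA, mul_assoc, mul_assoc, ← Real.exp_add, ← Real.exp_add]
    simp only [sub_mul, Finset.sum_sub_distrib]
    ring_nf
  -- The estimate holds for all real heights `t`, since the mode extends to all complex angles;
  -- moving `t` along `-(K.1 - k)` makes the bound tend to `0`.
  have hzero : ∀ K : Index n m, K.1 ≠ k → coeff δ F K.1 K.2.1 K.2.2 y.1 y.2.1 y.2.2 = 0 := by
    intro K hK
    obtain ⟨i₀, hi₀⟩ := Function.ne_iff.1 hK
    have h1 : (1 : ℝ) ≤ ∑ i, ((K.1 i : ℝ) - k i) ^ 2 := by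
      refine le_trans ?_ (Finset.single_le_sum (f := fun i => ((K.1 i : ℝ) - k i) ^ 2)
        (fun i _ => sq_nonneg _) (Finset.mem_univ i₀))
      have h2 : (1 : ℤ) ≤ (K.1 i₀ - k i₀) ^ 2 :=
        Int.add_one_le_iff.2 (sq_pos_iff.2 (sub_ne_zero.2 hi₀))
      exact_mod_cast h2
    have h2 : ∀ᶠ t : ℝ in atTop, ‖coeff δ F K.1 K.2.1 K.2.2 y.1 y.2.1 y.2.2‖ * δ' ^ K.deg ≤
        A * Real.exp (-t) := by
      filter_upwards [eventually_ge_atTop 0] with t ht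
      refine (hb K fun i => -t * ((K.1 i : ℝ) - k i)).trans ?_
      have hA0 : 0 ≤ A := mul_nonneg hF.nonneg (Real.exp_pos _).le
      gcongr
      have e : ∑ i, ((K.1 i : ℝ) - k i) * (-t * ((K.1 i : ℝ) - k i)) =
          -(t * ∑ i, ((K.1 i : ℝ) - k i) ^ 2) := by
        rw [Finset.mul_sum, ← Finset.sum_neg_distrib]
        exact Finset.sum_congr rfl fun i _ => by ring
      rw [e]
      nlinarith
    have h3 := ge_of_tendsto ((Real.tendsto_exp_neg_atTop_nhds_zero).const_mul A) h2
    rw [mul_zero] at h3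
    have h4 : 0 < δ' ^ K.deg := pow_pos (hδ.trans hδδ') _
    have h5 : ‖coeff δ F K.1 K.2.1 K.2.2 y.1 y.2.1 y.2.2‖ ≤ 0 := by
      by_contra h
      exact absurd h3 (not_le.2 (mul_pos (not_le.1 h) h4))
    exact norm_le_zero_iff.1 h5
  refine ⟨fun p => ?_, fun b h1 h2 => ?_⟩
  · simpa using hb (k, p) 0
  · have h3 := hexp.2 b ⟨fun _ => trivial, h1, h2⟩
    have hinj : Function.Injective (fun p : (Fin m → ℕ) × (Fin m → ℕ) => ((k, p) : Index n m)) :=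
      fun p p' h => (Prod.ext_iff.1 h).2
    rw [← hinj.hasSum_iff] at h3
    · exact h3
    · intro K hK
      have : K.1 ≠ k := fun h => hK ⟨K.2, by rw [← h]⟩
      rw [hzero K this, zero_mul]

/-- `∑ θ^{|h| + |j|}`. -/
def taylorSum (m : ℕ) (θ : ℝ) : ℝ :=
  ∑' p : (Fin m → ℕ) × (Fin m → ℕ), θ ^ (∑ l, p.1 l + ∑ l, p.2 l)

theorem summable_taylor {θ : ℝ} (hθ : 0 ≤ θ) (hθ1 : θ < 1) :
    Summable fun p : (Fin m → ℕ) × (Fin m → ℕ) => θ ^ (∑ l, p.1 l + ∑ l, p.2 l) := by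
  have h := summable_pi_prod (summable_geometric_of_lt_one hθ hθ1) (fun k => pow_nonneg hθ k)
    (Fin m)
  have hp : ∀ h : Fin m → ℕ, 0 ≤ ∏ l, θ ^ h l := fun h =>
    Finset.prod_nonneg fun l _ => pow_nonneg hθ _
  refine (h.mul_of_nonneg h hp hp).congr fun p => ?_
  rw [pow_add, Finset.prod_pow_eq_pow_sum, Finset.prod_pow_eq_pow_sum]

theorem taylorSum_nonneg {θ : ℝ} (hθ : 0 ≤ θ) : 0 ≤ taylorSum m θ :=
  tsum_nonneg fun _ => pow_nonneg hθ _

/-- Coefficients of a sum of Fourier modes. -/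
theorem norm_coeff_le_of_hasSum {ι : Type} [Countable ι] {k : ι → Fin n → ℤ} {a : ι → ℝ}
    {F : ι → Phase n m → ℂ} {g : Phase n m → ℂ} (hv : v.Pos) (hvw : v.Lt w) {δ' : ℝ}
    (hθv : v.δ < δ') (hδ'w : δ' < w.δ) (h1 : ∀ i, IsAtom B w (k i) (a i) (F i)) (h2 : Summable a)
    (h4 : ∀ z ∈ strip m B w, HasSum (fun i => F i z) (g z)) (K : Index n m)
    {y : ℂ × (Fin n → ℂ) × ℂ} (hy : y ∈ slowDomain B v) :
    ‖coeff v.δ g K.1 K.2.1 K.2.2 y.1 y.2.1 y.2.2‖ ≤ (∑' i, if k i = K.1 then a i else 0) *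
      (Real.exp (-(w.s * ∑ i, |(K.1 i : ℝ)|)) / δ' ^ K.deg) := by
  have hw := hvw.pos hv
  have hδ'0 : 0 < δ' := hv.2.2.2.2.trans hθv
  set q := v.δ / δ' with hq
  have hq0 : 0 ≤ q := div_nonneg hv.2.2.2.2.le hδ'0.le
  have hq1 : q < 1 := (div_lt_one hδ'0).2 hθv
  have hT := summable_taylor (m := m) hq0 hq1
  have hsumI : Summable fun i => if k i = K.1 then a i else 0 :=
    Summable.of_nonneg_of_le (fun i => by split_ifs <;> simp [(h1 i).nonneg])
      (fun i => by split_ifs <;> simp [(h1 i).nonneg]) h2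
  -- Here `q` is the ratio of the final radius to the intermediate one; it makes the Taylor series
  -- of each mode converge geometrically, uniformly over the modes.
  have haT : Summable fun b : ι × ((Fin m → ℕ) × (Fin m → ℕ)) =>
      a b.1 * q ^ (∑ l, b.2.1 l + ∑ l, b.2.2 l) :=
    Summable.mul_of_nonneg (g := fun p : (Fin m → ℕ) × (Fin m → ℕ) =>
      q ^ (∑ l, p.1 l + ∑ l, p.2 l)) h2 hT (fun i => (h1 i).nonneg) (fun p => pow_nonneg hq0 _)
  have hyw := slowDomain_mono B hvw.le hy
  have hex := fun i => (h1 i).expansion hv.2.2.2.2 hθv hδ'w hyw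
  have hcb : ∀ b : ι × ((Fin m → ℕ) × (Fin m → ℕ)),
      ‖coeff v.δ (F b.1) (k b.1) b.2.1 b.2.2 y.1 y.2.1 y.2.2‖ *
        v.δ ^ Index.deg ((k b.1, b.2) : Index n m) ≤
        a b.1 * q ^ (∑ l, b.2.1 l + ∑ l, b.2.2 l) := by
    rintro ⟨i, p⟩
    have h5 := (hex i).1 p
    have h6 : a i * Real.exp (-(w.s * ∑ j, |(k i j : ℝ)|)) ≤ a i := by
      refine mul_le_of_le_one_right (h1 i).nonneg (Real.exp_le_one_iff.2 ?_)
      have := mul_nonneg hw.2.2.2.1.le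
        (Finset.sum_nonneg fun j (_ : j ∈ Finset.univ) => abs_nonneg (k i j : ℝ))
      linarith
    have h7 := h5.trans h6
    have e : v.δ = q * δ' := by rw [hq]; field_simp
    have h8 : (0 : ℝ) ≤ q ^ Index.deg ((k i, p) : Index n m) := pow_nonneg hq0 _
    calc _ = q ^ Index.deg ((k i, p) : Index n m) *
          (‖coeff v.δ (F i) (k i) p.1 p.2 y.1 y.2.1 y.2.2‖ *
          δ' ^ Index.deg ((k i, p) : Index n m)) := by
          conv_lhs => rw [e]
          rw [mul_pow]
          conv_rhs => rw [e]
          ring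
      _ ≤ q ^ Index.deg ((k i, p) : Index n m) * a i := by gcongr
      _ = _ := mul_comm _ _
  have hss : Summable fun b : ι × ((Fin m → ℕ) × (Fin m → ℕ)) =>
      ‖coeff v.δ (F b.1) (k b.1) b.2.1 b.2.2 y.1 y.2.1 y.2.2‖ *
        v.δ ^ Index.deg ((k b.1, b.2) : Index n m) :=
    Summable.of_nonneg_of_le (fun b => mul_nonneg (norm_nonneg _)
      (pow_nonneg hv.2.2.2.2.le _)) hcb haT
  have hin : ∀ t, (∀ l, ‖(torusPoint v.δ t : Fast n m).2.1 l‖ < w.δ) ∧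
      ∀ l, ‖(torusPoint v.δ t : Fast n m).2.2 l‖ < w.δ := by
    intro t
    have hn : ∀ c : ℝ, ‖(v.δ : ℂ) * Complex.exp (Complex.I * (c : ℂ))‖ < w.δ := fun c => by
      rw [norm_mul, norm_exp_I_mul, Complex.norm_real, Real.norm_of_nonneg hv.2.2.2.2.le]
      simpa using hvw.2.2.2.2
    exact ⟨fun l => hn _, fun l => hn _⟩
  have hsum := hasSum_coeff (r := y.1) (I := y.2.1) (x := y.2.2) (g := g) hv.2.2.2.2
    (c := fun b : ι × ((Fin m → ℕ) × (Fin m → ℕ)) =>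
      coeff v.δ (F b.1) (k b.1) b.2.1 b.2.2 y.1 y.2.1 y.2.2)
    (L := fun b => (k b.1, b.2)) hss (by
      intro t
      have hst : ((y.1, y.2.1, y.2.2, torusPoint v.δ t) : Phase n m) ∈ strip m B w :=
        ⟨⟨hyw, (hin t).1, (hin t).2⟩, fun i => by simpa [torusPoint] using hw.2.2.2.1⟩
      have hsb : Summable fun b : ι × ((Fin m → ℕ) × (Fin m → ℕ)) =>
          coeff v.δ (F b.1) (k b.1) b.2.1 b.2.2 y.1 y.2.1 y.2.2 *
            monom ((k b.1, b.2) : Index n m) (torusPoint v.δ t) := by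
        refine Summable.of_norm (hss.congr fun b => ?_)
        rw [norm_mul, norm_mono_torusPoint hv.2.2.2.2.le]
      have h5 := hsb.hasSum.prod_fiberwise fun i => (hex i).2 _ (hin t).1 (hin t).2
      rw [(h4 _ hst).unique h5]
      exact hsb.hasSum) K
  have hpt : ∀ i, HasSum (fun p : (Fin m → ℕ) × (Fin m → ℕ) =>
      if ((k i, p) : Index n m) = K then coeff v.δ (F i) (k i) p.1 p.2 y.1 y.2.1 y.2.2 else 0)
      (if k i = K.1 then coeff v.δ (F i) K.1 K.2.1 K.2.2 y.1 y.2.1 y.2.2 else 0) := by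
    intro i
    have h5 := hasSum_ite_eq K.2
      (if k i = K.1 then coeff v.δ (F i) K.1 K.2.1 K.2.2 y.1 y.2.1 y.2.2 else 0)
    refine h5.congr_fun fun p => ?_
    by_cases hp : p = K.2
    · subst hp
      by_cases hk : k i = K.1
      · simp [hk]
      · simp [Prod.ext_iff, hk]
    · simp [Prod.ext_iff, hp] at *
  have hfib := hsum.prod_fiberwise hpt
  rw [← hfib.tsum_eq, ← tsum_mul_right]
  refine tsum_of_norm_bounded (hsumI.mul_right _).hasSum fun i => ?_
  by_cases hk : k i = K.1
  · rw [if_pos hk, if_pos hk, ← mul_div_assoc, le_div_iff₀ (pow_pos hδ'0 _)]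
    have h5 := (hex i).1 K.2
    rw [hk] at h5
    exact h5
  · simp [hk]

/-- A sum of Fourier modes has finite weighted Taylor–Fourier norm on smaller domains. -/
theorem Bd.norm_le_ofReal (hv : v.Pos) (hvw : v.Lt w) {θ M : ℝ} (hθ : 0 < θ) (hθ1 : θ < 1)
    (hθv : v.δ < θ * w.δ) {g : Phase n m → ℂ} (h : Bd B w M g) :
    norm B v g ≤ ENNReal.ofReal (taylorSum m (v.δ / (θ * w.δ)) * M) := by
  obtain ⟨ι, hι, k, a, F, h1, h2, h3, h4⟩ := h
  have hw := hvw.pos hv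
  -- Cauchy estimates in `(p, q)` are made at this intermediate radius; the only cost is the
  -- geometric sum of ratio `v.δ/δ'`.
  set δ' := θ * w.δ with hδ'
  have hδ'w : δ' < w.δ := mul_lt_of_lt_one_left hw.2.2.2.2 hθ1
  have hδ'0 : 0 < δ' := hv.2.2.2.2.trans hθv
  set q := v.δ / δ' with hq
  have hq0 : 0 ≤ q := div_nonneg hv.2.2.2.2.le hδ'0.le
  have hq1 : q < 1 := (div_lt_one hδ'0).2 hθv
  have hT := summable_taylor (m := m) hq0 hq1
  have hcoef : ∀ K : Index n m, coeffSup B v g K *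
      ENNReal.ofReal (Real.exp (v.s * ∑ i, |(K.1 i : ℝ)|) * v.δ ^ K.deg) ≤
      ∑' i, if k i = K.1 then ENNReal.ofReal (a i) * ENNReal.ofReal (q ^ K.deg) else 0 := by
    intro K
    have hsumI : Summable fun i => if k i = K.1 then a i else 0 :=
      Summable.of_nonneg_of_le (fun i => by split_ifs <;> simp [(h1 i).nonneg])
        (fun i => by split_ifs <;> simp [(h1 i).nonneg]) h2
    have hbound := fun y (hy : y ∈ slowDomain B v) =>
      norm_coeff_le_of_hasSum hv hvw hθv hδ'w h1 h2 h4 K hy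
    have hle : coeffSup B v g K ≤ ENNReal.ofReal ((∑' i, if k i = K.1 then a i else 0) *
          (Real.exp (-(w.s * ∑ i, |(K.1 i : ℝ)|)) / δ' ^ K.deg)) := by
      refine coeffSup_le_iff.2 fun y hy => ?_
      rw [← ofReal_norm]
      exact ENNReal.ofReal_le_ofReal (hbound y hy)
    have hI0 : ∀ i, 0 ≤ if k i = K.1 then a i else 0 := fun i => by
      split_ifs <;> simp [(h1 i).nonneg]
    calc _ ≤ ENNReal.ofReal ((∑' i, if k i = K.1 then a i else 0) *
          (Real.exp (-(w.s * ∑ i, |(K.1 i : ℝ)|)) / δ' ^ K.deg)) *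
          ENNReal.ofReal (Real.exp (v.s * ∑ i, |(K.1 i : ℝ)|) * v.δ ^ K.deg) := by gcongr
      _ ≤ ENNReal.ofReal ((∑' i, if k i = K.1 then a i else 0) * q ^ K.deg) := by
        have h0 : 0 ≤ ∑' i, if k i = K.1 then a i else 0 := tsum_nonneg hI0
        rw [← ENNReal.ofReal_mul (by positivity)]
        refine ENNReal.ofReal_le_ofReal ?_
        rw [mul_assoc]
        gcongr
        rw [hq, div_pow, div_mul_eq_mul_div]
        gcongr
        rw [← mul_assoc, ← Real.exp_add]
        refine mul_le_of_le_one_left (pow_nonneg hv.2.2.2.2.le _) (Real.exp_le_one_iff.2 ?_)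
        have h5 : 0 ≤ ∑ i, |(K.1 i : ℝ)| := Finset.sum_nonneg fun j _ => abs_nonneg _
        have h6 := hvw.2.2.2.1
        nlinarith
      _ = _ := by
        rw [ENNReal.ofReal_mul (tsum_nonneg hI0), ENNReal.ofReal_tsum_of_nonneg hI0 hsumI,
          ← ENNReal.tsum_mul_right]
        refine tsum_congr fun i => ?_
        split_ifs <;> simp
  have hfin : ∑' i, ENNReal.ofReal (a i) ≤ ENNReal.ofReal M := by
    rw [← ENNReal.ofReal_tsum_of_nonneg (fun i => (h1 i).nonneg) h2]
    exact ENNReal.ofReal_le_ofReal h3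
  rw [norm_eq]
  calc _ ≤ ∑' K : Index n m, ∑' i,
        if k i = K.1 then ENNReal.ofReal (a i) * ENNReal.ofReal (q ^ K.deg) else 0 :=
        ENNReal.tsum_le_tsum hcoef
    -- After exchanging the sums, each mode meets exactly one Fourier index `k`, and only its Taylor
    -- indices remain to be summed.
    _ = ∑' i, ∑' K : Index n m,
        if k i = K.1 then ENNReal.ofReal (a i) * ENNReal.ofReal (q ^ K.deg) else 0 :=
        ENNReal.tsum_comm
    _ = ∑' i, ENNReal.ofReal (a i) * ENNReal.ofReal (taylorSum m q) := by
        refine tsum_congr fun i => ?_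
        have e := ENNReal.tsum_prod (f := fun (κ : Fin n → ℤ) (p : (Fin m → ℕ) × (Fin m → ℕ)) =>
          if k i = κ then ENNReal.ofReal (a i) *
            ENNReal.ofReal (q ^ (∑ l, p.1 l + ∑ l, p.2 l)) else 0)
        refine e.trans ?_
        rw [ENNReal.tsum_comm]
        rw [taylorSum, ENNReal.ofReal_tsum_of_nonneg (fun _ => pow_nonneg hq0 _) hT,
          ← ENNReal.tsum_mul_left]
        refine tsum_congr fun p => ?_
        rw [tsum_ite_eq']
    _ ≤ _ := by
        rw [ENNReal.tsum_mul_right, mul_comm, ENNReal.ofReal_mul (taylorSum_nonneg hq0)]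
        gcongr

end NormBound

/-! ### Averages -/

section AverageTheory

variable {n m : ℕ} {B : BaseSets n} {v w u : Width}

/-! ### The average as an integral over torus rotations -/

section Rotation

/-- The point with angles `2π s` and with `(p, q)` rotated by the angles `2π t`. -/
def rotate (τ : (Fin n → ℝ) × (Fin m → ℝ)) (z : Phase n m) : Phase n m :=
  (z.1, z.2.1, z.2.2.1, fun i => 2 * Real.pi * (τ.1 i : ℂ),
    fun l => Complex.exp (Complex.I * (2 * Real.pi * (τ.2 l : ℂ))) * z.2.2.2.2.1 l,
    fun l => Complex.exp (-(Complex.I * (2 * Real.pi * (τ.2 l : ℂ)))) * z.2.2.2.2.2 l)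

/-- The unit cube. -/
def unitBox (n m : ℕ) : Set ((Fin n → ℝ) × (Fin m → ℝ)) := Set.Icc 0 1

/-- The average over the rotations. -/
def avg (g : Phase n m → ℂ) : Phase n m → ℂ := fun z =>
  ∫ τ in unitBox n m, g (rotate τ z)

theorem isCompact_unitBox : IsCompact (unitBox n m) := isCompact_Icc

theorem measurableSet_unitBox : MeasurableSet (unitBox n m) := measurableSet_Icc

theorem unitBox_eq : unitBox n m = Set.Icc 0 (fun _ => 1) ×ˢ Set.Icc 0 (fun _ => 1) := by
  rw [Set.Icc_prod_Icc]; rfl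

theorem volume_unitBox : volume (unitBox n m) = 1 := by
  rw [unitBox_eq, Measure.volume_eq_prod, Measure.prod_prod, Real.volume_Icc_pi,
    Real.volume_Icc_pi]
  simp

theorem continuous_rotate : Continuous fun p : ((Fin n → ℝ) × (Fin m → ℝ)) × Phase n m =>
    rotate p.1 p.2 := by
  unfold rotate; fun_prop

theorem norm_exp_I_two_pi (t : ℝ) : ‖Complex.exp (Complex.I * (2 * Real.pi * (t : ℂ)))‖ = 1 := by
  rw [norm_exp_I_mul]; simp

theorem norm_exp_neg_I_two_pi (t : ℝ) :
    ‖Complex.exp (-(Complex.I * (2 * Real.pi * (t : ℂ))))‖ = 1 := by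
  rw [Complex.exp_neg, norm_inv, norm_exp_I_two_pi, inv_one]

theorem rotate_mem_slab {τ : (Fin n → ℝ) × (Fin m → ℝ)} {z : Phase n m} (hz : z ∈ slab m B v) :
    rotate τ z ∈ slab m B v := by
  refine ⟨hz.1, fun l => ?_, fun l => ?_⟩
  · have h := hz.2.1 l
    simp only [rotate, norm_mul, norm_exp_I_two_pi, one_mul]
    exact h
  · have h := hz.2.2 l
    simp only [rotate, norm_mul, norm_exp_neg_I_two_pi, one_mul]
    exact h

theorem rotate_im (τ : (Fin n → ℝ) × (Fin m → ℝ)) (z : Phase n m) (i : Fin n) :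
    ((rotate τ z).2.2.2.1 i).im = 0 := by
  simp [rotate]

theorem rotate_mem_strip (hv : 0 < v.s) {τ : (Fin n → ℝ) × (Fin m → ℝ)} {z : Phase n m}
    (hz : z ∈ slab m B v) : rotate τ z ∈ strip m B v :=
  ⟨rotate_mem_slab hz, fun i => by rw [rotate_im]; simpa using hv⟩

theorem rotate_mem_domain (hv : 0 < v.s) {τ : (Fin n → ℝ) × (Fin m → ℝ)} {z : Phase n m}
    (hz : z ∈ domain m B v) : rotate τ z ∈ domain m B v := by
  refine ⟨hz.1, hz.2.1, hz.2.2.1, fun i => by rw [rotate_im]; simpa using hv.le,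
    fun l => ?_, fun l => ?_⟩
  · have h := hz.2.2.2.2.1 l
    simp only [rotate, norm_mul, norm_exp_I_two_pi, one_mul]
    exact h
  · have h := hz.2.2.2.2.2 l
    simp only [rotate, norm_mul, norm_exp_neg_I_two_pi, one_mul]
    exact h

/-- The indices of the resonant monomials. -/
def Index.IsDiag (K : Index n m) : Prop := K.1 = 0 ∧ K.2.1 = K.2.2

theorem Index.IsDiag.monom_eq {K : Index n m} (hK : K.IsDiag) (b : Fast n m) :
    monom K b = ∏ l, (b.2.1 l * b.2.2 l) ^ K.2.1 l := by
  simp only [monom, hK.1, ← hK.2, ← Finset.prod_mul_distrib, mul_pow]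
  simp

theorem Index.IsDiag.monom_rotate {K : Index n m} (hK : K.IsDiag)
    (τ : (Fin n → ℝ) × (Fin m → ℝ)) (z : Phase n m) :
    monom K (rotate τ z).2.2.2 = monom K z.2.2.2 := by
  rw [hK.monom_eq, hK.monom_eq]
  refine Finset.prod_congr rfl fun l _ => ?_
  congr 1
  simp only [rotate]
  rw [mul_mul_mul_comm, ← Complex.exp_add, add_neg_cancel, Complex.exp_zero, one_mul]

/-- The rotation multiplies a monomial by the character with frequencies `(k, h - j)`, trivial
exactly on the resonant indices. Opposite phases on `p_l` and `q_l` are what produces `h - j`. -/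
theorem monom_rotate (K : Index n m) (τ : (Fin n → ℝ) × (Fin m → ℝ)) (z : Phase n m) :
    monom K (rotate τ z).2.2.2 = monom K (0, z.2.2.2.2) *
      (Complex.exp (Complex.I * ∑ i, K.1 i * (2 * Real.pi * (τ.1 i : ℂ))) *
      Complex.exp (Complex.I * ∑ l, (((fun l => (K.2.1 l : ℤ) - K.2.2 l) l : ℤ) : ℂ) *
        (2 * Real.pi * (τ.2 l : ℂ)))) := by
  have e : ∀ (h : Fin m → ℕ) (a : Fin m → ℂ), ∏ l, Complex.exp (a l) ^ h l =
      Complex.exp (∑ l, (h l : ℂ) * a l) := by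
    intro h a
    rw [Complex.exp_sum]
    exact Finset.prod_congr rfl fun l _ => (Complex.exp_nat_mul _ _).symm
  simp only [monom, rotate, mul_pow, Finset.prod_mul_distrib, e, Pi.zero_apply, mul_zero,
    Finset.sum_const_zero, Complex.exp_zero, one_mul]
  have e2 : Complex.exp (Complex.I * ∑ l, (((K.2.1 l : ℤ) - (K.2.2 l : ℤ) : ℤ) : ℂ) *
        (2 * Real.pi * (τ.2 l : ℂ))) =
      Complex.exp (∑ l, (K.2.1 l : ℂ) * (Complex.I * (2 * Real.pi * (τ.2 l : ℂ)))) *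
      Complex.exp (∑ l, (K.2.2 l : ℂ) * -(Complex.I * (2 * Real.pi * (τ.2 l : ℂ)))) := by
    rw [← Complex.exp_add, Finset.mul_sum, ← Finset.sum_add_distrib]
    congr 1
    refine Finset.sum_congr rfl fun l _ => ?_
    push_cast
    ring
  rw [e2]
  ring

theorem norm_monom_rotate (K : Index n m) (τ : (Fin n → ℝ) × (Fin m → ℝ)) (z : Phase n m) :
    ‖monom K (rotate τ z).2.2.2‖ = ‖monom K (0, z.2.2.2.2)‖ := by
  rw [monom_rotate, norm_mul, norm_mul, norm_exp_I_mul, norm_exp_I_mul]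
  simp [Complex.im_sum]

open Classical in
theorem integral_monom_rotate (K : Index n m) (z : Phase n m) :
    ∫ τ in unitBox n m, monom K (rotate τ z).2.2.2 = if K.IsDiag then monom K z.2.2.2 else 0 := by
  have hone : ∀ (d : ℕ) (k : Fin d → ℤ), ∫ t in Set.Icc (0 : Fin d → ℝ) (fun _ => 1),
      Complex.exp (Complex.I * ∑ i, (k i : ℂ) * (2 * Real.pi * (t i : ℂ))) =
      if k = 0 then 1 else 0 := by
    intro d k
    have := integral_cube_exp one_pos k
    simpa using this
  simp only [monom_rotate]
  rw [integral_const_mul, unitBox_eq, Measure.volume_eq_prod, setIntegral_prod_mul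
    (f := fun t : Fin n → ℝ => Complex.exp (Complex.I * ∑ i, K.1 i * (2 * Real.pi * (t i : ℂ))))
    (g := fun t : Fin m → ℝ => Complex.exp (Complex.I *
      ∑ l, (((fun l => (K.2.1 l : ℤ) - K.2.2 l) l : ℤ) : ℂ) * (2 * Real.pi * (t l : ℂ)))),
    hone, hone]
  have hiff : (fun l => (K.2.1 l : ℤ) - K.2.2 l) = 0 ↔ K.2.1 = K.2.2 := by
    simp only [funext_iff, Pi.zero_apply, sub_eq_zero, Nat.cast_inj]
  rw [if_congr hiff rfl rfl]
  by_cases hK : K.IsDiag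
  · rw [if_pos hK, if_pos hK.1, if_pos hK.2, hK.monom_eq, hK.monom_eq]
    simp
  · rw [if_neg hK]
    by_cases h1 : K.1 = 0
    · rw [if_neg fun h2 => hK ⟨h1, h2⟩]; simp
    · simp [h1]

open Classical in
/-- The average of an absolutely convergent Taylor–Fourier series. -/
theorem hasSum_avg {β : Type*} [Countable β] {g : Phase n m → ℂ} {z : Phase n m} {c : β → ℂ}
    {L : β → Index n m} (hs : Summable fun b => ‖c b‖ * ‖monom (L b) ((0, z.2.2.2.2) : Fast n m)‖)
    (hg : ∀ τ, HasSum (fun b => c b * monom (L b) (rotate τ z).2.2.2) (g (rotate τ z))) :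
    HasSum (fun b => if (L b).IsDiag then c b * monom (L b) z.2.2.2 else 0) (avg g z) := by
  have hc : ∀ b, Continuous fun τ : (Fin n → ℝ) × (Fin m → ℝ) =>
      c b * monom (L b) (rotate τ z).2.2.2 := fun b => by
    refine continuous_const.mul ((continuous_mono (L b)).comp ?_)
    have h := (continuous_rotate (n := n) (m := m)).comp (f := fun τ => (τ, z)) (by fun_prop)
    exact h.snd.snd.snd
  have hsum := hasSum_integral_of_summable_integral_norm (μ := volume.restrict (unitBox n m))
    (F := fun b τ => c b * monom (L b) (rotate τ z).2.2.2)
    (fun b => (hc b).continuousOn.integrableOn_compact isCompact_unitBox) (by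
      simp only [norm_mul, norm_monom_rotate, integral_const, smul_eq_mul]
      exact hs.mul_left _)
  have h2 : ∫ τ in unitBox n m, ∑' b, c b * monom (L b) (rotate τ z).2.2.2 = avg g z :=
    integral_congr_ae (ae_of_all _ fun τ => (hg τ).tsum_eq)
  rw [h2] at hsum
  refine hsum.congr_fun fun b => ?_
  rw [integral_const_mul, integral_monom_rotate]
  split_ifs <;> simp

theorem avg_congr {f g : Phase n m → ℂ} {z : Phase n m} (h : ∀ τ, f (rotate τ z) = g (rotate τ z)) :
    avg f z = avg g z := by
  simp only [avg, h]

theorem avg_const {g : Phase n m → ℂ} {z : Phase n m} {c : ℂ} (h : ∀ τ, g (rotate τ z) = c) :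
    avg g z = c := by
  simp only [avg, h, integral_const]
  simp [Measure.real, volume_unitBox]

theorem norm_avg_le {g : Phase n m → ℂ} {z : Phase n m} {C : ℝ} (h : ∀ τ, ‖g (rotate τ z)‖ ≤ C) :
    ‖avg g z‖ ≤ C := by
  refine (norm_setIntegral_le_of_norm_le_const (by simp [volume_unitBox])
    fun τ _ => h τ).trans_eq ?_
  simp [Measure.real, volume_unitBox]

end Rotation

/-! ### Comparison with the average defined by coefficients -/

section HolomorphicAverage

open Classical in
/-- On functions of class `𝒪_w` the average is the average over the rotations. -/
theorem IsHol.average_eq_avg (hw : w.Pos) {g : Phase n m → ℂ} (hg : IsHol B w g) {z : Phase n m}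
    (hz : z ∈ domain m B w) : average w.δ g z = avg g z ∧
    HasSum (fun K : Index n m => if K.IsDiag then
      coeff w.δ g K.1 K.2.1 K.2.2 z.1 z.2.1 z.2.2.1 * monom K z.2.2.2 else 0) (avg g z) := by
  obtain ⟨C, s', δ', hC, hs, hδ, hexp⟩ := hg.expansion hw
  have h1 := (hexp (z.1, z.2.1, z.2.2.1) ⟨hz.1, hz.2.1, hz.2.2.1⟩).2
  have hrot : ∀ τ, HasSum (fun K : Index n m =>
      coeff w.δ g K.1 K.2.1 K.2.2 z.1 z.2.1 z.2.2.1 * monom K (rotate τ z).2.2.2)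
      (g (rotate τ z)) := fun τ => by
    have h := rotate_mem_domain hw.2.2.2.1 (τ := τ) hz
    exact h1 _ h.2.2.2.1 h.2.2.2.2.1 h.2.2.2.2.2
  have hsum := hasSum_avg (L := id) (by
    refine ((hrot 0).summable.norm).congr fun K => ?_
    rw [norm_mul, norm_monom_rotate]; rfl) hrot
  refine ⟨?_, hsum⟩
  have hinj : Function.Injective fun h : Fin m → ℕ => ((0, h, h) : Index n m) :=
    fun h h' e => (Prod.ext_iff.1 (Prod.ext_iff.1 e).2).1
  rw [← hinj.hasSum_iff] at hsum
  · rw [average, ← hsum.tsum_eq]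
    refine tsum_congr fun h => ?_
    have hd : Index.IsDiag ((0, h, h) : Index n m) := ⟨rfl, rfl⟩
    simp only [Function.comp, id, if_pos hd, hd.monom_eq, mul_pow]
  · intro K hK
    exact if_neg fun hd => hK ⟨K.2.1, Prod.ext hd.1.symm (Prod.ext rfl hd.2)⟩

open Classical in
theorem IsHol.coeff_offAverage (hw : w.Pos) {g : Phase n m → ℂ} (hg : IsHol B w g)
    {y : ℂ × (Fin n → ℂ) × ℂ} (hy : y ∈ slowDomain B w) (K : Index n m) :
    coeff w.δ (offAverage w.δ g) K.1 K.2.1 K.2.2 y.1 y.2.1 y.2.2 =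
      if K.IsDiag then 0 else coeff w.δ g K.1 K.2.1 K.2.2 y.1 y.2.1 y.2.2 := by
  obtain ⟨C, s', δ', hC, hs, hδ, hexp⟩ := hg.expansion hw
  have h1 := (hexp y hy).2
  have hδ0 := hw.2.2.2.2
  have htor : ∀ t, ((y.1, y.2.1, y.2.2, torusPoint w.δ t) : Phase n m) ∈ domain m B w := by
    intro t
    have hn : ∀ c : ℝ, ‖(w.δ : ℂ) * Complex.exp (Complex.I * (c : ℂ))‖ ≤ w.δ := fun c => by
      rw [norm_mul, norm_exp_I_mul, Complex.norm_real, Real.norm_of_nonneg hδ0.le]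
      simp
    exact ⟨hy.1, hy.2.1, hy.2.2, fun i => by simpa [torusPoint] using hw.2.2.2.1.le,
      fun l => hn _, fun l => hn _⟩
  have ht : ∀ t, HasSum (fun K : Index n m => (if K.IsDiag then 0 else
      coeff w.δ g K.1 K.2.1 K.2.2 y.1 y.2.1 y.2.2) * monom K (torusPoint w.δ t))
      (offAverage w.δ g (y.1, y.2.1, y.2.2, torusPoint w.δ t)) := by
    intro t
    have h2 := h1 (torusPoint w.δ t) (htor t).2.2.2.1 (htor t).2.2.2.2.1 (htor t).2.2.2.2.2
    obtain ⟨h3, h4⟩ := hg.average_eq_avg hw (htor t)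
    rw [offAverage, h3]
    refine (h2.sub h4).congr_fun fun K => ?_
    split_ifs <;> simp
  have h := hasSum_coeff hδ0 (L := id) (by
    refine (ht 0).summable.norm.congr fun K => ?_
    rw [norm_mul, norm_mono_torusPoint hδ0.le]; rfl) ht K
  have h' := hasSum_ite_eq K (if K.IsDiag then 0 else coeff w.δ g K.1 K.2.1 K.2.2 y.1 y.2.1 y.2.2)
  refine h.unique (h'.congr_fun fun K' => ?_)
  by_cases hK : K' = K
  · subst hK; simp
  · simp [hK]

open Classical in
theorem IsHol.coeffSup_offAverage (hw : w.Pos) {g : Phase n m → ℂ} (hg : IsHol B w g)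
    (K : Index n m) : coeffSup B w (offAverage w.δ g) K =
      if K.IsDiag then 0 else coeffSup B w g K := by
  refine eq_of_forall_ge_iff fun c => ?_
  rw [coeffSup_le_iff]
  have h : ∀ y ∈ slowDomain B w, _ := fun y hy => hg.coeff_offAverage hw hy K
  split_ifs with hK
  · simp only [zero_le, iff_true]
    intro y hy
    rw [h y hy, if_pos hK]
    simp
  · rw [coeffSup_le_iff]
    refine forall₂_congr fun y hy => ?_
    rw [h y hy, if_neg hK]

theorem IsHol.norm_offAverage_le (hw : w.Pos) {g : Phase n m → ℂ} (hg : IsHol B w g) :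
    norm B w (offAverage w.δ g) ≤ norm B w g := by
  classical
  rw [norm_eq, norm_eq]
  refine ENNReal.tsum_le_tsum fun K => ?_
  rw [hg.coeffSup_offAverage hw]
  gcongr
  split_ifs <;> simp

end HolomorphicAverage

/-! ### Averages of Fourier modes and zero-average decompositions -/

section ModeAverage

variable {k : Fin n → ℤ} {a M : ℝ} {F f g : Phase n m → ℂ}

theorem IsAtom.continuous_rotate (hF : IsAtom B v k a F) {z : Phase n m} (hz : z ∈ slab m B v) :
    Continuous fun τ : (Fin n → ℝ) × (Fin m → ℝ) => F (rotate τ z) :=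
  hF.diff.continuousOn.comp_continuous
    ((NormalForm.continuous_rotate (n := n) (m := m)).comp (f := fun τ => (τ, z)) (by fun_prop))
    fun _ => rotate_mem_slab hz

theorem IsAtom.norm_rotate_le (hv : 0 ≤ v.s) (hF : IsAtom B v k a F) {z : Phase n m}
    (hz : z ∈ slab m B v) (τ : (Fin n → ℝ) × (Fin m → ℝ)) : ‖F (rotate τ z)‖ ≤ a :=
  hF.norm_le (rotate_mem_slab hz) fun i => by rw [rotate_im]; simpa using hv

theorem IsAtom.avg (hv : 0 ≤ v.s) (hF : IsAtom B v k a F) : IsAtom B v 0 a (avg F) where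
  diff := by
    refine differentiableOn_setIntegral isCompact_unitBox measurableSet_unitBox (isOpen_slab B v)
      ?_ ?_
    · exact hF.diff.continuousOn.comp NormalForm.continuous_rotate.continuousOn
        fun p hp => rotate_mem_slab hp.2
    · intro τ _
      refine hF.diff.comp ?_ fun z hz => rotate_mem_slab hz
      unfold rotate
      fun_prop
  qper := fun z _ θ => by
    have : ∀ τ, rotate τ (shift θ z) = rotate τ z := fun τ => rfl
    simp [NormalForm.avg, this]
  nonneg := hF.nonneg
  bound := fun z hz => by
    simpa using norm_avg_le (hF.norm_rotate_le hv hz)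

open Classical in
-- The series on the left does not contain `τ`, so the average is constant along rotations. The
-- auxiliary radius is immaterial.
theorem IsAtom.hasSum_avg (hv : v.Pos) (hF : IsAtom B v k a F) {z : Phase n m}
    (hz : z ∈ slab m B v) : ∃ δ, ∀ τ,
    HasSum (fun p : (Fin m → ℕ) × (Fin m → ℕ) => if Index.IsDiag ((k, p) : Index n m) then
      coeff δ F k p.1 p.2 z.1 z.2.1 z.2.2.1 * monom (k, p) z.2.2.2 else 0)
      (NormalForm.avg F (rotate τ z)) := by
  have hδ := hv.2.2.2.2
  refine ⟨v.δ / 3, fun τ => ?_⟩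
  have hex := (hF.expansion (δ := v.δ / 3) (δ' := v.δ / 2) (by linarith) (by linarith)
    (by linarith) hz.1).2
  have hz' : rotate τ z ∈ slab m B v := rotate_mem_slab hz
  have h1 : ∀ τ', HasSum (fun p : (Fin m → ℕ) × (Fin m → ℕ) =>
      coeff (v.δ / 3) F k p.1 p.2 z.1 z.2.1 z.2.2.1 *
        monom (k, p) (rotate τ' (rotate τ z)).2.2.2) (F (rotate τ' (rotate τ z))) := fun τ' => by
    have h := rotate_mem_slab (τ := τ') hz'
    exact hex _ h.2.1 h.2.2
  have h2 := NormalForm.hasSum_avg (L := fun p => ((k, p) : Index n m)) (by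
    refine (h1 0).summable.norm.congr fun p => ?_
    rw [norm_mul, norm_monom_rotate]) h1
  refine h2.congr_fun fun p => ?_
  split_ifs with hd
  · rw [hd.monom_rotate]
  · rfl

theorem IsAtom.avg_rotate (hv : v.Pos) (hF : IsAtom B v k a F) {z : Phase n m}
    (hz : z ∈ slab m B v) (τ τ' : (Fin n → ℝ) × (Fin m → ℝ)) :
    NormalForm.avg F (rotate τ z) = NormalForm.avg F (rotate τ' z) := by
  obtain ⟨δ, h⟩ := hF.hasSum_avg hv hz
  exact (h τ).unique (h τ')

theorem rotate_zero_sub (z : Phase n m) :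
    rotate 0 z = shift (-z.2.2.2.1) z := by
  simp only [rotate, shift, add_neg_cancel]
  simp
  rfl

theorem IsAtom.avg_rotate_eq (hv : v.Pos) (hF : IsAtom B v k a F) {z : Phase n m}
    (hz : z ∈ slab m B v) (τ : (Fin n → ℝ) × (Fin m → ℝ)) :
    NormalForm.avg F (rotate τ z) = NormalForm.avg F z := by
  rw [hF.avg_rotate hv hz τ 0, rotate_zero_sub, (hF.avg hv.2.2.2.1.le).qper z hz]
  simp

theorem IsAtom.avg_avg (hv : v.Pos) (hF : IsAtom B v k a F) {z : Phase n m}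
    (hz : z ∈ slab m B v) : NormalForm.avg (NormalForm.avg F) z = NormalForm.avg F z :=
  avg_const fun τ => hF.avg_rotate_eq hv hz τ

theorem IsAtom.avg_eq_zero (hv : v.Pos) (hF : IsAtom B v k a F) (hk : k ≠ 0) {z : Phase n m}
    (hz : z ∈ slab m B v) : NormalForm.avg F z = 0 := by
  obtain ⟨δ, h⟩ := hF.hasSum_avg hv hz
  rw [← hF.avg_rotate_eq hv hz 0]
  refine (h 0).unique (hasSum_zero.congr_fun fun p => ?_)
  exact if_neg fun hd => hk hd.1

theorem IsAtom.sub_avg (hv : v.Pos) (hF : IsAtom B v k a F) :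
    IsAtom B v k (2 * a) (fun z => F z - NormalForm.avg F z) ∧
      ∀ z ∈ slab m B v, NormalForm.avg (fun z => F z - NormalForm.avg F z) z = 0 := by
  have hA := hF.avg hv.2.2.2.1.le
  refine ⟨?_, fun z hz => ?_⟩
  -- For `k ≠ 0` the average vanishes and nothing is subtracted; for `k = 0` both terms are modes of
  -- the same index. Thus the difference is always a single mode, at the price of a factor `2`.
  · by_cases hk : k = 0
    · subst hk
      refine ⟨hF.diff.sub hA.diff, fun z hz θ => ?_, by linarith [hF.nonneg], fun z hz => ?_⟩
      · rw [hF.qper z hz, hA.qper z hz, mul_sub]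
      · have h1 := hF.bound z hz
        have h2 := hA.bound z hz
        have := norm_sub_le (F z) (NormalForm.avg F z)
        linarith
    · have h0 := fun z hz => hF.avg_eq_zero hv hk (z := z) hz
      refine ⟨hF.diff.sub hA.diff, fun z hz θ => ?_, by linarith [hF.nonneg], fun z hz => ?_⟩
      · rw [hF.qper z hz, h0 z hz, h0 (shift θ z) hz, sub_zero, sub_zero]
      · rw [h0 z hz, sub_zero]
        have h1 := hF.bound z hz
        have h2 := (norm_nonneg _).trans h1
        linarith
  · have h1 := (hF.continuous_rotate hz).continuousOn.integrableOn_compact (μ := volume)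
      (isCompact_unitBox (n := n) (m := m))
    have h2 := (hA.continuous_rotate hz).continuousOn.integrableOn_compact (μ := volume)
      (isCompact_unitBox (n := n) (m := m))
    have h3 := hF.avg_avg hv hz
    have e : NormalForm.avg (fun z => F z - NormalForm.avg F z) z =
        NormalForm.avg F z - NormalForm.avg (NormalForm.avg F) z := integral_sub h1 h2
    rw [e, h3, sub_self]

/-- Termwise average of a sum of modes. -/
theorem hasSum_avg_of_isAtom {ι : Type} [Countable ι] {k : ι → Fin n → ℤ} {a : ι → ℝ}
    {F : ι → Phase n m → ℂ} (hv : v.Pos) (h1 : ∀ i, IsAtom B v (k i) (a i) (F i))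
    (h2 : Summable a) (h4 : ∀ z ∈ strip m B v, HasSum (fun i => F i z) (g z)) {z : Phase n m}
    (hz : z ∈ slab m B v) : HasSum (fun i => avg (F i) z) (avg g z) := by
  have hn : ∀ i, ∫ τ in unitBox n m, ‖F i (rotate τ z)‖ ≤ a i := fun i => by
    have := norm_avg_le (g := fun z => ((‖F i z‖ : ℝ) : ℂ)) (z := z) (C := a i) fun τ => by
      simpa using (h1 i).norm_rotate_le hv.2.2.2.1.le hz τ
    rw [avg, integral_complex_ofReal, Complex.norm_real] at this
    exact (le_abs_self _).trans this
  have hsum := hasSum_integral_of_summable_integral_norm (μ := volume.restrict (unitBox n m))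
    (F := fun i τ => F i (rotate τ z))
    (fun i => ((h1 i).continuous_rotate hz).continuousOn.integrableOn_compact isCompact_unitBox)
    (Summable.of_nonneg_of_le (fun i => integral_nonneg fun τ => norm_nonneg _) hn h2)
  have e : ∫ τ in unitBox n m, ∑' i, F i (rotate τ z) = avg g z :=
    integral_congr_ae (ae_of_all _ fun τ => (h4 _ (rotate_mem_strip hv.2.2.2.1 hz)).tsum_eq)
  rw [e] at hsum
  exact hsum

/-- `g` is a sum of Fourier modes with zero average, of total weight at most `M`. -/
def ZBd (B : BaseSets n) (v : Width) (M : ℝ) (g : Phase n m → ℂ) : Prop :=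
  ∃ (ι : Type) (_ : Countable ι) (k : ι → Fin n → ℤ) (a : ι → ℝ) (F : ι → Phase n m → ℂ),
    (∀ i, IsAtom B v (k i) (a i) (F i)) ∧ (∀ i, ∀ z ∈ slab m B v, avg (F i) z = 0) ∧
    Summable a ∧ ∑' i, a i ≤ M ∧ ∀ z ∈ strip m B v, HasSum (fun i => F i z) (g z)

theorem ZBd.bd (h : ZBd B v M g) : Bd B v M g := by
  obtain ⟨ι, hι, k, a, F, h1, -, h2, h3, h4⟩ := h
  exact ⟨ι, hι, k, a, F, h1, h2, h3, h4⟩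

theorem ZBd.mono {M' : ℝ} (h : ZBd B v M g) (hM : M ≤ M') : ZBd B v M' g := by
  obtain ⟨ι, hι, k, a, F, h1, h1', h2, h3, h4⟩ := h
  exact ⟨ι, hι, k, a, F, h1, h1', h2, h3.trans hM, h4⟩

theorem ZBd.mono_width (h : ZBd B w M g) (hvw : v.Le w) : ZBd B v M g := by
  obtain ⟨ι, hι, k, a, F, h1, h1', h2, h3, h4⟩ := h
  exact ⟨ι, hι, k, a, F, fun i => (h1 i).mono_width hvw,
    fun i z hz => h1' i z (slab_mono B hvw hz), h2, h3, fun z hz => h4 z (strip_mono B hvw hz)⟩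

theorem ZBd.congr (h : ZBd B v M f) (hfg : ∀ z ∈ strip m B v, g z = f z) : ZBd B v M g := by
  obtain ⟨ι, hι, k, a, F, h1, h1', h2, h3, h4⟩ := h
  exact ⟨ι, hι, k, a, F, h1, h1', h2, h3, fun z hz => by rw [hfg z hz]; exact h4 z hz⟩

theorem ZBd.avg_eq_zero (hv : v.Pos) (h : ZBd B v M g) {z : Phase n m} (hz : z ∈ slab m B v) :
    avg g z = 0 := by
  obtain ⟨ι, hι, k, a, F, h1, h1', h2, h3, h4⟩ := h
  refine (hasSum_avg_of_isAtom hv h1 h2 h4 hz).unique (hasSum_zero.congr_fun fun i => h1' i z hz)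

theorem ZBd.isZeroAverage (hv : v.Pos) (h : ZBd B w M g) (hvw : v.Lt w) :
    IsZeroAverage B v g := by
  have hg := h.bd.isHol hvw
  refine ⟨hg, fun z hz => ?_⟩
  rw [(hg.average_eq_avg hv hz).1]
  exact h.avg_eq_zero (hvw.pos hv) (domain_subset_strip B hvw hz).1

theorem Bd.avg (hv : v.Pos) (h : Bd B v M g) : Bd B v M (avg g) := by
  obtain ⟨ι, hι, k, a, F, h1, h2, h3, h4⟩ := h
  exact ⟨ι, hι, _, a, _, fun i => (h1 i).avg hv.2.2.2.1.le, h2, h3,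
    fun z hz => hasSum_avg_of_isAtom hv h1 h2 h4 hz.1⟩

theorem Bd.avg_avg (hv : v.Pos) (h : Bd B v M g) {z : Phase n m} (hz : z ∈ slab m B v) :
    NormalForm.avg (NormalForm.avg g) z = NormalForm.avg g z := by
  obtain ⟨ι, hι, k, a, F, h1, h2, h3, h4⟩ := h
  have h5 := hasSum_avg_of_isAtom hv h1 h2 h4 hz
  have h6 := hasSum_avg_of_isAtom hv (fun i => (h1 i).avg hv.2.2.2.1.le) h2
    (fun z hz => hasSum_avg_of_isAtom hv h1 h2 h4 hz.1) hz
  exact h6.unique (h5.congr_fun fun i => (h1 i).avg_avg hv hz)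

/-- The subtraction is performed mode by mode, so each summand separately has zero average. The
homological equation is solved modewise and needs this. -/
theorem Bd.zbd_sub_avg (hv : v.Pos) (h : Bd B v M g) :
    ZBd B v (2 * M) (fun z => g z - NormalForm.avg g z) := by
  obtain ⟨ι, hι, k, a, F, h1, h2, h3, h4⟩ := h
  refine ⟨ι, hι, k, _, _, fun i => ((h1 i).sub_avg hv).1, fun i => ((h1 i).sub_avg hv).2,
    h2.mul_left 2, ?_, fun z hz => (h4 z hz).sub (hasSum_avg_of_isAtom hv h1 h2 h4 hz.1)⟩
  rw [tsum_mul_left]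
  linarith

theorem Bd.isNormal_avg (hv : v.Pos) (h : Bd B w M g) (hvw : v.Lt w) :
    IsNormal B v (NormalForm.avg g) := by
  have hw := hvw.pos hv
  have hg := (h.avg hw).isHol hvw
  refine ⟨hg, fun z hz => ?_⟩
  rw [(hg.average_eq_avg hv hz).1]
  exact h.avg_avg hw (domain_subset_strip B hvw hz).1

/-- Keeping only the nonresonant monomials gives total weight at most `‖f̃‖`, without the factor `2`
of `Bd.zbd_sub_avg`. This is how `‖f̃‖` enters the bound for `H₁`. -/
theorem IsHol.zbd_sub_avg (hw : w.Pos) (hg : IsHol B w g) :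
    ZBd B w (norm B w (offAverage w.δ g)).toReal (fun z => g z - avg g z) := by
  classical
  have hfin := ((hg.norm_offAverage_le hw).trans_lt (hg.norm_lt_top hw)).ne
  rw [norm_eq] at hfin ⊢
  obtain ⟨C, s', δ', hC, hs, hδ, hexp⟩ := hg.expansion hw
  set A : Index n m → ℝ≥0∞ := fun K => coeffSup B w (offAverage w.δ g) K *
    ENNReal.ofReal (Real.exp (w.s * ∑ i, |(K.1 i : ℝ)|) * w.δ ^ K.deg) with hA
  have hAfin : ∀ K, A K ≠ ⊤ := ENNReal.ne_top_of_tsum_ne_top hfin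
  set S := {K : Index n m // ¬K.IsDiag}
  have hatom : ∀ K : S, IsAtom B w K.1.1 (A K.1).toReal (fun z : Phase n m =>
      coeff w.δ g K.1.1 K.1.2.1 K.1.2.2 z.1 z.2.1 z.2.2.1 * monom K.1 z.2.2.2) := fun K => by
    refine isAtom_mono_term hw hg K.1 ENNReal.toReal_nonneg ?_
    rw [ENNReal.ofReal_toReal (hAfin _), hA]
    simp only [hg.coeffSup_offAverage hw, if_neg K.2]
    exact le_rfl
  refine ⟨S, inferInstance, fun K => K.1.1, fun K => (A K.1).toReal, fun K z =>
    coeff w.δ g K.1.1 K.1.2.1 K.1.2.2 z.1 z.2.1 z.2.2.1 * monom K.1 z.2.2.2, hatom, ?_, ?_, ?_, ?_⟩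
  · intro K z hz
    have h1 := hasSum_avg (β := Unit) (L := fun _ => K.1) (z := z)
      (c := fun _ => coeff w.δ g K.1.1 K.1.2.1 K.1.2.2 z.1 z.2.1 z.2.2.1)
      (g := fun z => coeff w.δ g K.1.1 K.1.2.1 K.1.2.2 z.1 z.2.1 z.2.2.1 * monom K.1 z.2.2.2)
      (hasSum_fintype _).summable (fun τ => by
        have := hasSum_unique (fun _ : Unit =>
          coeff w.δ g K.1.1 K.1.2.1 K.1.2.2 z.1 z.2.1 z.2.2.1 * monom K.1 (rotate τ z).2.2.2)
        exact this)
    simp only [if_neg K.2] at h1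
    exact h1.unique hasSum_zero
  · exact (ENNReal.summable_toReal hfin).subtype _
  · rw [ENNReal.tsum_toReal_eq hAfin]
    exact (ENNReal.summable_toReal hfin).tsum_subtype_le _ _ (fun _ => ENNReal.toReal_nonneg)
  · intro z hz
    have hzd := strip_subset_domain B w hz
    have h1 := (hexp (z.1, z.2.1, z.2.2.1) ⟨hzd.1, hzd.2.1, hzd.2.2.1⟩).2 z.2.2.2
      hzd.2.2.2.1 hzd.2.2.2.2.1 hzd.2.2.2.2.2
    have h2 := h1.sub (hg.average_eq_avg hw hzd).2
    have hinj : Function.Injective (Subtype.val : S → Index n m) := Subtype.val_injective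
    rw [← hinj.hasSum_iff] at h2
    · refine h2.congr_fun fun K => ?_
      simp [if_neg K.2]
    · intro K hK
      have hd : K.IsDiag := by
        by_contra hd
        exact hK ⟨⟨K, hd⟩, rfl⟩
      simp [if_pos hd]

end ModeAverage

end AverageTheory

/-! ### Frequencies and the unperturbed flow -/

section Frequencies

variable {n m : ℕ} {B : BaseSets n} {v w u : Width}

theorem toActions_mem_actionDomain (hvu : v.Le u) {z : Phase n m} (hz : z ∈ slab m B v) :
    toActions z ∈ actionDomain m B u := by
  have h := slab_mono B hvu hz
  refine ⟨h.1.1, h.1.2.1, fun l => ?_⟩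
  have h1 := (h.2.1 l).le
  have h2 := (h.2.2 l).le
  simp only [toActions, norm_mul, sq]
  exact mul_le_mul h1 h2 (norm_nonneg _) ((norm_nonneg _).trans h1)

theorem toActions_rotate (τ : (Fin n → ℝ) × (Fin m → ℝ)) (z : Phase n m) :
    toActions (rotate τ z) = toActions z := by
  simp only [toActions, rotate, Prod.mk.injEq, true_and]
  funext l
  rw [mul_mul_mul_comm, ← Complex.exp_add, add_neg_cancel, Complex.exp_zero, one_mul]

theorem toActions_shift (θ : Fin n → ℂ) (z : Phase n m) : toActions (shift θ z) = toActions z := rfl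

/-- The unperturbed Hamiltonian is holomorphic on a neighbourhood of the domain of the actions. -/
theorem IsHol.exists_isOpen_actions (hu : u.Pos) {H₀ : Actions n m → ℂ}
    (hH : IsHol B u fun z : Phase n m => H₀ (toActions z)) :
    ∃ A : Set (Actions n m), IsOpen A ∧ actionDomain m B u ⊆ A ∧ DifferentiableOn ℂ H₀ A := by
  obtain ⟨v, huv, hd, -⟩ := hH
  have hv := huv.pos hu
  have hδ : (v.δ : ℂ) ≠ 0 := by exact_mod_cast hv.2.2.2.2.ne'
  refine ⟨nbhd B.setR v.r ×ˢ nbhdVec B.setI v.ρ ×ˢ {J | ∀ l, ‖J l‖ < v.δ ^ 2}, ?_, ?_, ?_⟩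
  · refine (isOpen_nbhd _ _).prod ((isOpen_nbhdVec _ _).prod ?_)
    simp only [Set.ofPred_forall]
    exact isOpen_iInter_of_finite fun l => isOpen_lt (by fun_prop) continuous_const
  · intro y hy
    exact ⟨nbhd_mono _ huv.1.le hy.1, nbhdVec_mono _ huv.2.1.le hy.2.1, fun l =>
      (hy.2.2 l).trans_lt (pow_lt_pow_left₀ huv.2.2.2.2 hu.2.2.2.2.le two_ne_zero)⟩
  -- `H₀` is recovered from its composition with the actions through the section `x = 0`, `φ = 0`,
  -- `p = J/v.δ`, `q = v.δ`, which stays in the domain when `|J_l| < v.δ²`.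
  · have hmap : Set.MapsTo (fun y : Actions n m => ((y.1, y.2.1, ((0 : ℝ) : ℂ), 0,
        fun l => y.2.2 l / v.δ, fun _ => (v.δ : ℂ)) : Phase n m))
        (nbhd B.setR v.r ×ˢ nbhdVec B.setI v.ρ ×ˢ {J | ∀ l, ‖J l‖ < v.δ ^ 2})
        (domain m B v) := by
      intro y hy
      refine ⟨hy.1, hy.2.1, mem_nbhd_of_mem hv.2.2.1 B.zero_mem_X, fun i => ?_, fun l => ?_,
        fun l => ?_⟩
      · simpa using hv.2.2.2.1.le
      · have h1 : ‖y.2.2 l‖ < v.δ ^ 2 := hy.2.2 l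
        simp only [norm_div, Complex.norm_real, Real.norm_of_nonneg hv.2.2.2.2.le]
        rw [div_le_iff₀ hv.2.2.2.2, ← sq]
        exact h1.le
      · simp only [Complex.norm_real, Real.norm_of_nonneg hv.2.2.2.2.le]
        exact le_rfl
    have h2 := hd.comp (by fun_prop) hmap
    refine h2.congr fun y _ => ?_
    show H₀ y = H₀ _
    congr 1
    exact Prod.ext rfl (Prod.ext rfl (funext fun l => by simp only [toActions]; field_simp))

variable {H₀ : Actions n m → ℂ}

/-- The ratios `ω_I / ω_r`. -/
def freqI (H₀ : Actions n m → ℂ) (z : Phase n m) (i : Fin n) : ℂ :=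
  omegaI H₀ i (toActions z) / omegaR H₀ (toActions z)

/-- The ratios `ω_J / ω_r`. -/
def freqJ (H₀ : Actions n m → ℂ) (z : Phase n m) (l : Fin m) : ℂ :=
  omegaJ H₀ l (toActions z) / omegaR H₀ (toActions z)

/-- The vector field `∂_x + (ω_I / ω_r) ∂_φ + (ω_J / ω_r) (q ∂_q - p ∂_p)`. -/
def field (H₀ : Actions n m → ℂ) (z : Phase n m) : Phase n m :=
  (0, 0, 1, freqI H₀ z, fun l => -(freqJ H₀ z l * z.2.2.2.2.1 l),
    fun l => freqJ H₀ z l * z.2.2.2.2.2 l)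

/-- The flow of `field`. -/
def flow (H₀ : Actions n m → ℂ) (σ : ℂ) (z : Phase n m) : Phase n m :=
  (z.1, z.2.1, z.2.2.1 + σ, fun i => z.2.2.2.1 i + σ * freqI H₀ z i,
    fun l => z.2.2.2.2.1 l * Complex.exp (-(σ * freqJ H₀ z l)),
    fun l => z.2.2.2.2.2 l * Complex.exp (σ * freqJ H₀ z l))

theorem toActions_flow (σ : ℂ) (z : Phase n m) : toActions (flow H₀ σ z) = toActions z := by
  simp only [toActions, flow, Prod.mk.injEq, true_and]
  funext l
  rw [mul_mul_mul_comm, ← Complex.exp_add, neg_add_cancel, Complex.exp_zero, mul_one]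

theorem freqI_flow (σ : ℂ) (z : Phase n m) : freqI H₀ (flow H₀ σ z) = freqI H₀ z := by
  funext i; simp only [freqI, toActions_flow]

theorem freqJ_flow (σ : ℂ) (z : Phase n m) : freqJ H₀ (flow H₀ σ z) = freqJ H₀ z := by
  funext i; simp only [freqJ, toActions_flow]

theorem flow_flow (σ σ' : ℂ) (z : Phase n m) :
    flow H₀ σ (flow H₀ σ' z) = flow H₀ (σ + σ') z := by
  rw [flow, freqI_flow, freqJ_flow]
  simp only [flow, Prod.mk.injEq, true_and]
  refine ⟨by ring, ?_, ?_, ?_⟩ <;> funext i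
  · ring
  · rw [mul_assoc, ← Complex.exp_add]; ring_nf
  · rw [mul_assoc, ← Complex.exp_add]; ring_nf

theorem flow_zero (z : Phase n m) : flow H₀ 0 z = z := by
  simp [flow]

theorem hasDerivAt_flow (z : Phase n m) : HasDerivAt (fun σ => flow H₀ σ z) (field H₀ z) 0 := by
  unfold flow field
  refine (hasDerivAt_const _ _).prodMk ((hasDerivAt_const _ _).prodMk
    (HasDerivAt.prodMk ?_ (HasDerivAt.prodMk ?_ (HasDerivAt.prodMk ?_ ?_))))
  · simpa using (hasDerivAt_id (0 : ℂ)).const_add z.2.2.1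
  · refine hasDerivAt_pi.2 fun i => ?_
    simpa using ((hasDerivAt_id (0 : ℂ)).mul_const (freqI H₀ z i)).const_add (z.2.2.2.1 i)
  · refine hasDerivAt_pi.2 fun l => ?_
    have := (((hasDerivAt_id (0 : ℂ)).mul_const (freqJ H₀ z l)).neg.cexp).const_mul (z.2.2.2.2.1 l)
    simpa [mul_comm] using this
  · refine hasDerivAt_pi.2 fun l => ?_
    have := (((hasDerivAt_id (0 : ℂ)).mul_const (freqJ H₀ z l)).cexp).const_mul (z.2.2.2.2.2 l)
    simpa [mul_comm] using this

/-- A rotation forgets the angles, so the two orders differ by the drift of the angles, which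
depends on the conserved actions only. -/
theorem flow_rotate (σ : ℂ) (τ : (Fin n → ℝ) × (Fin m → ℝ)) (z : Phase n m) :
    flow H₀ σ (rotate τ z) = shift (fun i => σ * freqI H₀ z i) (rotate τ (flow H₀ σ z)) := by
  have h1 : freqI H₀ (rotate τ z) = freqI H₀ z := by
    funext i; simp only [freqI, toActions_rotate]
  have h2 : freqJ H₀ (rotate τ z) = freqJ H₀ z := by
    funext i; simp only [freqJ, toActions_rotate]
  rw [flow, h1, h2]
  simp only [rotate, flow, shift, Prod.mk.injEq, true_and]
  refine ⟨rfl, ?_, ?_⟩ <;> funext l <;> ring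

theorem flow_shift (σ : ℂ) (θ : Fin n → ℂ) (z : Phase n m) :
    flow H₀ σ (shift θ z) = shift θ (flow H₀ σ z) := by
  have h1 : freqI H₀ (shift θ z) = freqI H₀ z := rfl
  have h2 : freqJ H₀ (shift θ z) = freqJ H₀ z := rfl
  rw [flow, h1, h2]
  simp only [flow, shift, Prod.mk.injEq, true_and, and_true]
  funext i
  simp only [Pi.add_apply]
  ring

/-- Bounds for the frequencies on the domain of the actions. -/
structure FreqBound (B : BaseSets n) (u : Width) (H₀ : Actions n m → ℂ) (X W μ : ℝ) : Prop where
  pos : u.Pos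
  hol : IsHol B u fun z : Phase n m => H₀ (toActions z)
  ne : ∀ y ∈ actionDomain m B u, omegaR H₀ y ≠ 0
  norm_x : ∀ x ∈ nbhd B.setX u.ξ, ‖x‖ ≤ X
  norm_inv : ∀ y ∈ actionDomain m B u, ‖(omegaR H₀ y)⁻¹‖ ≤ W
  -- For complex times of modulus at most `X` the angles drift by at most `μ s` and `log |p|`, `log
  -- |q|` by at most `μ`: `μ` is the relative loss of width in one homological equation.
  normI : ∀ y ∈ actionDomain m B u, ∀ i, X * ‖omegaI H₀ i y / omegaR H₀ y‖ ≤ μ * u.s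
  normJ : ∀ y ∈ actionDomain m B u, ∀ l, X * ‖omegaJ H₀ l y / omegaR H₀ y‖ ≤ μ

variable {X W μ : ℝ}

theorem FreqBound.differentiableOn (h : FreqBound B u H₀ X W μ) (e : Actions n m) :
    DifferentiableOn ℂ (fun z : Phase n m => fderiv ℂ H₀ (toActions z) e) (slab m B u) := by
  obtain ⟨A, hA, hsub, hd⟩ := h.hol.exists_isOpen_actions h.pos
  refine (differentiableOn_fderiv_apply hA hd e).comp ?_ fun z hz =>
    hsub (toActions_mem_actionDomain ⟨le_rfl, le_rfl, le_rfl, le_rfl, le_rfl⟩ hz)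
  unfold toActions
  fun_prop

theorem FreqBound.differentiableOn_inv (h : FreqBound B u H₀ X W μ) :
    DifferentiableOn ℂ (fun z : Phase n m => (omegaR H₀ (toActions z))⁻¹) (slab m B u) :=
  (h.differentiableOn _).inv fun _ hz =>
    h.ne _ (toActions_mem_actionDomain ⟨le_rfl, le_rfl, le_rfl, le_rfl, le_rfl⟩ hz)

theorem FreqBound.differentiableOn_freqI (h : FreqBound B u H₀ X W μ) (i : Fin n) :
    DifferentiableOn ℂ (fun z : Phase n m => freqI H₀ z i) (slab m B u) := by
  simp only [freqI, div_eq_mul_inv]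
  exact (h.differentiableOn _).mul h.differentiableOn_inv

theorem FreqBound.differentiableOn_freqJ (h : FreqBound B u H₀ X W μ) (l : Fin m) :
    DifferentiableOn ℂ (fun z : Phase n m => freqJ H₀ z l) (slab m B u) := by
  simp only [freqJ, div_eq_mul_inv]
  exact (h.differentiableOn _).mul h.differentiableOn_inv

theorem FreqBound.differentiableOn_flow (h : FreqBound B u H₀ X W μ) :
    DifferentiableOn ℂ (fun p : ℂ × Phase n m => flow H₀ p.1 p.2) (Set.univ ×ˢ slab m B u) := by
  have hI : ∀ i, DifferentiableOn ℂ (fun p : ℂ × Phase n m => freqI H₀ p.2 i)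
      (Set.univ ×ˢ slab m B u) := fun i =>
    (h.differentiableOn_freqI i).comp (by fun_prop) fun p hp => hp.2
  have hJ : ∀ l, DifferentiableOn ℂ (fun p : ℂ × Phase n m => freqJ H₀ p.2 l)
      (Set.univ ×ˢ slab m B u) := fun l =>
    (h.differentiableOn_freqJ l).comp (by fun_prop) fun p hp => hp.2
  have h1 : DifferentiableOn ℂ (fun p : ℂ × Phase n m => p.1) (Set.univ ×ˢ slab m B u) := by
    fun_prop
  unfold flow
  refine DifferentiableOn.prodMk (by fun_prop) (DifferentiableOn.prodMk (by fun_prop)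
    (DifferentiableOn.prodMk (by fun_prop) (DifferentiableOn.prodMk ?_
    (DifferentiableOn.prodMk ?_ ?_))))
  · exact differentiableOn_pi.2 fun i => DifferentiableOn.add (by fun_prop) (h1.mul (hI i))
  · exact differentiableOn_pi.2 fun l => DifferentiableOn.mul (by fun_prop) (h1.mul (hJ l)).neg.cexp
  · exact differentiableOn_pi.2 fun l => DifferentiableOn.mul (by fun_prop) (h1.mul (hJ l)).cexp

/-- `Ξ` is an interval containing `0`, so its complex neighbourhoods are star-shaped about `0`; the
integration path from `0` to `x` stays inside. -/
theorem mul_mem_nbhd (B : BaseSets n) {θ : ℝ} {x : ℂ} (hx : x ∈ nbhd B.setX θ) {t : ℝ}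
    (ht : t ∈ Set.Icc (0 : ℝ) 1) : (t : ℂ) * x ∈ nbhd B.setX θ := by
  obtain ⟨a, ha, hxa⟩ := hx
  refine ⟨t * a, ?_, ?_⟩
  · have := B.isConnected_X.isPreconnected.ordConnected.out B.zero_mem_X ha
    have h' := B.isConnected_X.isPreconnected.ordConnected.out ha B.zero_mem_X
    rcases le_total 0 a with h | h
    · exact this ⟨mul_nonneg ht.1 h, mul_le_of_le_one_left h ht.2⟩
    · exact h' ⟨by nlinarith [ht.2], by nlinarith [ht.1]⟩
  · have e : (t : ℂ) * x - ((t * a : ℝ) : ℂ) = t * (x - a) := by push_cast; ring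
    rw [e, norm_mul, Complex.norm_real, Real.norm_of_nonneg ht.1]
    exact (mul_le_of_le_one_left (norm_nonneg _) ht.2).trans_lt hxa

/-- Since `τ ≤ 1`, `τ - μ ≤ τ (1 - μ) ≤ τ e^{-μ}`: shrinking `p`, `q` from `τ δ` to `(τ - μ) δ`
compensates a stretching by `e^μ`. -/
theorem exp_mul_sub_le {τ b : ℝ} (hτ1 : τ ≤ 1) (hμ : 0 ≤ μ) (hμτ : μ ≤ τ) (hb : b ≤ μ) :
    Real.exp b * (τ - μ) ≤ τ := by
  have h1 : Real.exp b ≤ Real.exp μ := Real.exp_le_exp.2 hb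
  have h2 : 1 - μ ≤ Real.exp (-μ) := by have := Real.add_one_le_exp (-μ); linarith
  have h3 : τ - μ ≤ τ * Real.exp (-μ) := by nlinarith
  calc Real.exp b * (τ - μ) ≤ Real.exp μ * (τ * Real.exp (-μ)) := by gcongr
    _ = τ * (Real.exp μ * Real.exp (-μ)) := by ring
    _ = τ := by rw [← Real.exp_add]; simp

theorem FreqBound.norm_mul_freqJ_le (h : FreqBound B u H₀ X W μ) (hvu : v.Le u) {z : Phase n m}
    (hz : z ∈ slab m B v) {σ : ℂ} (hσ : ‖σ‖ ≤ X) (l : Fin m) : ‖σ * freqJ H₀ z l‖ ≤ μ := by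
  rw [norm_mul]
  refine le_trans ?_ (h.normJ _ (toActions_mem_actionDomain hvu hz) l)
  exact mul_le_mul_of_nonneg_right hσ (norm_nonneg _)

theorem FreqBound.norm_mul_freqI_le (h : FreqBound B u H₀ X W μ) (hvu : v.Le u) {z : Phase n m}
    (hz : z ∈ slab m B v) {σ : ℂ} (hσ : ‖σ‖ ≤ X) (i : Fin n) : ‖σ * freqI H₀ z i‖ ≤ μ * u.s := by
  rw [norm_mul]
  refine le_trans ?_ (h.normI _ (toActions_mem_actionDomain hvu hz) i)
  exact mul_le_mul_of_nonneg_right hσ (norm_nonneg _)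

theorem norm_mul_exp_lt_of_re {δ τ : ℝ} {p c : ℂ} (hδ : 0 < δ) (hτ1 : τ ≤ 1) (hμ : 0 ≤ μ)
    (hμτ : μ < τ) (hp : ‖p‖ < (τ - μ) * δ) (hc : ‖c‖ ≤ μ) : ‖p * Complex.exp c‖ < τ * δ := by
  rw [norm_mul, Complex.norm_exp]
  have h1 := exp_mul_sub_le hτ1 hμ hμτ.le ((Complex.re_le_norm c).trans hc)
  calc ‖p‖ * Real.exp c.re < (τ - μ) * δ * Real.exp c.re := by gcongr
    _ = Real.exp c.re * (τ - μ) * δ := by ring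
    _ ≤ τ * δ := by gcongr

theorem FreqBound.flow_mem_slab (h : FreqBound B u H₀ X W μ) {τ : ℝ} (hμ : 0 ≤ μ) (hμτ : μ < τ)
    (hτ1 : τ ≤ 1) {z : Phase n m} (hz : z ∈ slab m B (u.scale (τ - μ))) {σ : ℂ}
    (hσ : ‖σ‖ ≤ X) (hx : z.2.2.1 + σ ∈ nbhd B.setX (u.scale τ).ξ) :
    flow H₀ σ z ∈ slab m B (u.scale τ) := by
  have hle : (u.scale (τ - μ)).Le u := by
    have := Width.scale_le h.pos (show τ - μ ≤ 1 by linarith)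
    rwa [Width.scale_one] at this
  have hz' := slab_mono B (Width.scale_le h.pos (show τ - μ ≤ τ by linarith)) hz
  refine ⟨⟨hz'.1.1, hz'.1.2.1, hx⟩, fun l => ?_, fun l => ?_⟩
  · refine norm_mul_exp_lt_of_re h.pos.2.2.2.2 hτ1 hμ hμτ (hz.2.1 l) ?_
    rw [norm_neg]
    exact h.norm_mul_freqJ_le hle hz hσ l
  · exact norm_mul_exp_lt_of_re h.pos.2.2.2.2 hτ1 hμ hμτ (hz.2.2 l)
      (h.norm_mul_freqJ_le hle hz hσ l)

end Frequencies

/-! ### The homological equation -/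

section HomologicalTheory

variable {n m : ℕ} {B : BaseSets n} {v w u : Width} {H₀ : Actions n m → ℂ} {X W μ : ℝ}

/-! ### The bracket with the unperturbed Hamiltonian -/

section BracketWithH

theorem FreqBound.differentiableAt_actions (h : FreqBound B u H₀ X W μ) {z : Phase n m}
    (hz : z ∈ slab m B u) : DifferentiableAt ℂ H₀ (toActions z) := by
  obtain ⟨A, hA, hsub, hd⟩ := h.hol.exists_isOpen_actions h.pos
  exact (hd.differentiableAt (hA.mem_nhds
    (hsub (toActions_mem_actionDomain ⟨le_rfl, le_rfl, le_rfl, le_rfl, le_rfl⟩ hz))))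

theorem differentiable_toActions : Differentiable ℂ (toActions : Phase n m → Actions n m) := by
  unfold toActions; fun_prop

/-- Along each coordinate direction of phase space the actions move on a straight line, `J_l` being
linear in `p_l` and in `q_l` separately; comparing line derivatives avoids differentiating the map
to the actions. -/
theorem FreqBound.fderiv_eq (h : FreqBound B u H₀ X W μ) {z e : Phase n m}
    (hz : z ∈ slab m B u) {d : Actions n m}
    (hd : ∀ ζ : ℂ, toActions (z + ζ • e) = toActions z + ζ • d) :
    fderiv ℂ (fun z : Phase n m => H₀ (toActions z)) z e = fderiv ℂ H₀ (toActions z) d := by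
  have h1 := h.differentiableAt_actions hz
  have h2 : DifferentiableAt ℂ (fun z : Phase n m => H₀ (toActions z)) z :=
    h1.comp z differentiable_toActions.differentiableAt
  have e1 := h2.hasFDerivAt.hasLineDerivAt e
  have e2 := h1.hasFDerivAt.hasLineDerivAt d
  rw [HasLineDerivAt] at e1 e2
  simp only [hd] at e1
  exact e1.unique e2

theorem map_eq_sum_single {d : ℕ} (L : Phase n m →L[ℂ] ℂ) (ι : (Fin d → ℂ) →ₗ[ℂ] Phase n m)
    (θ : Fin d → ℂ) : L (ι θ) = ∑ i, θ i * L (ι (Pi.single i 1)) := by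
  conv_lhs => rw [pi_eq_sum_univ' θ]
  simp only [map_sum, map_smul, smul_eq_mul]

theorem map_angles (L : Phase n m →L[ℂ] ℂ) (θ : Fin n → ℂ) :
    L ((0, 0, 0, θ, 0, 0) : Phase n m) =
      ∑ i, θ i * L ((0, 0, 0, Pi.single i 1, 0, 0) : Phase n m) :=
  map_eq_sum_single L
    { toFun := fun θ => (0, 0, 0, θ, 0, 0), map_add' := by simp, map_smul' := by simp } θ

theorem map_p (L : Phase n m →L[ℂ] ℂ) (θ : Fin m → ℂ) :
    L ((0, 0, 0, 0, θ, 0) : Phase n m) =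
      ∑ i, θ i * L ((0, 0, 0, 0, Pi.single i 1, 0) : Phase n m) :=
  map_eq_sum_single L
    { toFun := fun θ => (0, 0, 0, 0, θ, 0), map_add' := by simp, map_smul' := by simp } θ

theorem map_q (L : Phase n m →L[ℂ] ℂ) (θ : Fin m → ℂ) :
    L ((0, 0, 0, 0, 0, θ) : Phase n m) =
      ∑ i, θ i * L ((0, 0, 0, 0, 0, Pi.single i 1) : Phase n m) :=
  map_eq_sum_single L
    { toFun := fun θ => (0, 0, 0, 0, 0, θ), map_add' := by simp, map_smul' := by simp } θ

/-- The bracket with the unperturbed Hamiltonian is a derivative along `field`. -/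
theorem FreqBound.poisson_eq (h : FreqBound B u H₀ X W μ) (G : Phase n m → ℂ) {z : Phase n m}
    (hz : z ∈ slab m B u) : poisson G (fun z => H₀ (toActions z)) z =
      -(omegaR H₀ (toActions z) * fderiv ℂ G z (field H₀ z)) := by
  have hne : omegaR H₀ (toActions z) ≠ 0 :=
    h.ne _ (toActions_mem_actionDomain ⟨le_rfl, le_rfl, le_rfl, le_rfl, le_rfl⟩ hz)
  set H := fun z : Phase n m => H₀ (toActions z) with hH
  have dR : fderiv ℂ H z (1, 0, 0, 0, 0, 0) = omegaR H₀ (toActions z) :=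
    h.fderiv_eq hz fun ζ => by simp [toActions]
  have dX : fderiv ℂ H z (0, 0, 1, 0, 0, 0) = 0 := by
    rw [hH, h.fderiv_eq hz (d := 0) fun ζ => by simp [toActions], map_zero]
  have dI : ∀ i, fderiv ℂ H z (0, Pi.single i 1, 0, 0, 0, 0) = omegaI H₀ i (toActions z) :=
    fun i => h.fderiv_eq hz fun ζ => by simp [toActions]
  have dA : ∀ i, fderiv ℂ H z (0, 0, 0, Pi.single i 1, 0, 0) = 0 := fun i => by
    rw [hH, h.fderiv_eq hz (d := 0) fun ζ => by simp [toActions], map_zero]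
  have dP : ∀ l, fderiv ℂ H z (0, 0, 0, 0, Pi.single l 1, 0) =
      z.2.2.2.2.2 l * omegaJ H₀ l (toActions z) := fun l => by
    rw [omegaJ, ← smul_eq_mul, ← map_smul]
    refine h.fderiv_eq hz fun ζ => ?_
    refine Prod.ext (by simp [toActions]) (Prod.ext (by simp [toActions]) (funext fun j => ?_))
    by_cases hj : j = l
    · subst hj; simp [toActions]; ring
    · simp [toActions, hj]
  have dQ : ∀ l, fderiv ℂ H z (0, 0, 0, 0, 0, Pi.single l 1) =
      z.2.2.2.2.1 l * omegaJ H₀ l (toActions z) := fun l => by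
    rw [omegaJ, ← smul_eq_mul, ← map_smul]
    refine h.fderiv_eq hz fun ζ => ?_
    refine Prod.ext (by simp [toActions]) (Prod.ext (by simp [toActions]) (funext fun j => ?_))
    by_cases hj : j = l
    · subst hj; simp [toActions]; ring
    · simp [toActions, hj]
  have hfield : field H₀ z = (0, 0, 1, 0, 0, 0) + (0, 0, 0, freqI H₀ z, 0, 0) +
      (0, 0, 0, 0, (fun l => -(freqJ H₀ z l * z.2.2.2.2.1 l)), 0) +
      (0, 0, 0, 0, 0, fun l => freqJ H₀ z l * z.2.2.2.2.2 l) := by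
    simp [field]
  rw [poisson_def, hfield, map_add, map_add, map_add, map_angles, map_p, map_q, dR, dX]
  simp only [dI, dA, dP, dQ, freqI, freqJ, mul_zero, zero_sub, mul_add, neg_add, Finset.mul_sum,
    ← Finset.sum_neg_distrib]
  rw [add_assoc (-_ + _), ← Finset.sum_add_distrib]
  congr 1
  · congr 1
    refine Finset.sum_congr rfl fun i _ => ?_
    field_simp
  · refine Finset.sum_congr rfl fun l _ => ?_
    field_simp
    ring

end BracketWithH

/-! ### Solving the homological equation along the flow -/

section Primitive

variable {k : Fin n → ℤ} {a M τ : ℝ} {F f : Phase n m → ℂ}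

/-- The solution of the homological equation for one mode, vanishing at `x = 0`. -/
def modePrimitive (H₀ : Actions n m → ℂ) (F : Phase n m → ℂ) : Phase n m → ℂ := fun z =>
  z.2.2.1 * (omegaR H₀ (toActions z))⁻¹ *
    ∫ t in Set.Icc (0 : ℝ) 1, F (flow H₀ (((t : ℂ) - 1) * z.2.2.1) z)

theorem FreqBound.nonneg_X (h : FreqBound B u H₀ X W μ) : 0 ≤ X :=
  (norm_nonneg _).trans (h.norm_x _ (mem_nbhd_of_mem h.pos.2.2.1 B.zero_mem_X))

theorem FreqBound.nonneg_W (h : FreqBound B u H₀ X W μ) : 0 ≤ W := by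
  obtain ⟨y, hy⟩ := slowDomain_nonempty B h.pos
  exact (norm_nonneg _).trans (h.norm_inv (y.1, y.2.1, 0) ⟨hy.1, hy.2.1, fun l => by
    simpa using sq_nonneg _⟩)

theorem FreqBound.scale_le (h : FreqBound B u H₀ X W μ) (hτ1 : τ ≤ 1) : (u.scale τ).Le u := by
  have := Width.scale_le h.pos hτ1
  rwa [Width.scale_one] at this

theorem FreqBound.norm_sub_one_mul_le (h : FreqBound B u H₀ X W μ) (hτ1 : τ ≤ 1) {t : ℝ}
    (ht : t ∈ Set.Icc (0 : ℝ) 1) {x : ℂ} (hx : x ∈ nbhd B.setX (u.scale τ).ξ) :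
    ‖((t : ℂ) - 1) * x‖ ≤ X := by
  have h1 := h.norm_x x (nbhd_mono _ (h.scale_le hτ1).2.2.1 hx)
  have h2 : ‖(t : ℂ) - 1‖ ≤ 1 := by
    rw [← Complex.ofReal_one, ← Complex.ofReal_sub, Complex.norm_real, Real.norm_eq_abs, abs_le]
    exact ⟨by linarith [ht.1], by linarith [ht.2]⟩
  rw [norm_mul]
  exact (mul_le_of_le_one_left (norm_nonneg _) h2).trans h1

theorem FreqBound.flow_segment_mem (h : FreqBound B u H₀ X W μ) (hμ : 0 ≤ μ) (hμτ : μ < τ)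
    (hτ1 : τ ≤ 1) {z : Phase n m} (hz : z ∈ slab m B (u.scale (τ - μ))) {t : ℝ}
    (ht : t ∈ Set.Icc (0 : ℝ) 1) :
    flow H₀ (((t : ℂ) - 1) * z.2.2.1) z ∈ slab m B (u.scale τ) := by
  have hz' := slab_mono B (Width.scale_le h.pos (show τ - μ ≤ τ by linarith)) hz
  refine h.flow_mem_slab hμ hμτ hτ1 hz (h.norm_sub_one_mul_le hτ1 ht hz'.1.2.2) ?_
  have e : z.2.2.1 + ((t : ℂ) - 1) * z.2.2.1 = t * z.2.2.1 := by ring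
  rw [e]
  exact mul_mem_nbhd B hz'.1.2.2 ht

theorem FreqBound.continuousOn_integrand (h : FreqBound B u H₀ X W μ) (hμ : 0 ≤ μ) (hμτ : μ < τ)
    (hτ1 : τ ≤ 1) (hF : IsAtom B (u.scale τ) k a F) :
    ContinuousOn (fun p : ℝ × Phase n m => F (flow H₀ (((p.1 : ℂ) - 1) * p.2.2.2.1) p.2))
      (Set.Icc (0 : ℝ) 1 ×ˢ slab m B (u.scale (τ - μ))) := by
  refine hF.diff.continuousOn.comp ?_ fun p hp => h.flow_segment_mem hμ hμτ hτ1 hp.2 hp.1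
  refine h.differentiableOn_flow.continuousOn.comp
    (f := fun p : ℝ × Phase n m => (((p.1 : ℂ) - 1) * p.2.2.2.1, p.2)) (by fun_prop) fun p hp => ?_
  exact ⟨trivial, slab_mono B (h.scale_le (by linarith)) hp.2⟩

theorem norm_setIntegral_Icc_le {g : ℝ → ℂ} {C : ℝ} (hg : ∀ t ∈ Set.Icc (0 : ℝ) 1, ‖g t‖ ≤ C) :
    ‖∫ t in Set.Icc (0 : ℝ) 1, g t‖ ≤ C := by
  refine (norm_setIntegral_le_of_norm_le_const (by simp) hg).trans_eq ?_
  simp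

/-- The Fourier index survives because the flow commutes with translations of the angles. The drift
of `Im φ` costs at most `e^{μ s |k|}`, which is the gain from narrowing the strip from `τ s` to `(τ
- μ) s`; the prefactor `x/ω_r` costs `X W`. -/
theorem IsAtom.modePrimitive (h : FreqBound B u H₀ X W μ) (hμ : 0 ≤ μ) (hμτ : μ < τ)
    (hτ1 : τ ≤ 1) (hF : IsAtom B (u.scale τ) k a F) :
    IsAtom B (u.scale (τ - μ)) k (X * W * a) (modePrimitive H₀ F) where
  diff := by
    refine DifferentiableOn.mul (DifferentiableOn.mul (by fun_prop)
      (h.differentiableOn_inv.mono (slab_mono B (h.scale_le (by linarith))))) ?_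
    refine differentiableOn_setIntegral isCompact_Icc measurableSet_Icc (isOpen_slab B _)
      (h.continuousOn_integrand hμ hμτ hτ1 hF) fun t ht => ?_
    refine hF.diff.comp ?_ fun z hz => h.flow_segment_mem hμ hμτ hτ1 hz ht
    refine h.differentiableOn_flow.comp
      (f := fun z : Phase n m => (((t : ℂ) - 1) * z.2.2.1, z)) (by fun_prop) fun z hz => ?_
    exact ⟨trivial, slab_mono B (h.scale_le (by linarith)) hz⟩
  qper := fun z hz θ => by
    simp only [NormalForm.modePrimitive, toActions_shift, flow_shift]
    have : ∫ t in Set.Icc (0 : ℝ) 1, F (shift θ (flow H₀ (((t : ℂ) - 1) * (shift θ z).2.2.1) z)) =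
        ∫ t in Set.Icc (0 : ℝ) 1, Complex.exp (Complex.I * ∑ i, k i * θ i) *
          F (flow H₀ (((t : ℂ) - 1) * z.2.2.1) z) :=
      setIntegral_congr_fun measurableSet_Icc fun t ht =>
        hF.qper _ (h.flow_segment_mem hμ hμτ hτ1 hz ht) θ
    rw [this, integral_const_mul]
    simp only [shift]
    ring
  nonneg := mul_nonneg (mul_nonneg h.nonneg_X h.nonneg_W) hF.nonneg
  bound := fun z hz => by
    have hle := h.scale_le (τ := τ - μ) (by linarith)
    have hX := h.norm_x _ (nbhd_mono _ hle.2.2.1 hz.1.2.2)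
    have hW := h.norm_inv _ (toActions_mem_actionDomain hle hz)
    have hX0 := h.nonneg_X
    have hW0 := h.nonneg_W
    have ha := hF.nonneg
    rw [NormalForm.modePrimitive, norm_mul, norm_mul, mul_assoc (X * W)]
    refine mul_le_mul (mul_le_mul hX hW (norm_nonneg _) hX0) ?_ (norm_nonneg _)
      (mul_nonneg hX0 hW0)
    refine norm_setIntegral_Icc_le fun t ht => ?_
    have hm := h.flow_segment_mem hμ hμτ hτ1 hz ht
    refine (hF.bound _ hm).trans ?_
    gcongr a * Real.exp ?_
    set σ := ((t : ℂ) - 1) * z.2.2.1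
    have hσ : ‖σ‖ ≤ X := h.norm_sub_one_mul_le (τ := τ - μ) (by linarith) ht hz.1.2.2
    have e : ∀ i, ((flow H₀ σ z).2.2.2.1 i).im = (z.2.2.2.1 i).im + (σ * freqI H₀ z i).im :=
      fun i => Complex.add_im _ _
    have h1 : ∀ i, -((k i : ℝ) * (σ * freqI H₀ z i).im) ≤ |(k i : ℝ)| * (μ * u.s) := fun i => by
      refine (neg_le_abs _).trans ?_
      rw [abs_mul]
      gcongr
      exact (Complex.abs_im_le_norm _).trans (h.norm_mul_freqI_le hle hz hσ i)
    have h2 : -∑ i, (k i : ℝ) * (σ * freqI H₀ z i).im ≤ (∑ i, |(k i : ℝ)|) * (μ * u.s) := by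
      rw [← Finset.sum_neg_distrib, Finset.sum_mul]
      exact Finset.sum_le_sum fun i _ => h1 i
    simp only [e, mul_add, Finset.sum_add_distrib, Width.scale]
    nlinarith

/-- The set of admissible `y` is star-shaped about `0`: along the segment from `0` to `y` the
logarithms of `|p_l|` and `|q_l|` are affine in `t`, so their bounds at both ends hold in between.
The angles are unrestricted in the slab. -/
theorem FreqBound.flow_star (h : FreqBound B u H₀ X W μ) (hμ : 0 ≤ μ) (hμτ : μ < τ)
    (hτ1 : τ ≤ 1) {z : Phase n m} (hz : z ∈ slab m B (u.scale (τ - μ))) {y : ℂ}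
    (hy : flow H₀ (y - z.2.2.1) z ∈ slab m B (u.scale τ)) {t : ℝ} (ht : t ∈ Set.Icc (0 : ℝ) 1) :
    flow H₀ (t * y - z.2.2.1) z ∈ slab m B (u.scale τ) := by
  have h0 := h.flow_segment_mem hμ hμτ hτ1 hz (t := 0) (by simp)
  have key : ∀ (p α β : ℂ) (R : ℝ), ‖p * Complex.exp α‖ < R → ‖p * Complex.exp β‖ < R →
      ‖p * Complex.exp ((1 - t) * α + t * β)‖ < R := by
    intro p α β R h1 h2
    rw [norm_mul, Complex.norm_exp] at *
    have e : ((1 - t) * α + t * β : ℂ).re = (1 - t) * α.re + t * β.re := by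
      rw [Complex.add_re, ← Complex.ofReal_one, ← Complex.ofReal_sub, Complex.re_ofReal_mul,
        Complex.re_ofReal_mul]
    rcases le_total α.re β.re with hab | hab
    · refine lt_of_le_of_lt ?_ h2
      gcongr ‖p‖ * Real.exp ?_
      rw [e]; nlinarith [ht.1, ht.2]
    · refine lt_of_le_of_lt ?_ h1
      gcongr ‖p‖ * Real.exp ?_
      rw [e]; nlinarith [ht.1, ht.2]
  refine ⟨⟨hy.1.1, hy.1.2.1, ?_⟩, fun l => ?_, fun l => ?_⟩
  · have h1 : z.2.2.1 + (y - z.2.2.1) ∈ nbhd B.setX (u.scale τ).ξ := hy.1.2.2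
    show z.2.2.1 + (t * y - z.2.2.1) ∈ nbhd B.setX (u.scale τ).ξ
    rw [add_sub_cancel] at h1 ⊢
    exact mul_mem_nbhd B h1 ht
  · have := key _ _ _ _ (h0.2.1 l) (hy.2.1 l)
    convert this using 4
    simp only [flow]
    congr 2
    push_cast
    ring
  · have := key _ _ _ _ (h0.2.2 l) (hy.2.2 l)
    convert this using 4
    simp only [flow]
    congr 2
    push_cast
    ring

/-- Restricted to an orbit, with `y = x + σ` as coordinate, the solution is `1/ω_r` times the radial
primitive of `F` along that orbit, and `ω_r` is constant there. -/
theorem IsAtom.fderiv_modePrimitive (h : FreqBound B u H₀ X W μ) (hμ : 0 ≤ μ) (hμτ : μ < τ)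
    (hτ1 : τ ≤ 1) (hF : IsAtom B (u.scale τ) k a F) {z : Phase n m}
    (hz : z ∈ slab m B (u.scale (τ - μ))) :
    fderiv ℂ (NormalForm.modePrimitive H₀ F) z (field H₀ z) =
      (omegaR H₀ (toActions z))⁻¹ * F z := by
  set x := z.2.2.1 with hx
  have hz' := slab_mono B (Width.scale_le h.pos (show τ - μ ≤ τ by linarith)) hz
  have hflowd : Differentiable ℂ fun y : ℂ => flow H₀ (y - x) z := by
    unfold flow; fun_prop
  have hUo : IsOpen {y : ℂ | flow H₀ (y - x) z ∈ slab m B (u.scale τ)} :=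
    (isOpen_slab B _).preimage hflowd.continuous
  have hrad := hasDerivAt_radial_primitive hUo
    (fun y hy t ht => h.flow_star hμ hμτ hτ1 hz hy ht)
    (h := fun y => F (flow H₀ (y - x) z))
    (hF.diff.comp hflowd.differentiableOn fun y hy => hy) (x := x)
    (by simpa [flow_zero] using hz')
  simp only [sub_self, flow_zero] at hrad
  have hrad' : HasDerivAt (fun σ => (x + σ) * ∫ t in (0 : ℝ)..1, F (flow H₀ (t * (x + σ) - x) z))
      (F z) 0 := by
    have := HasDerivAt.comp_const_add x 0 (by rw [add_zero]; exact hrad)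
    exact this
  have hcomp : ∀ σ, NormalForm.modePrimitive H₀ F (flow H₀ σ z) = (omegaR H₀ (toActions z))⁻¹ *
      ((x + σ) * ∫ t in (0 : ℝ)..1, F (flow H₀ (t * (x + σ) - x) z)) := by
    intro σ
    rw [NormalForm.modePrimitive, toActions_flow, intervalIntegral.integral_of_le zero_le_one,
      ← integral_Icc_eq_integral_Ioc]
    have e : ∀ t : ℝ, flow H₀ (((t : ℂ) - 1) * (flow H₀ σ z).2.2.1) (flow H₀ σ z) =
        flow H₀ (t * (x + σ) - x) z := by
      intro t
      rw [flow_flow]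
      congr 1
      simp only [flow]
      ring
    simp only [e]
    simp only [flow]
    ring
  have h1 : HasDerivAt (fun σ => NormalForm.modePrimitive H₀ F (flow H₀ σ z))
      ((omegaR H₀ (toActions z))⁻¹ * F z) 0 := by
    simp only [hcomp]
    exact hrad'.const_mul _
  have h2 := (hF.modePrimitive h hμ hμτ hτ1).hasFDerivAt hz
  rw [← flow_zero (H₀ := H₀) z] at h2
  have h3 := h2.comp_hasDerivAt 0 (hasDerivAt_flow z)
  rw [flow_zero] at h3
  exact h3.unique h1

/-- By Fubini the average is taken inside the integral along the flow. Exchanging flow and rotation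
produces a translation of the angles, which multiplies a mode by a factor independent of the
rotation; the average of `F` at the flowed point is zero. -/
theorem IsAtom.avg_modePrimitive (h : FreqBound B u H₀ X W μ) (hμ : 0 ≤ μ) (hμτ : μ < τ)
    (hτ1 : τ ≤ 1) (hF : IsAtom B (u.scale τ) k a F)
    (hF0 : ∀ z ∈ slab m B (u.scale τ), NormalForm.avg F z = 0) {z : Phase n m}
    (hz : z ∈ slab m B (u.scale (τ - μ))) :
    NormalForm.avg (NormalForm.modePrimitive H₀ F) z = 0 := by
  have hrot : ∀ τ' t, flow H₀ (((t : ℝ) - 1 : ℂ) * (rotate τ' z).2.2.1) (rotate τ' z) =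
      shift (fun i => ((t : ℂ) - 1) * z.2.2.1 * freqI H₀ z i)
        (rotate τ' (flow H₀ (((t : ℂ) - 1) * z.2.2.1) z)) := fun τ' t => flow_rotate _ _ _
  simp only [NormalForm.avg, NormalForm.modePrimitive, toActions_rotate]
  have e : ∀ τ' : (Fin n → ℝ) × (Fin m → ℝ), (rotate τ' z).2.2.1 = z.2.2.1 := fun _ => rfl
  simp only [e] at hrot ⊢
  rw [integral_const_mul]
  have hcont : ContinuousOn (fun p : ((Fin n → ℝ) × (Fin m → ℝ)) × ℝ =>
      F (flow H₀ (((p.2 : ℂ) - 1) * z.2.2.1) (rotate p.1 z)))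
      (unitBox n m ×ˢ Set.Icc (0 : ℝ) 1) := by
    have hr : Continuous fun p : ((Fin n → ℝ) × (Fin m → ℝ)) × ℝ => (p.2, rotate p.1 z) := by
      have := (NormalForm.continuous_rotate (n := n) (m := m)).comp
        (f := fun p : ((Fin n → ℝ) × (Fin m → ℝ)) × ℝ => (p.1, z)) (by fun_prop)
      exact continuous_snd.prodMk this
    exact (h.continuousOn_integrand hμ hμτ hτ1 hF).comp hr.continuousOn
      fun p hp => ⟨hp.2, rotate_mem_slab hz⟩
  have hint : Integrable (Function.uncurry fun (τ' : (Fin n → ℝ) × (Fin m → ℝ)) (t : ℝ) =>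
      F (flow H₀ (((t : ℂ) - 1) * z.2.2.1) (rotate τ' z)))
      ((volume.restrict (unitBox n m)).prod (volume.restrict (Set.Icc (0 : ℝ) 1))) := by
    rw [Measure.prod_restrict]
    exact hcont.integrableOn_compact (isCompact_unitBox.prod isCompact_Icc)
  rw [integral_integral_swap hint]
  have hz0 : ∀ t ∈ Set.Icc (0 : ℝ) 1, ∫ τ' in unitBox n m,
      F (flow H₀ (((t : ℂ) - 1) * z.2.2.1) (rotate τ' z)) = 0 := by
    intro t ht
    have hm := h.flow_segment_mem hμ hμτ hτ1 hz ht
    have : ∀ τ', F (flow H₀ (((t : ℂ) - 1) * z.2.2.1) (rotate τ' z)) =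
        Complex.exp (Complex.I * ∑ i, k i * (((t : ℂ) - 1) * z.2.2.1 * freqI H₀ z i)) *
          F (rotate τ' (flow H₀ (((t : ℂ) - 1) * z.2.2.1) z)) := fun τ' => by
      rw [hrot, hF.qper _ (rotate_mem_slab hm)]
    simp only [this]
    rw [integral_const_mul]
    have h0 := hF0 _ hm
    rw [NormalForm.avg] at h0
    rw [h0, mul_zero]
  rw [setIntegral_congr_fun measurableSet_Icc hz0]
  simp

/-- The homological equation `{χ, H₀} = -f`. -/
theorem ZBd.exists_homological (h : FreqBound B u H₀ X W μ) (hμ : 0 ≤ μ) (hμτ : μ < τ)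
    (hτ1 : τ ≤ 1) (hf : ZBd B (u.scale τ) M f) :
    ∃ χ, ZBd B (u.scale (τ - μ)) (X * W * M) χ ∧
      ∀ z ∈ strip m B (u.scale (τ - μ)), poisson χ (fun z => H₀ (toActions z)) z = -f z := by
  obtain ⟨ι, hι, k, a, F, h1, h0, h2, h3, h4⟩ := hf
  have hatom := fun i => (h1 i).modePrimitive h hμ hμτ hτ1
  have hsum : ∀ z ∈ strip m B (u.scale (τ - μ)), Summable fun i => modePrimitive H₀ (F i) z :=
    fun z hz => Summable.of_norm_bounded (h2.mul_left (X * W)) fun i => (hatom i).norm_le_strip hz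
  refine ⟨fun z => ∑' i, modePrimitive H₀ (F i) z, ⟨ι, hι, k, _, _, hatom,
    fun i z hz => (h1 i).avg_modePrimitive h hμ hμτ hτ1 (h0 i) hz, h2.mul_left _, ?_,
    fun z hz => (hsum z hz).hasSum⟩, fun z hz => ?_⟩
  · rw [tsum_mul_left]
    exact mul_le_mul_of_nonneg_left h3 (mul_nonneg h.nonneg_X h.nonneg_W)
  · have hzu := slab_mono B (h.scale_le (τ := τ - μ) (by linarith)) hz.1
    have hne : omegaR H₀ (toActions z) ≠ 0 :=
      h.ne _ (toActions_mem_actionDomain ⟨le_rfl, le_rfl, le_rfl, le_rfl, le_rfl⟩ hzu)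
    rw [h.poisson_eq _ hzu]
    -- The derivative along the field is taken termwise, which the summable weights allow.
    obtain ⟨g', hg', hs⟩ := hasFDerivAt_of_hasSum (isOpen_strip B (u.scale (τ - μ)))
      (h2.mul_left (X * W)) (fun i => (hatom i).diff.mono fun z hz => hz.1)
      (fun i z hz => (hatom i).norm_le_strip hz) (fun z hz => (hsum z hz).hasSum) hz
    rw [hg'.fderiv]
    have hs1 := hs.mapL (ContinuousLinearMap.apply ℂ ℂ (field H₀ z))
    have hs2 : HasSum (fun i => fderiv ℂ (modePrimitive H₀ (F i)) z (field H₀ z))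
        (g' (field H₀ z)) := hs1
    simp only [(h1 _).fderiv_modePrimitive h hμ hμτ hτ1 hz.1] at hs2
    have hs3 := (h4 z (strip_mono B (Width.scale_le h.pos (by linarith)) hz)).mul_left
      (omegaR H₀ (toActions z))⁻¹
    rw [hs2.unique hs3]
    field_simp

end Primitive

end HomologicalTheory

/-! ### One step of averaging -/

section Step

variable {n m : ℕ} {B : BaseSets n} {v w u : Width} {H₀ : Actions n m → ℂ} {X W μ : ℝ}

variable {σ ν τ K M ε : ℝ} {f g χ G P Q : Phase n m → ℂ}

theorem Bd.continuous_rotate (hv : v.Pos) (h : Bd B v M g) {z : Phase n m} (hz : z ∈ slab m B v) :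
    Continuous fun τ : (Fin n → ℝ) × (Fin m → ℝ) => g (rotate τ z) :=
  h.differentiableOn.continuousOn.comp_continuous
    ((NormalForm.continuous_rotate (n := n) (m := m)).comp (f := fun τ => (τ, z)) (by fun_prop))
    fun _ => rotate_mem_strip hv.2.2.2.1 hz

theorem Bd.avg_add {M' : ℝ} (hv : v.Pos) (hf : Bd B v M f) (hg : Bd B v M' g) {z : Phase n m}
    (hz : z ∈ slab m B v) :
    NormalForm.avg (fun z => f z + g z) z = NormalForm.avg f z + NormalForm.avg g z :=
  integral_add ((hf.continuous_rotate hv hz).continuousOn.integrableOn_compact isCompact_unitBox)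
    ((hg.continuous_rotate hv hz).continuousOn.integrableOn_compact isCompact_unitBox)

/-- One generator must act on every `g ∈ 𝒪_τ`, with no bound relating `g` to `χ`: convergence
depends on `χ` alone, through `lieRatio`, and the size of `g` is only a factor. -/
theorem generatesLieMap (hu : u.Pos) (hν : 0 < ν) (hσ : 0 < σ - 2 * ν) (hτ : σ - ν ≤ τ)
    (hχ : ZBd B (u.scale σ) K χ) (hη : lieRatio n m u ν K ≤ 1 / 2) (hw : w.Pos)
    (hlt : w.Lt (u.scale (σ - 2 * ν))) : GeneratesLieMap B (u.scale τ) w χ := by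
  have hσ0 : (u.scale (σ - 2 * ν)).Pos := Width.scale_pos hu hσ
  have hle : (u.scale (σ - 2 * ν)).Le (u.scale σ) := Width.scale_le hu (by linarith)
  refine ⟨(hχ.mono_width hle).isZeroAverage hw hlt, fun g hg => ?_⟩
  have hb := (hg.bd (Width.scale_pos hu (by linarith))).mono_width (Width.scale_le hu hτ)
  set M := (norm B (u.scale τ) g).toReal
  have hM : 0 ≤ M := hb.nonneg
  refine ⟨?_, (hb.lieSeries hu hν hσ hχ.bd hη).isHol hlt⟩
  have hη0 : 0 ≤ lieRatio n m u ν K := by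
    have := Width.frakd_pos hu
    have := hχ.bd.nonneg
    rw [lieRatio]; positivity
  -- Chosen so that the intermediate radius is the midpoint between the two values of `δ`.
  set θ := (w.δ + (u.scale (σ - 2 * ν)).δ) / (2 * (u.scale (σ - 2 * ν)).δ) with hθ
  have h1 := hlt.2.2.2.2
  have h2 := hσ0.2.2.2.2
  have h3 := hw.2.2.2.2
  have hθ0 : 0 < θ := by positivity
  have hθ1 : θ < 1 := by rw [hθ, div_lt_one (by positivity)]; linarith
  have hθw : w.δ < θ * (u.scale (σ - 2 * ν)).δ := by
    have : θ * (u.scale (σ - 2 * ν)).δ = (w.δ + (u.scale (σ - 2 * ν)).δ) / 2 := by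
      rw [hθ]; field_simp
    rw [this]; linarith
  set T := taylorSum m (w.δ / (θ * (u.scale (σ - 2 * ν)).δ))
  have hT : 0 ≤ T := taylorSum_nonneg (by positivity)
  have hj : ∀ j : ℕ, norm B w ((poisson χ)^[j] g) / (j.factorial : ℝ≥0∞) ≤
      ENNReal.ofReal (T * M * (1 / 2) ^ j) := fun j => by
    have hf : (0 : ℝ) < j.factorial := by positivity
    have h4 := (hb.iterate_poisson hu hν hσ hχ.bd j).norm_le_ofReal hw hlt hθ0 hθ1 hθw
    refine ENNReal.div_le_of_le_mul (h4.trans ?_)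
    rw [← ENNReal.ofReal_natCast, ← ENNReal.ofReal_mul (by positivity)]
    refine ENNReal.ofReal_le_ofReal ?_
    calc _ ≤ T * ((1 / 2) ^ j * j.factorial * M) := by gcongr
      _ = _ := by ring
  refine lt_of_le_of_lt (ENNReal.tsum_le_tsum hj) ?_
  exact ((hasSum_geometric_two.summable.mul_left (T * M))).tsum_ofReal_lt_top

/-- The constant of the Cauchy estimate of the Poisson bracket. -/
def bracketConst (n m : ℕ) : ℝ := 2 * (1 + n + m)

theorem bracketConst_ge : 2 ≤ bracketConst n m := by
  have : (0 : ℝ) ≤ n := Nat.cast_nonneg n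
  have : (0 : ℝ) ≤ m := Nat.cast_nonneg m
  rw [bracketConst]; linarith

theorem Bd.bracket_le (hu : u.Pos) {σ₁ σ₂ M₁ M₂ ℓ₁ ℓ₂ : ℝ} (hτ : 0 < τ) (h1 : 0 < ℓ₁)
    (h2 : 0 < ℓ₂) (hσ₁ : ℓ₁ ≤ σ₁ - τ) (hσ₂ : ℓ₂ ≤ σ₂ - τ)
    (hf : Bd B (u.scale σ₁) M₁ f) (hg : Bd B (u.scale σ₂) M₂ g) :
    Bd B (u.scale τ) (bracketConst n m * (M₁ * M₂ / (ℓ₁ * ℓ₂ * u.frakd))) (poisson f g) := by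
  have hd := Width.frakd_pos hu
  have hM1 := hf.nonneg
  have hM2 := hg.nonneg
  refine (Bd.poissonBracket hu hτ (by linarith) (by linarith) hf hg).mono ?_
  rw [bracketConst]
  have := h1.le.trans hσ₁
  gcongr

/-- One step of the averaging procedure for the perturbation `G = P + Q`. -/
theorem FreqBound.step (h : FreqBound B u H₀ X W μ) (hμ : 0 < μ) (hν : 0 < ν) {ℓ τ' MP MQ : ℝ}
    (hℓ : 0 < ℓ) (hτ1 : τ ≤ 1) (hpos : 0 < τ - μ - 2 * ν) (hℓτ : ℓ ≤ τ' - (τ - μ - ν))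
    (hττ' : τ ≤ τ') (hG : ZBd B (u.scale τ) ε (fun z => G z - avg G z))
    (hP : Bd B (u.scale τ') MP P) (hQ : Bd B (u.scale τ) MQ Q)
    (hPQ : ∀ z ∈ strip m B (u.scale τ), G z = P z + Q z)
    (hη : lieRatio n m u ν (X * W * ε) ≤ 1 / 2) :
    ∃ χ, ZBd B (u.scale (τ - μ)) (X * W * ε) χ ∧ Bd B (u.scale (τ - μ - 2 * ν))
      (2 * (bracketConst n m * (X * W * ε * MP / (ν * ℓ * u.frakd)) +
          bracketConst n m * (X * W * ε * MQ / (ν * ν * u.frakd))) +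
        2 * (bracketConst n m * (X * W * ε * ε / (ν * ν * u.frakd))))
      (fun z => lieExp χ (fun z => H₀ (toActions z) + G z) z - H₀ (toActions z) - avg G z) := by
  have hu := h.pos
  obtain ⟨χ, hχ, heq⟩ := hG.exists_homological h hμ.le (by linarith) hτ1
  refine ⟨χ, hχ, ?_⟩
  have hle : (u.scale (τ - μ)).Le (u.scale τ) := Width.scale_le hu (by linarith)
  have hle' : (u.scale (τ - μ - ν)).Le (u.scale (τ - μ)) := Width.scale_le hu (by linarith)
  have hsub : strip m B (u.scale (τ - μ)) ⊆ strip m B (u.scale τ) := strip_mono B hle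
  have hPs : DifferentiableOn ℂ P (strip m B (u.scale τ)) :=
    hP.differentiableOn.mono (strip_mono B (Width.scale_le hu hττ'))
  have hQs := hQ.differentiableOn
  have hGs : DifferentiableOn ℂ G (strip m B (u.scale τ)) :=
    (hPs.add hQs).congr hPQ
  -- `P` is known on the larger width `τ'` and loses `ℓ`, whereas `Q` and the off-average part are
  -- only known at `τ` and are differentiated with the small loss `ν`.
  have b1 := Bd.bracket_le hu (τ := τ - μ - ν) (ℓ₁ := ν) (ℓ₂ := ℓ) (by linarith) hν hℓ (by linarith)
    hℓτ hχ.bd hP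
  have b2 := Bd.bracket_le hu (τ := τ - μ - ν) (ℓ₁ := ν) (ℓ₂ := ν) (by linarith) hν hν (by linarith)
    (by linarith) hχ.bd hQ
  have b3 := Bd.bracket_le hu (τ := τ - μ - ν) (ℓ₁ := ν) (ℓ₂ := ν) (by linarith) hν hν (by linarith)
    (by linarith) hχ.bd hG.bd
  have b4 : Bd B (u.scale (τ - μ - ν)) _ (poisson χ G) := (b1.add b2).congr fun z hz => by
    have hz' := hsub (strip_mono B hle' hz)
    have hO := isOpen_strip (m := m) B (u.scale τ)
    have e := poisson_add_smul (χ := χ) 1 ((hPs z hz').differentiableAt (hO.mem_nhds hz'))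
      ((hQs z hz').differentiableAt (hO.mem_nhds hz'))
    simp only [one_mul] at e
    rw [← e]
    exact poisson_congr hO hPQ hz'
  have hH : DifferentiableOn ℂ (fun z : Phase n m => H₀ (toActions z))
      (strip m B (u.scale (τ - μ))) := fun z hz =>
    ((h.differentiableAt_actions (slab_mono B (h.scale_le (by linarith)) hz.1)).comp z
      differentiable_toActions.differentiableAt).differentiableWithinAt
  -- Here `G₁` is `G - avg G`, so that `G - G₁` is the average of `G`.
  have := Bd.lieExp_sub hu hν hpos hχ.bd hη hH (hGs.mono hsub) (hG.bd.differentiableOn.mono hsub)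
    heq b4 b3
  refine this.congr fun z _ => ?_
  ring

/-- The perturbation after one step. -/
theorem averaging_step {D r : ℝ} {G' : Phase n m → ℂ} (hv : v.Pos) (hG : Bd B v M G)
    (hD : Bd B v D (fun z => avg G z - avg f z)) (hR : Bd B v r (fun z => G' z - avg G z)) :
    ZBd B v (2 * r) (fun z => G' z - avg G' z) ∧
      Bd B v (D + r) (fun z => avg G' z - avg f z) := by
  have hA := hG.avg hv
  -- The average is idempotent, so `avg G` is unchanged and only the remainder contributes a new
  -- average.
  have key : ∀ z ∈ slab m B v, avg G' z = avg G z + avg (fun z => G' z - avg G z) z := by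
    intro z hz
    have h1 := hA.avg_add hv hR hz
    rw [hG.avg_avg hv hz] at h1
    rw [← h1]
    exact avg_congr fun τ => by ring
  refine ⟨(hR.zbd_sub_avg hv).congr fun z hz => ?_, (hD.add (hR.avg hv)).congr fun z hz => ?_⟩
  · rw [key z hz.1]; ring
  · rw [key z hz.1]; ring

end Step

/-! ### The iteration -/

section Iteration

variable {n m : ℕ} {B : BaseSets n} {v w u : Width} {H₀ : Actions n m → ℂ} {X W : ℝ}

theorem lieComp_congr {χ χ' : ℕ → Phase n m → ℂ} {N : ℕ} (h : ∀ j < N, χ j = χ' j)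
    (g : Phase n m → ℂ) : lieComp χ N g = lieComp χ' N g := by
  induction N with
  | zero => rfl
  | succ N ih =>
    simp only [lieComp]
    rw [ih fun j hj => h j (by omega), h N (by omega)]

theorem IsHol.lieComp {χ : ℕ → Phase n m → ℂ} {N : ℕ} {w : ℕ → Width}
    (h : ∀ i < N, GeneratesLieMap B (w i) (w (i + 1)) (χ i)) {g : Phase n m → ℂ}
    (hg : IsHol B (w 0) g) : IsHol B (w N) (lieComp χ N g) := by
  induction N with
  | zero => exact hg
  | succ N ih => exact ((h N (by omega)).2 _ (ih fun i hi => h i (by omega))).2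

/-- The widths along the iteration, in units of `u`. -/
def stepWidth (N i : ℕ) : ℝ := if i = 0 then 1 else 11 / 12 - i / (3 * N)

/-- The widths of the domains of the Lie maps, in units of `u`. -/
def lieWidth (N i : ℕ) : ℝ := if i = N then 1 / 3 else stepWidth N i

theorem stepWidth_zero (N : ℕ) : stepWidth N 0 = 1 := if_pos rfl

theorem stepWidth_succ (N i : ℕ) :
    stepWidth N (i + 1) = 11 / 12 - ((i : ℝ) + 1) * (1 / N) / 3 := by
  rw [stepWidth, if_neg (Nat.succ_ne_zero i)]
  push_cast
  ring

/-- The budget is `1/12` reserved for the first step plus `1/(3N)` for each of the `N` steps. A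
later step needs `μ + 2ν = 1/(4N) + 1/(18N)`, the first `1/(4N) + 1/18`. The remaining room from
`7/12` to `1/3` serves the return to the Taylor–Fourier norm. -/
theorem stepWidth_self {N : ℕ} (hN : 1 ≤ N) : stepWidth N N = 7 / 12 := by
  have : (N : ℝ) ≠ 0 := by positivity
  rw [stepWidth, if_neg (by omega)]
  field_simp
  norm_num

theorem lieWidth_self (N : ℕ) : lieWidth N N = 1 / 3 := if_pos rfl

theorem lieWidth_of_lt {N i : ℕ} (h : i < N) : lieWidth N i = stepWidth N i := if_neg h.ne

theorem mul_inv_le_one {N i : ℕ} (hi : i < N) : ((i : ℝ) + 1) * (1 / N) ≤ 1 := by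
  have hN : (0 : ℝ) < N := by exact_mod_cast (by omega : 0 < N)
  rw [mul_one_div, div_le_one hN]
  exact_mod_cast hi

theorem lieWidth_succ_pos {N i : ℕ} (hi : i < N) : 0 < lieWidth N (i + 1) := by
  rw [lieWidth]
  split_ifs
  · norm_num
  · rw [stepWidth_succ]
    linarith [mul_inv_le_one hi]

/-- The two sequences differ only at the last index, where the composition has to land exactly in
`u/3` while the estimates are still available at `7/12`. -/
theorem lieWidth_succ_le {N i : ℕ} (hi : i < N) : lieWidth N (i + 1) ≤ stepWidth N (i + 1) := by
  rw [lieWidth]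
  split_ifs
  · rw [stepWidth_succ]
    linarith [mul_inv_le_one hi]
  · exact le_rfl

theorem stepWidth_succ_lt {N i : ℕ} (hN : 1 ≤ N) : stepWidth N (i + 1) < stepWidth N i := by
  have hx : (0 : ℝ) < 1 / N := by positivity
  rw [stepWidth_succ]
  rcases i with _ | i
  · rw [stepWidth_zero]; push_cast; linarith
  · rw [stepWidth_succ]; push_cast; linarith

/-- The largeness condition on the constant, resolved. -/
theorem small_mul {C t : ℝ} (hC : 2 ≤ C) (ht : 0 ≤ t) (h : 10 ^ 9 * C ^ 2 * t ≤ 1) :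
    C ^ 2 * t ≤ 1 / 10 ^ 9 ∧ C * t ≤ 1 / 10 ^ 9 ∧ t ≤ 1 / 10 ^ 9 ∧ C ^ 2 * t ^ 2 ≤ 1 / 10 ^ 9 := by
  have h1 : C ^ 2 * t ≤ 1 / 10 ^ 9 := by linarith
  have h2 : C * t ≤ C ^ 2 * t := by
    rw [sq, mul_assoc]
    exact le_mul_of_one_le_left (by positivity) (by linarith)
  have h3 : t ≤ C * t := le_mul_of_one_le_left ht (by linarith)
  refine ⟨h1, h2.trans h1, h3.trans (h2.trans h1), ?_⟩
  have h5 : t ≤ 1 := by linarith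
  have h6 : 0 ≤ C ^ 2 * t := by positivity
  nlinarith

/-- The quantities governing the iteration. -/
structure Scheme (B : BaseSets n) (u : Width) (H₀ : Actions n m → ℂ) (f : Phase n m → ℂ)
    (X W E ε : ℝ) (N : ℕ) : Prop where
  one_le : 1 ≤ N
  freq : FreqBound B u H₀ X W (1 / N / 4)
  bd : Bd B u E f
  zbd : ZBd B u ε (fun z => f z - avg f z)
  le : ε ≤ E
  small : 10 ^ 9 * bracketConst n m ^ 2 * (N * (X * W / u.frakd) * E) ≤ 1

/-- The size of the perturbation after the first step. -/
def firstError (n m : ℕ) (u : Width) (X W E ε : ℝ) : ℝ :=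
  5184 * bracketConst n m * (X * W / u.frakd) * ε * E

variable {f : Phase n m → ℂ} {E ε : ℝ} {N : ℕ}

theorem Scheme.firstError_nonneg (h : Scheme B u H₀ f X W E ε N) :
    0 ≤ firstError n m u X W E ε := by
  have h1 := h.bd.nonneg
  have h2 := h.zbd.bd.nonneg
  have h3 := Width.frakd_pos h.freq.pos
  have h4 := h.freq.nonneg_X
  have h5 := h.freq.nonneg_W
  have h6 := bracketConst_ge (n := n) (m := m)
  rw [firstError]
  positivity

/-- This is why a smallness condition linear in `N` suffices: the factor `N²` meets `ρ`, which is
already quadratic in the perturbation. -/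
theorem Scheme.sq_mul_firstError_le (h : Scheme B u H₀ f X W E ε N) :
    N ^ 2 * (X * W / u.frakd) * firstError n m u X W E ε ≤
      5184 * bracketConst n m * (N * (X * W / u.frakd) * E) ^ 2 := by
  have h1 := h.bd.nonneg
  have h2 := h.zbd.bd.nonneg
  have h3 := Width.frakd_pos h.freq.pos
  have h4 := h.freq.nonneg_X
  have h5 := h.freq.nonneg_W
  have h6 := bracketConst_ge (n := n) (m := m)
  have hle := h.le
  rw [firstError]
  calc _ = 5184 * bracketConst n m * (N * (X * W / u.frakd)) ^ 2 * E * ε := by ring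
    _ ≤ 5184 * bracketConst n m * (N * (X * W / u.frakd)) ^ 2 * E * E := by gcongr
    _ = _ := by ring

/-- The loss `ν = 1/36` does not depend on `N`, so neither does the constant in the error. The
constant `5184 = 4 · 36²` collects two brackets, each with the factor `2` of the Lie series, after
bounding one `ε` by `E`. -/
theorem Scheme.first_step (h : Scheme B u H₀ f X W E ε N) :
    ∃ χ, GeneratesLieMap B (u.scale (lieWidth N 0)) (u.scale (lieWidth N 1)) χ ∧
      Bd B (u.scale (stepWidth N 1)) (firstError n m u X W E ε)
        (fun z => lieExp χ (fun z => H₀ (toActions z) + f z) z - H₀ (toActions z) - avg f z) := by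
  have hN := h.one_le
  have hu := h.freq.pos
  have hx : (0 : ℝ) < 1 / N := by positivity
  have hx1 : (1 : ℝ) / N ≤ 1 := by
    rw [div_le_one (by positivity)]; exact_mod_cast hN
  have hE := h.bd.nonneg
  have hε := h.zbd.bd.nonneg
  have hd := Width.frakd_pos hu
  have hX := h.freq.nonneg_X
  have hW := h.freq.nonneg_W
  have hC := bracketConst_ge (n := n) (m := m)
  have hle := h.le
  have hN1 : (1 : ℝ) ≤ N := by exact_mod_cast hN
  set κ := X * W / u.frakd with hκ
  have hκ0 : 0 ≤ κ := by positivity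
  have hXW : X * W = κ * u.frakd := by rw [hκ]; field_simp
  obtain ⟨s1, s2, s3, s4⟩ := small_mul hC (by positivity : 0 ≤ N * κ * E) h.small
  have hη : lieRatio n m u (1 / 36) (X * W * ε) ≤ 1 / 2 := by
    have e : lieRatio n m u (1 / 36) (X * W * ε) =
        1296 * Real.exp 1 * (bracketConst n m * (κ * ε)) := by
      rw [lieRatio, bracketConst, hXW]; field_simp; ring
    have h1 : bracketConst n m * (κ * ε) ≤ bracketConst n m * (N * κ * E) := by
      gcongr
      exact le_mul_of_one_le_left hκ0 hN1
    have h2 := Real.exp_one_lt_d9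
    have h3 : 0 ≤ bracketConst n m * (κ * ε) := by positivity
    rw [e]
    calc _ ≤ (1296 : ℝ) * 3 * (1 / 10 ^ 9) := by gcongr <;> linarith
      _ ≤ _ := by norm_num
  have hu1 : u.scale 1 = u := Width.scale_one u
  -- In the first step the whole perturbation is the part `P`, and `Q = 0`.
  have hz : Bd B (u.scale 1) (‖(0 : ℂ)‖ * E) (fun z => 0 * f z) := by
    rw [hu1]; exact h.bd.const_mul 0
  obtain ⟨χ, hχ, hR⟩ := h.freq.step (τ := 1) (τ' := 1) (ν := 1 / 36) (ℓ := 1 / 36) (G := f) (P := f)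
    (by positivity) (by norm_num) (by norm_num) le_rfl (by linarith) (by linarith) le_rfl
    (by rw [hu1]; exact h.zbd) (by rw [hu1]; exact h.bd) hz (fun z _ => by ring) hη
  refine ⟨χ, ?_, ?_⟩
  · have e : lieWidth N 0 = 1 := by rw [lieWidth_of_lt (by omega), stepWidth_zero]
    rw [e]
    refine generatesLieMap hu (ν := 1 / 36) (by norm_num) (by linarith) (by linarith) hχ hη
      (Width.scale_pos hu (lieWidth_succ_pos (by omega))) (Width.scale_lt hu ?_)
    have h1 := lieWidth_succ_le (N := N) (i := 0) (by omega)
    rw [stepWidth_succ] at h1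
    push_cast at h1
    linarith
  · have h1 := stepWidth_succ N 0
    push_cast at h1
    refine (hR.mono_width (Width.scale_le hu (by rw [h1]; linarith))).mono ?_
    rw [firstError, norm_zero, ← hκ, hXW]
    have e : 2 * (bracketConst n m * (κ * u.frakd * ε * E / (1 / 36 * (1 / 36) * u.frakd)) +
        bracketConst n m * (κ * u.frakd * ε * (0 * E) / (1 / 36 * (1 / 36) * u.frakd))) +
        2 * (bracketConst n m * (κ * u.frakd * ε * ε / (1 / 36 * (1 / 36) * u.frakd))) =
        2592 * bracketConst n m * κ * ε * E + 2592 * bracketConst n m * κ * ε * ε := by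
      field_simp; ring
    rw [e]
    have : 2592 * bracketConst n m * κ * ε * ε ≤ 2592 * bracketConst n m * κ * ε * E := by gcongr
    linarith

/-- The generator has size proportional to `e₁`. Its bracket with `avg f` costs `N`, the one with `G
- avg f` and the one with the off-average part cost `N²` but act on quantities of order `ρ`. All
three are small by hypothesis, leaving `e₁/8`; removing the new average doubles this, hence the rate
`1/4`. -/
theorem Scheme.next_step (h : Scheme B u H₀ f X W E ε N) {i : ℕ} (hi : i + 1 < N)
    {G : Phase n m → ℂ}
    (hG : ZBd B (u.scale (stepWidth N (i + 1))) (2 * firstError n m u X W E ε / 4 ^ i)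
      (fun z => G z - avg G z))
    (hD : Bd B (u.scale (stepWidth N (i + 1)))
      (3 * firstError n m u X W E ε - 2 * firstError n m u X W E ε / 4 ^ i)
      (fun z => avg G z - avg f z)) :
    ∃ χ, GeneratesLieMap B (u.scale (lieWidth N (i + 1))) (u.scale (lieWidth N (i + 2))) χ ∧
      Bd B (u.scale (stepWidth N (i + 2))) (2 * firstError n m u X W E ε / 4 ^ i / 8)
        (fun z => lieExp χ (fun z => H₀ (toActions z) + G z) z - H₀ (toActions z) - avg G z) := by
  have hN := h.one_le
  have hu := h.freq.pos
  have hN0 : (0 : ℝ) < N := by positivity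
  have hx : (0 : ℝ) < 1 / N := by positivity
  have hE := h.bd.nonneg
  have hd := Width.frakd_pos hu
  have hX := h.freq.nonneg_X
  have hW := h.freq.nonneg_W
  have hC := bracketConst_ge (n := n) (m := m)
  have hρ := h.firstError_nonneg
  have hs := h.sq_mul_firstError_le
  set κ := X * W / u.frakd with hκ
  have hκ0 : 0 ≤ κ := by positivity
  have hXW : X * W = κ * u.frakd := by rw [hκ]; field_simp
  obtain ⟨s1, s2, s3, s4⟩ := small_mul hC (by positivity : 0 ≤ N * κ * E) h.small
  set ρ := firstError n m u X W E ε
  set e₁ := 2 * ρ / 4 ^ i with he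
  have he0 : 0 ≤ e₁ := hG.bd.nonneg
  have heρ : e₁ ≤ 2 * ρ := div_le_self (by positivity) (one_le_pow₀ (by norm_num))
  have hCs : bracketConst n m * (N ^ 2 * κ * ρ) ≤ 5184 * (1 / 10 ^ 9) := by
    calc _ ≤ bracketConst n m * (5184 * bracketConst n m * (N * κ * E) ^ 2) := by gcongr
      _ = 5184 * (bracketConst n m ^ 2 * (N * κ * E) ^ 2) := by ring
      _ ≤ _ := by gcongr
  have hη : lieRatio n m u (1 / N / 36) (X * W * e₁) ≤ 1 / 2 := by
    have e : lieRatio n m u (1 / N / 36) (X * W * e₁) =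
        1296 * Real.exp 1 * (bracketConst n m * (N ^ 2 * κ * e₁)) := by
      rw [lieRatio, bracketConst, hXW]; field_simp; ring
    have h1 : bracketConst n m * (N ^ 2 * κ * e₁) ≤ bracketConst n m * (N ^ 2 * κ * (2 * ρ)) := by
      gcongr
    have h2 := Real.exp_one_lt_d9
    have h3 : 0 ≤ bracketConst n m * (N ^ 2 * κ * e₁) := by positivity
    have h4 : bracketConst n m * (N ^ 2 * κ * e₁) ≤ 2 * (5184 * (1 / 10 ^ 9)) := by linarith
    have h5 : 1296 * Real.exp 1 ≤ 1296 * 3 := by linarith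
    rw [e]
    exact (mul_le_mul h5 h4 h3 (by norm_num)).trans (by norm_num)
  have hi1 := mul_inv_le_one (show i < N by omega)
  have hi2 := mul_inv_le_one hi
  push_cast at hi2
  have hτ := stepWidth_succ N i
  have hτ2 := stepWidth_succ N (i + 1)
  push_cast at hτ2
  have hix : (0 : ℝ) ≤ i * (1 / N) := by positivity
  have hτ3 : stepWidth N (i + 2) = stepWidth N (i + 1) - 1 / N / 3 := by rw [hτ, hτ2]; ring
  have hτ4 : stepWidth N (i + 1) ≤ 11 / 12 - 1 / N / 3 := by rw [hτ]; linarith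
  have hτ5 : 7 / 12 ≤ stepWidth N (i + 2) := by rw [hτ2]; linarith
  set τ := stepWidth N (i + 1)
  have hP : Bd B (u.scale 1) E (avg f) := by rw [Width.scale_one]; exact h.bd.avg hu
  -- The bound for the drift of the average has the form `3ρ - e₁` precisely so that adding the
  -- off-average part gives `3ρ` at every step.
  have hQ : Bd B (u.scale τ) (3 * ρ) (fun z => G z - avg f z) :=
    ((hG.bd.add hD).congr fun z _ => by ring).mono (by linarith)
  -- `avg f` is used at scale `1`, at distance at least `1/12` from the current domain, which starts
  -- below `11/12`; the loss `ν = 1/(36N)` is the one that must be repeated.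
  obtain ⟨χ, hχ, hR⟩ := h.freq.step (τ := τ) (τ' := 1) (ν := 1 / N / 36) (ℓ := 1 / 12) (G := G)
    (P := avg f) (Q := fun z => G z - avg f z)
    (by positivity) (by positivity) (by norm_num) (by linarith) (by linarith) (by linarith)
    (by linarith) hG hP hQ (fun z _ => by ring) hη
  refine ⟨χ, ?_, ?_⟩
  · rw [lieWidth_of_lt hi]
    refine generatesLieMap hu (ν := 1 / N / 36) (by positivity) (by linarith) (by linarith) hχ hη
      (Width.scale_pos hu (lieWidth_succ_pos hi)) (Width.scale_lt hu ?_)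
    have h1 := lieWidth_succ_le hi
    have h2 : stepWidth N (i + 1 + 1) = stepWidth N (i + 2) := rfl
    linarith
  · refine (hR.mono_width (Width.scale_le hu (by linarith))).mono ?_
    rw [hXW]
    have e : 2 * (bracketConst n m * (κ * u.frakd * e₁ * E / (1 / N / 36 * (1 / 12) * u.frakd)) +
        bracketConst n m * (κ * u.frakd * e₁ * (3 * ρ) / (1 / N / 36 * (1 / N / 36) * u.frakd))) +
        2 * (bracketConst n m * (κ * u.frakd * e₁ * e₁ / (1 / N / 36 * (1 / N / 36) * u.frakd))) =
        e₁ * (864 * (bracketConst n m * (N * κ * E)) +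
          7776 * (bracketConst n m * (N ^ 2 * κ * ρ)) +
          2592 * (bracketConst n m * (N ^ 2 * κ * e₁))) := by
      field_simp; ring
    have h1 : bracketConst n m * (N ^ 2 * κ * e₁) ≤ bracketConst n m * (N ^ 2 * κ * (2 * ρ)) := by
      gcongr
    rw [e, div_eq_mul_one_div e₁ 8]
    refine mul_le_mul_of_nonneg_left ?_ he0
    linarith

/-- The averaging procedure. -/
theorem Scheme.iterate (h : Scheme B u H₀ f X W E ε N) (i : ℕ) (hi : i < N) :
    ∃ χ : ℕ → Phase n m → ℂ,
      (∀ j ≤ i, GeneratesLieMap B (u.scale (lieWidth N j)) (u.scale (lieWidth N (j + 1))) (χ j)) ∧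
      ∃ G : Phase n m → ℂ, lieComp χ (i + 1) (fun z => H₀ (toActions z) + f z) =
          (fun z => H₀ (toActions z) + G z) ∧
        ZBd B (u.scale (stepWidth N (i + 1))) (2 * firstError n m u X W E ε / 4 ^ i)
          (fun z => G z - avg G z) ∧
        Bd B (u.scale (stepWidth N (i + 1)))
          (3 * firstError n m u X W E ε - 2 * firstError n m u X W E ε / 4 ^ i)
          (fun z => avg G z - avg f z) := by
  have hu := h.freq.pos
  have hN := h.one_le
  have hpos : ∀ j < N, (u.scale (stepWidth N (j + 1))).Pos := fun j hj =>
    Width.scale_pos hu ((lieWidth_succ_pos hj).trans_le (lieWidth_succ_le hj))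
  induction i with
  | zero =>
    obtain ⟨χ, hχ, hR⟩ := h.first_step
    refine ⟨fun _ => χ, fun j hj => ?_, fun z => lieExp χ (fun z => H₀ (toActions z) + f z) z -
      H₀ (toActions z), ?_, ?_⟩
    · obtain rfl : j = 0 := by omega
      exact hχ
    · funext z
      simp only [lieComp]
      ring
    · have hle : (u.scale (stepWidth N (0 + 1))).Le u := by
        have := Width.scale_le hu (stepWidth_succ_lt (N := N) (i := 0) hN).le
        rwa [stepWidth_zero, Width.scale_one] at this
      have hf := h.bd.mono_width hle
      -- Initially the perturbation is `f` itself, so the drift of the average is zero.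
      have h0 : Bd B (u.scale (stepWidth N (0 + 1))) (‖(0 : ℂ)‖ * E)
          (fun z => avg f z - avg f z) :=
        (hf.const_mul 0).congr fun z _ => by ring
      have := averaging_step (hpos 0 hi) hf h0 hR
      refine ⟨this.1.mono (by simp), this.2.mono ?_⟩
      simp only [norm_zero, zero_mul, pow_zero]
      linarith
  | succ i ih =>
    obtain ⟨χ, hχ, G, hcomp, hG, hD⟩ := ih (by omega)
    obtain ⟨χ', hχ', hR⟩ := h.next_step hi hG hD
    have hup : ∀ j < i + 1, Function.update χ (i + 1) χ' j = χ j := fun j hj =>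
      Function.update_of_ne hj.ne _ _
    have hup' : Function.update χ (i + 1) χ' (i + 1) = χ' := Function.update_self _ _ _
    refine ⟨Function.update χ (i + 1) χ', fun j hj => ?_,
      fun z => lieExp χ' (fun z => H₀ (toActions z) + G z) z - H₀ (toActions z), ?_, ?_⟩
    · rcases Nat.lt_or_ge j (i + 1) with hj' | hj'
      · rw [hup j hj']
        exact hχ j (by omega)
      · obtain rfl : j = i + 1 := by omega
        rw [hup']
        exact hχ'
    · have e : lieComp (Function.update χ (i + 1) χ') (i + 1 + 1)
          (fun z => H₀ (toActions z) + f z) = lieExp (Function.update χ (i + 1) χ' (i + 1))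
            (lieComp (Function.update χ (i + 1) χ') (i + 1) fun z => H₀ (toActions z) + f z) := rfl
      rw [e, hup', lieComp_congr hup, hcomp]
      funext z
      ring
    · have hle : (u.scale (stepWidth N (i + 1 + 1))).Le (u.scale (stepWidth N (i + 1))) :=
        Width.scale_le hu (stepWidth_succ_lt hN).le
      have hle1 : (u.scale (stepWidth N (i + 1))).Le u := by
        refine h.freq.scale_le ?_
        rw [stepWidth_succ]
        have : (0 : ℝ) ≤ ((i : ℝ) + 1) * (1 / N) := by positivity
        linarith
      have hGb : Bd B (u.scale (stepWidth N (i + 1))) _ G :=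
        ((hG.bd.add hD).add ((h.bd.avg hu).mono_width hle1)).congr fun z _ => by ring
      have := averaging_step (hpos (i + 1) hi) (hGb.mono_width hle) (hD.mono_width hle) hR
      have hρ := h.firstError_nonneg
      have h4 : (0 : ℝ) < 4 ^ i := by positivity
      have e : 2 * firstError n m u X W E ε / 4 ^ (i + 1) =
          2 * firstError n m u X W E ε / 4 ^ i / 4 := by rw [pow_succ]; field_simp
      have h5 : 0 ≤ 2 * firstError n m u X W E ε / 4 ^ i := by positivity
      rw [e]
      exact ⟨this.1.mono (by linarith), this.2.mono (by linarith)⟩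

end Iteration

/-! ### Constants and smallness -/

section Conclusion

variable {n m : ℕ} {B : BaseSets n} {v w u : Width} {H₀ : Actions n m → ℂ} {X W : ℝ}
  {f : Phase n m → ℂ} {E ε : ℝ} {N : ℕ}

/-- The choice `θ = 11/14` makes the intermediate radius `11/24`, the midpoint of `1/3` and `7/12`;
the ratio of `1/3` to it is `8/11`. -/
theorem Bd.norm_third_le (hu : u.Pos) {M : ℝ} {g : Phase n m → ℂ}
    (h : Bd B (u.scale (7 / 12)) M g) :
    norm B u.third g ≤ ENNReal.ofReal (taylorSum m (8 / 11) * M) := by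
  have hδ := hu.2.2.2.2
  have e1 : (u.scale (1 / 3)).δ = 1 / 3 * u.δ := rfl
  have e2 : (u.scale (7 / 12)).δ = 7 / 12 * u.δ := rfl
  rw [Width.third_eq]
  have := h.norm_le_ofReal (v := u.scale (1 / 3)) (Width.scale_pos hu (by norm_num))
    (Width.scale_lt hu (by norm_num)) (θ := 11 / 14) (by norm_num) (by norm_num)
    (by rw [e1, e2]; linarith)
  rwa [e1, e2, show 1 / 3 * u.δ / (11 / 14 * (7 / 12 * u.δ)) = 8 / 11 by field_simp; norm_num]
    at this

theorem supX_ne_top (B : BaseSets n) (u : Width) : supX B u ≠ ⊤ := by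
  obtain ⟨R, hR⟩ := B.isBounded_X.exists_norm_le
  refine ((iSup₂_le fun x hx => ?_ : supX B u ≤ ENNReal.ofReal (R + u.ξ)).trans_lt
    ENNReal.ofReal_lt_top).ne
  obtain ⟨a, ha, hxa⟩ := hx
  rw [← ofReal_norm]
  refine ENNReal.ofReal_le_ofReal ?_
  have h1 : ‖x‖ ≤ ‖(a : ℂ)‖ + ‖x - a‖ := by simpa using norm_add_le (a : ℂ) (x - a)
  have h2 := hR a ha
  rw [Complex.norm_real] at h1
  linarith

theorem supX_ne_zero (B : BaseSets n) (hu : u.Pos) : supX B u ≠ 0 := by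
  have hξ := hu.2.2.1
  have hmem : ((u.ξ / 2 : ℝ) : ℂ) ∈ nbhd B.setX u.ξ := by
    refine ⟨0, B.zero_mem_X, ?_⟩
    rw [Complex.ofReal_zero, sub_zero, Complex.norm_real, Real.norm_of_nonneg (by positivity)]
    linarith
  have h1 : ‖((u.ξ / 2 : ℝ) : ℂ)‖ₑ ≤ supX B u := le_iSup₂_of_le _ hmem le_rfl
  refine (lt_of_lt_of_le ?_ h1).ne'
  rw [enorm_pos, Complex.ofReal_ne_zero]
  positivity

theorem norm_le_toReal_supNorm {g : Actions n m → ℂ} (h : supNorm B u g ≠ ⊤) {y : Actions n m}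
    (hy : y ∈ actionDomain m B u) : ‖g y‖ ≤ (supNorm B u g).toReal := by
  rw [← toReal_enorm]
  exact ENNReal.toReal_mono h (le_iSup₂_of_le y hy le_rfl)

/-- A smallness hypothesis on the frequency ratios, at a point. -/
theorem mul_norm_le_of_sum_lt {ι : Type*} [Fintype ι] {g : ι → Actions n m → ℂ} {s : ℝ}
    (hN : 1 ≤ N) (hs : 0 ≤ s)
    (h : 4 * (N : ℝ≥0∞) * supX B u * (∑ i, supNorm B u (g i)) < ENNReal.ofReal s)
    {y : Actions n m} (hy : y ∈ actionDomain m B u) (i : ι) :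
    (supX B u).toReal * ‖g i y‖ ≤ 1 / N / 4 * s := by
  have h1 : ‖g i y‖ₑ ≤ ∑ i, supNorm B u (g i) :=
    (le_iSup₂_of_le y hy le_rfl : ‖g i y‖ₑ ≤ supNorm B u (g i)).trans
      (Finset.single_le_sum (f := fun i => supNorm B u (g i)) (fun _ _ => zero_le)
        (Finset.mem_univ i))
  have h2 : 4 * (N : ℝ≥0∞) * supX B u * ‖g i y‖ₑ ≤ ENNReal.ofReal s :=
    (mul_le_mul_right h1 _).trans h.le
  have h3 := ENNReal.toReal_mono ENNReal.ofReal_ne_top h2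
  rw [ENNReal.toReal_ofReal hs] at h3
  simp only [ENNReal.toReal_mul, ENNReal.toReal_ofNat, ENNReal.toReal_natCast, toReal_enorm] at h3
  have hN0 : (0 : ℝ) < N := by positivity
  rw [div_div, one_div_mul_eq_div, le_div_iff₀ (by positivity)]
  linarith

theorem Scheme.exists_lieComp (h : Scheme B u H₀ f X W E ε N) :
    ∃ χ : ℕ → Phase n m → ℂ, IsLieComposition B N u u.third (lieComp χ N) ∧
      ∃ G : Phase n m → ℂ, lieComp χ N (fun z => H₀ (toActions z) + f z) =
          (fun z => H₀ (toActions z) + G z) ∧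
        Bd B (u.scale (7 / 12)) (8 * firstError n m u X W E ε / 4 ^ N) (fun z => G z - avg G z) ∧
        Bd B (u.scale (7 / 12)) (3 * firstError n m u X W E ε) (fun z => avg G z - avg f z) := by
  have hN := h.one_le
  have hu := h.freq.pos
  have hρ := h.firstError_nonneg
  obtain ⟨k, rfl⟩ : ∃ k, N = k + 1 := ⟨N - 1, by omega⟩
  obtain ⟨χ, hχ, G, hcomp, hG, hD⟩ := h.iterate k (by omega)
  rw [stepWidth_self hN] at hG hD
  refine ⟨χ, ⟨fun i => u.scale (lieWidth (k + 1) i), χ, ?_, ?_, fun i hi => ⟨?_, hχ i (by omega)⟩,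
    rfl⟩, G, hcomp, ?_, ?_⟩
  · beta_reduce
    rw [lieWidth_of_lt (by omega), stepWidth_zero, Width.scale_one]
  · beta_reduce
    rw [lieWidth_self, Width.third_eq]
  · refine Width.scale_le hu ?_
    rw [lieWidth_of_lt hi]
    exact (lieWidth_succ_le hi).trans (stepWidth_succ_lt hN).le
  -- After `N` steps the index of the iteration is `N - 1`, so `2ρ/4^{N-1} = 8ρ/4^N`.
  · exact hG.bd.mono (by rw [pow_succ]; apply le_of_eq; field_simp; ring)
  · refine hD.mono (sub_le_self _ (by positivity))

theorem IsLieComposition.isHol {Ψ : (Phase n m → ℂ) → Phase n m → ℂ}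
    (h : IsLieComposition B N u v Ψ) {g : Phase n m → ℂ} (hg : IsHol B u g) :
    IsHol B v (Ψ g) := by
  obtain ⟨w, χ, rfl, rfl, hw, rfl⟩ := h
  exact IsHol.lieComp (fun i hi => (hw i hi).2) hg

theorem third_lt (hu : u.Pos) : u.third.Lt u := by
  obtain ⟨h1, h2, h3, h4, h5⟩ := hu
  refine ⟨?_, ?_, ?_, ?_, ?_⟩ <;> simp only [Width.third] <;> linarith

theorem third_pos (hu : u.Pos) : u.third.Pos := by
  obtain ⟨h1, h2, h3, h4, h5⟩ := hu
  refine ⟨?_, ?_, ?_, ?_, ?_⟩ <;> simp only [Width.third] <;> linarith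

theorem iterate_poisson_zero (g : Phase n m → ℂ) (j : ℕ) :
    (poisson (fun _ => 0))^[j + 1] g = fun _ => 0 := by
  rw [Function.iterate_succ_apply']
  funext z
  simp [poisson]

theorem lieExp_zero (g : Phase n m → ℂ) : lieExp (fun _ => 0) g = g := by
  funext z
  rw [lieExp, tsum_eq_single 0]
  · simp
  · intro j hj
    obtain ⟨j, rfl⟩ := Nat.exists_eq_succ_of_ne_zero hj
    rw [Nat.succ_eq_add_one, iterate_poisson_zero, mul_zero]

theorem lieComp_zero (N : ℕ) (g : Phase n m → ℂ) : lieComp (fun _ _ => 0) N g = g := by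
  induction N with
  | zero => rfl
  | succ N ih => rw [lieComp, ih, lieExp_zero]

theorem norm_zero_fun (B : BaseSets n) (v : Width) : norm B v (fun _ : Phase n m => 0) = 0 := by
  simp [norm, coeff]

theorem average_zero (δ : ℝ) : average δ (fun _ : Phase n m => 0) = fun _ => 0 := by
  funext z
  simp [average, coeff]

theorem isHol_zero (hu : u.Pos) : IsHol B u (fun _ : Phase n m => 0) := by
  obtain ⟨h1, h2, h3, h4, h5⟩ := hu
  refine ⟨⟨u.r + 1, u.ρ + 1, u.ξ + 1, u.s + 1, u.δ + 1⟩, ⟨?_, ?_, ?_, ?_, ?_⟩,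
    differentiableOn_const _, fun _ _ _ => rfl⟩ <;> exact lt_add_one _

theorem generatesLieMap_zero (hv : v.Pos) (hvw : v.Le w) :
    GeneratesLieMap B w v (fun _ : Phase n m => 0) := by
  refine ⟨⟨isHol_zero hv, fun z _ => by rw [average_zero]⟩, fun g hg => ?_⟩
  have hg' := hg.mono hvw
  rw [lieExp_zero]
  refine ⟨?_, hg'⟩
  rw [tsum_eq_single 0]
  · simpa using hg'.norm_lt_top hv
  · intro j hj
    obtain ⟨j, rfl⟩ := Nat.exists_eq_succ_of_ne_zero hj
    rw [Nat.succ_eq_add_one, iterate_poisson_zero, norm_zero_fun, ENNReal.zero_div]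

theorem isLieComposition_zero (hu : u.Pos) (hN : 1 ≤ N) :
    IsLieComposition B N u u.third (lieComp (fun _ (_ : Phase n m) => 0) N) := by
  have hlt := third_lt hu
  refine ⟨fun i => if i = 0 then u else u.third, fun _ _ => 0, if_pos rfl, if_neg (by omega),
    fun i _ => ?_, rfl⟩
  have hle : (if i + 1 = 0 then u else u.third).Le (if i = 0 then u else u.third) := by
    rw [if_neg (Nat.succ_ne_zero i)]
    split_ifs
    · exact hlt.le
    · exact ⟨le_rfl, le_rfl, le_rfl, le_rfl, le_rfl⟩
  refine ⟨hle, generatesLieMap_zero ?_ hle⟩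
  beta_reduce
  rw [if_neg (Nat.succ_ne_zero i)]
  exact third_pos hu

theorem IsHol.average_eq_avg_of_scale (hu : u.Pos) (hf : IsHol B u f) {z : Phase n m}
    (hz : z ∈ strip m B (u.scale (7 / 12))) : average u.δ f z = avg f z := by
  have hle := Width.scale_le hu (by norm_num : (7 / 12 : ℝ) ≤ 1)
  rw [Width.scale_one] at hle
  exact (hf.average_eq_avg hu (strip_subset_domain B u (strip_mono B hle hz))).1

/-- The threshold of the normal form theorem. -/
def normalFormConst (n m : ℕ) : ℝ :=
  10 ^ 9 * bracketConst n m ^ 2 * (1 + taylorSum m (8 / 11))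

theorem one_le_normalFormConst (n m : ℕ) : 1 ≤ normalFormConst n m := by
  have h1 := bracketConst_ge (n := n) (m := m)
  have h2 : 0 ≤ taylorSum m (8 / 11) := taylorSum_nonneg (by norm_num)
  have h3 : 1 ≤ bracketConst n m ^ 2 := one_le_pow₀ (by linarith)
  rw [normalFormConst]
  nlinarith

theorem firstError_le (hC : 0 ≤ X * W / u.frakd * ε * E) :
    taylorSum m (8 / 11) * (3 * firstError n m u X W E ε) ≤
      normalFormConst n m * (X * W / u.frakd * ε * E) := by
  have h1 := bracketConst_ge (n := n) (m := m)
  have h2 : 0 ≤ taylorSum m (8 / 11) := taylorSum_nonneg (by norm_num)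
  rw [firstError, normalFormConst]
  calc _ = 15552 * bracketConst n m * taylorSum m (8 / 11) * (X * W / u.frakd * ε * E) := by ring
    _ ≤ _ := by
      refine mul_le_mul_of_nonneg_right ?_ hC
      have h3 : bracketConst n m * taylorSum m (8 / 11) ≤
          bracketConst n m ^ 2 * (1 + taylorSum m (8 / 11)) := by
        rw [sq, mul_assoc]
        refine mul_le_mul_of_nonneg_left ?_ (by linarith)
        nlinarith
      have h4 : 0 ≤ bracketConst n m * taylorSum m (8 / 11) := by positivity
      linarith

/-- Smallness absorbs the constants into `8 T ρ ≤ E/2`, where `T` is the Taylor sum and `ρ` the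
first error. The rate `4^{-N}` is more than the required `2^{-N}`. -/
theorem remainder_le (hN : 1 ≤ N) (hκ : 0 ≤ X * W / u.frakd) (hε : 0 ≤ ε) (hεE : ε ≤ E)
    (hsmall : normalFormConst n m * (N * (X * W / u.frakd) * E) ≤ 1) :
    taylorSum m (8 / 11) * (8 * firstError n m u X W E ε / 4 ^ N) ≤ E / 2 ^ (N + 1) := by
  have hE : 0 ≤ E := hε.trans hεE
  have h1 : X * W / u.frakd * ε * E ≤ N * (X * W / u.frakd) * E * E := by
    have hN1 : (1 : ℝ) ≤ N := by exact_mod_cast hN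
    have : X * W / u.frakd * ε ≤ N * (X * W / u.frakd) * E := by
      refine mul_le_mul (le_mul_of_one_le_left hκ hN1) hεE hε (by positivity)
    exact mul_le_mul_of_nonneg_right this hE
  have h2 := bracketConst_ge (n := n) (m := m)
  have h3 : 0 ≤ taylorSum m (8 / 11) := taylorSum_nonneg (by norm_num)
  set T := taylorSum m (8 / 11)
  set κ := X * W / u.frakd with hκd
  have h4 : bracketConst n m * T ≤ bracketConst n m ^ 2 * (1 + T) := by
    rw [sq, mul_assoc]
    refine mul_le_mul_of_nonneg_left ?_ (by linarith)
    nlinarith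
  have h5 : T * (8 * firstError n m u X W E ε) ≤ E / 2 := by
    calc T * (8 * firstError n m u X W E ε)
        = 41472 * (bracketConst n m * T * (κ * ε * E)) := by rw [firstError]; ring
      _ ≤ 41472 * (bracketConst n m ^ 2 * (1 + T) * (N * κ * E * E)) := by
        gcongr
      _ = 41472 / 10 ^ 9 * (normalFormConst n m * (N * κ * E)) * E := by
        rw [normalFormConst]; ring
      _ ≤ 41472 / 10 ^ 9 * 1 * E := by gcongr
      _ ≤ E / 2 := by linarith
  have h6 : (2 : ℝ) ^ N ≤ 4 ^ N := pow_le_pow_left₀ (by norm_num) (by norm_num) N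
  calc _ = T * (8 * firstError n m u X W E ε) / 4 ^ N := by ring
    _ ≤ E / 2 / 2 ^ N := div_le_div₀ (by positivity) h5 (by positivity) h6
    _ = _ := by rw [pow_succ]; field_simp

end Conclusion

/-! ### The normal form -/

section NormalFormTheorem

variable {n m : ℕ} {B : BaseSets n} {u : Width} {H₀ : Actions n m → ℂ} {f : Phase n m → ℂ} {N : ℕ}

/-- The conclusion of the normal form lemma, with constant `c`. -/
def HasNormalForm (B : BaseSets n) (u : Width) (H₀ : Actions n m → ℂ) (f : Phase n m → ℂ)
    (N : ℕ) (c : ℝ) : Prop :=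
  ∃ Ψ : (Phase n m → ℂ) → (Phase n m → ℂ), IsLieComposition B N u u.third Ψ ∧
    ∃ H₁ f_N : Phase n m → ℂ, IsNormal B u.third H₁ ∧ IsHol B u.third f_N ∧
      (∀ z ∈ domain m B u.third, Ψ (fun z' => H₀ (toActions z') + f z') z =
        H₀ (toActions z) + H₁ z + f_N z) ∧
      norm B u.third (fun z => H₁ z - average u.δ f z) ≤
        ENNReal.ofReal c * (supX B u / ENNReal.ofReal u.frakd) *
          supNorm B u (fun y => 1 / omegaR H₀ y) * norm B u (offAverage u.δ f) * norm B u f ∧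
      norm B u.third f_N ≤ norm B u f / 2 ^ (N + 1)

/-- The degenerate case is settled by the identity transformation, with zero generators, `H₁ = 0`
and `f` itself as remainder. -/
theorem hasNormalForm_of_norm_eq_zero (hu : u.Pos) (hf : IsHol B u f) (hN : 1 ≤ N) (c : ℝ)
    (h0 : norm B u f = 0) : HasNormalForm B u H₀ f N c := by
  have hlt := third_lt hu
  have hle := Width.scale_le hu (by norm_num : (7 / 12 : ℝ) ≤ 1)
  rw [Width.scale_one] at hle
  have hf' := hf.bd hu
  rw [h0, ENNReal.toReal_zero] at hf'
  have hzero : ∀ g : Phase n m → ℂ, Bd B (u.scale (7 / 12)) 0 g → norm B u.third g = 0 :=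
    fun g hg => by simpa using hg.norm_third_le hu
  refine ⟨_, isLieComposition_zero hu hN, fun _ => 0, f, ?_, hf.mono hlt.le, fun z _ => ?_, ?_, ?_⟩
  · exact ⟨isHol_zero (third_pos hu), fun z _ => by rw [average_zero]⟩
  · rw [lieComp_zero]
    ring
  · refine (hzero _ ?_).trans_le zero_le
    have := (((hf'.avg hu).mono_width hle).const_mul (-1)).congr (g := fun z => 0 - average u.δ f z)
      fun z hz => by rw [hf.average_eq_avg_of_scale hu hz]; ring
    simpa using this
  · exact (hzero f (hf'.mono_width hle)).trans_le zero_le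

theorem hasNormalForm_of_scheme {W : ℝ}
    (hf : IsHol B u f) (hW : supNorm B u (fun y => 1 / omegaR H₀ y) = ENNReal.ofReal W)
    (h : Scheme B u H₀ f (supX B u).toReal W (norm B u f).toReal
      (norm B u (offAverage u.δ f)).toReal N)
    (hsmall : normalFormConst n m *
      (N * ((supX B u).toReal * W / u.frakd) * (norm B u f).toReal) ≤ 1) :
    HasNormalForm B u H₀ f N (normalFormConst n m) := by
  have hu := h.freq.pos
  have hd := Width.frakd_pos hu
  have hfin := hf.norm_lt_top hu
  have hfin' := (hf.norm_offAverage_le hu).trans_lt hfin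
  have hW0 := h.freq.nonneg_W
  have hc := one_le_normalFormConst n m
  have hle := Width.scale_le hu (by norm_num : (7 / 12 : ℝ) ≤ 1)
  rw [Width.scale_one] at hle
  have hlt : u.third.Lt (u.scale (7 / 12)) := by
    rw [Width.third_eq]; exact Width.scale_lt hu (by norm_num)
  obtain ⟨χ, hχ, G, hcomp, hG, hD⟩ := h.exists_lieComp
  have hGb : Bd B (u.scale (7 / 12)) _ G :=
    ((hG.add hD).add (((hf.bd hu).avg hu).mono_width hle)).congr fun z _ => by ring
  set X := (supX B u).toReal with hX
  set E := (norm B u f).toReal with hE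
  set ε := (norm B u (offAverage u.δ f)).toReal with hε
  have hX0 : 0 ≤ X := ENNReal.toReal_nonneg
  have hE0 : 0 ≤ E := ENNReal.toReal_nonneg
  have hε0 : 0 ≤ ε := ENNReal.toReal_nonneg
  have eX : supX B u = ENNReal.ofReal X := (ENNReal.ofReal_toReal (supX_ne_top B u)).symm
  have eE : norm B u f = ENNReal.ofReal E := (ENNReal.ofReal_toReal hfin.ne).symm
  have eε : norm B u (offAverage u.δ f) = ENNReal.ofReal ε :=
    (ENNReal.ofReal_toReal hfin'.ne).symm
  refine ⟨_, hχ, avg G, fun z => G z - avg G z, hGb.isNormal_avg (third_pos hu) hlt, hG.isHol hlt,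
    fun z _ => ?_, ?_, ?_⟩
  · rw [hcomp]
    ring
  · have hD' : Bd B (u.scale (7 / 12)) (3 * firstError n m u X W E ε)
        (fun z => avg G z - average u.δ f z) :=
      hD.congr fun z hz => by rw [hf.average_eq_avg_of_scale hu hz]
    refine (hD'.norm_third_le hu).trans ?_
    rw [hW, eX, eE, eε, ← ENNReal.ofReal_div_of_pos hd, ← ENNReal.ofReal_mul (by positivity),
      ← ENNReal.ofReal_mul (by positivity), ← ENNReal.ofReal_mul (by positivity),
      ← ENNReal.ofReal_mul (by positivity)]
    refine ENNReal.ofReal_le_ofReal ((firstError_le (by positivity)).trans (le_of_eq ?_))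
    ring
  · refine (hG.norm_third_le hu).trans ?_
    rw [eE, ← ENNReal.ofReal_ofNat 2, ← ENNReal.ofReal_pow (by norm_num),
      ← ENNReal.ofReal_div_of_pos (by positivity)]
    exact ENNReal.ofReal_le_ofReal (remainder_le h.one_le (by positivity) hε0 h.le hsmall)

theorem hasNormalForm (hu : u.Pos)
    (hH : IsHol B u (fun z : Phase n m => H₀ (toActions z))) (hf : IsHol B u f)
    (hne : ∀ y ∈ actionDomain m B u, omegaR H₀ y ≠ 0) (hN : 1 ≤ N)
    (hI : 4 * (N : ℝ≥0∞) * supX B u * (∑ i, supNorm B u (fun y => omegaI H₀ i y / omegaR H₀ y)) <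
      ENNReal.ofReal u.s)
    (hJ : 4 * (N : ℝ≥0∞) * supX B u * (∑ l, supNorm B u (fun y => omegaJ H₀ l y / omegaR H₀ y)) <
      1)
    (hsmall : ENNReal.ofReal (normalFormConst n m) * (N : ℝ≥0∞) *
      (supX B u / ENNReal.ofReal u.frakd) * supNorm B u (fun y => 1 / omegaR H₀ y) * norm B u f <
      1) :
    HasNormalForm B u H₀ f N (normalFormConst n m) := by
  have hd := Width.frakd_pos hu
  have hc := one_le_normalFormConst n m
  have hfin := hf.norm_lt_top hu
  -- `1/ω_r` may be unbounded although `ω_r` has no zero. Then `⊤` times anything nonzero is `⊤`, so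
  -- the smallness condition forces `‖f‖ = 0`; this needs `𝒳 > 0`.
  by_cases hS : supNorm B u (fun y => 1 / omegaR H₀ y) = ⊤
  · refine hasNormalForm_of_norm_eq_zero hu hf hN _ ?_
    by_contra h0
    have hN0 : (N : ℝ≥0∞) ≠ 0 := by exact_mod_cast (by omega : N ≠ 0)
    have hc0 : ENNReal.ofReal (normalFormConst n m) ≠ 0 := by
      rw [ne_eq, ENNReal.ofReal_eq_zero]; linarith
    have hX : supX B u / ENNReal.ofReal u.frakd ≠ 0 :=
      ENNReal.div_ne_zero.2 ⟨supX_ne_zero B hu, ENNReal.ofReal_ne_top⟩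
    rw [hS, ENNReal.mul_top (mul_ne_zero (mul_ne_zero hc0 hN0) hX), ENNReal.top_mul h0] at hsmall
    exact not_top_lt hsmall
  · have hsmall' : normalFormConst n m * (N * ((supX B u).toReal *
        (supNorm B u (fun y => 1 / omegaR H₀ y)).toReal / u.frakd) * (norm B u f).toReal) ≤ 1 := by
      have := ENNReal.toReal_mono ENNReal.one_ne_top hsmall.le
      simp only [ENNReal.toReal_mul, ENNReal.toReal_div, ENNReal.toReal_natCast,
        ENNReal.toReal_one, ENNReal.toReal_ofReal hd.le,
        ENNReal.toReal_ofReal (zero_le_one.trans hc)] at this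
      refine le_trans (le_of_eq ?_) this
      ring
    refine hasNormalForm_of_scheme hf (ENNReal.ofReal_toReal hS).symm
      ⟨hN, ⟨hu, hH, hne, fun x hx => ?_, fun y hy => ?_, fun y hy i => ?_, fun y hy l => ?_⟩,
        hf.bd hu, hf.zbd_sub_avg hu, ?_, ?_⟩ hsmall'
    · rw [← toReal_enorm]
      exact ENNReal.toReal_mono (supX_ne_top B u) (le_iSup₂_of_le x hx le_rfl)
    · rw [← one_div]
      exact norm_le_toReal_supNorm hS hy
    · exact mul_norm_le_of_sum_lt hN hu.2.2.2.1.le hI hy i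
    · rw [← ENNReal.ofReal_one] at hJ
      simpa only [mul_one] using mul_norm_le_of_sum_lt hN zero_le_one hJ hy l
    · exact ENNReal.toReal_mono hfin.ne (hf.norm_offAverage_le hu)
    · refine le_trans ?_ hsmall'
      have hT : 0 ≤ taylorSum m (8 / 11) := taylorSum_nonneg (by norm_num)
      refine mul_le_mul_of_nonneg_right ?_ (by positivity)
      rw [normalFormConst]
      exact le_mul_of_one_le_right (by positivity) (by linarith)

end NormalFormTheorem

end NormalForm

end

theorem lemma1 (n m : ℕ) :
    ∃ c : ℝ, 1 ≤ c ∧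
      ∀ (B : NormalForm.BaseSets n) (u : NormalForm.Width), u.Pos →
      ∀ (H₀ : NormalForm.Actions n m → ℂ) (f : NormalForm.Phase n m → ℂ),
        NormalForm.IsHol B u (fun z : NormalForm.Phase n m => H₀ (NormalForm.toActions z)) →
        NormalForm.IsHol B u f →
        (∀ y ∈ NormalForm.actionDomain m B u, NormalForm.omegaR H₀ y ≠ 0) →
      ∀ N : ℕ, 1 ≤ N →
        4 * (N : ENNReal) * NormalForm.supX B u *
            (∑ i, NormalForm.supNorm B u
              (fun y => NormalForm.omegaI H₀ i y / NormalForm.omegaR H₀ y))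
          < ENNReal.ofReal u.s →
        4 * (N : ENNReal) * NormalForm.supX B u *
            (∑ l, NormalForm.supNorm B u
              (fun y => NormalForm.omegaJ H₀ l y / NormalForm.omegaR H₀ y))
          < 1 →
        ENNReal.ofReal c * (N : ENNReal) * (NormalForm.supX B u / ENNReal.ofReal u.frakd) *
            NormalForm.supNorm B u (fun y => 1 / NormalForm.omegaR H₀ y) *
            NormalForm.norm B u f
          < 1 →
        ∃ Ψ : (NormalForm.Phase n m → ℂ) → (NormalForm.Phase n m → ℂ),
          NormalForm.IsLieComposition B N u u.third Ψ ∧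
          (∀ g, NormalForm.IsHol B u g → NormalForm.IsHol B u.third (Ψ g)) ∧
          ∃ H₁ f_N : NormalForm.Phase n m → ℂ,
            NormalForm.IsNormal B u.third H₁ ∧
            NormalForm.IsHol B u.third f_N ∧
            (∀ z ∈ NormalForm.domain m B u.third,
              Ψ (fun z' => H₀ (NormalForm.toActions z') + f z') z
                = H₀ (NormalForm.toActions z) + H₁ z + f_N z) ∧
            NormalForm.norm B u.third (fun z => H₁ z - NormalForm.average u.δ f z)
              ≤ ENNReal.ofReal c * (NormalForm.supX B u / ENNReal.ofReal u.frakd) *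
                  NormalForm.supNorm B u (fun y => 1 / NormalForm.omegaR H₀ y) *
                  NormalForm.norm B u (NormalForm.offAverage u.δ f) *
                  NormalForm.norm B u f ∧
            NormalForm.norm B u.third f_N ≤ NormalForm.norm B u f / 2 ^ (N + 1) := by
  refine ⟨NormalForm.normalFormConst n m, NormalForm.one_le_normalFormConst n m, ?_⟩
  intro B u hu H₀ f hH hf hne N hN hI hJ hsmall
  obtain ⟨Ψ, hΨ, H₁, f_N, h1, h2, h3, h4, h5⟩ :=
    NormalForm.hasNormalForm hu hH hf hne hN hI hJ hsmall
  exact ⟨Ψ, hΨ, fun g hg => hΨ.isHol hg, H₁, f_N, h1, h2, h3, h4, h5⟩
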